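/- All alphabets are finite, $\log$ and $\exp$ have base $2$, $\log 0=-\infty$, $\log\infty=\infty$, and $|x|^+=\max\{x,0\}$. $\mathcal P(\mathcal X)$ denotes the set of probability distributions on $\mathcal X$. **Rényi quantities.** For nonnegative vectors $P,Q$ on a finite set, the order-$\alpha$ Rényi divergence is $D_\alpha(P\|Q)=-\log F_\alpha(P,Q)$, where $F_\alpha(P,Q)=\big(\sum_x P(x)^\alpha Q(x)^{1-\alpha}\big)^{1/(1-\alpha)}$ for $\alpha\in(0,1)\cup(1,\infty)$ (with $0/0=0$ and $a/0=\infty$ for $a>0$ when $\alpha>1$), $F_0(P,Q)=\sum_{x:P(x)>0}Q(x)$, $F_1(P,Q)=\prod_x (Q(x)/P(x))^{P(x)}$ (factors with $P(x)=0$ being $1$), and $F_\infty(P,Q)=\min_{x:P(x)>0}Q(x)/P(x)$. Let $\mathcal X$ be nonempty and let $\mathcal W:\mathcal X\to\mathcal Y$ be a discrete memoryless channel with transition probabilities $\mathcal W(y|x)$. For $P\in\mathcal P(\mathcal X)$ write $(P\cdot\mathcal W)(x,y)=P(x)\mathcal W(y|x)$. The order-$\alpha$ Rényi capacity, $\alpha\in[0,\infty]$,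 is $$I_\alpha(\mathcal W)=\max_{P\in\mathcal P(\mathcal X)}\ \min_{Q\in\mathcal P(\mathcal Y)} D_\alpha(P\cdot\mathcal W\,\|\,P\times Q).$$ **Simulation.** A channel $\mathcal N:\mathcal X\to\mathcal Y$ is a simulation with communication cost at most $c$ bits if there are an integer $M\ge1$ with $\log M\le c$, a finite set $\mathcal K$ with a distribution $P_K$ (shared randomness), and stochastic maps $\mathcal E:\mathcal X\times\mathcal K\to\{1,\dots,M\}$ and $\mathcal D:\{1,\dots,M\}\times\mathcal K\to\mathcal Y$ such that $$\mathcal N(y|x)=\sum_{k\in\mathcal K}\sum_{j=1}^{M}P_K(k)\,\mathcal E(j|x,k)\,\mathcal D(y|j,k).$$ Let $\mathsf D_\alpha(\mathcal W,c)$ be the minimum, over all such $\mathcal N$, of $\max_{P\in\mathcal P(\mathcal X)}D_\alpha(P\cdot\mathcal W\,\|\,P\cdot\mathcal N)$ (it is $\infty$ if $c<0$). With $\mathcal W^{\times n}$ denoting $n$ independent uses of $\mathcal W$, the reliability function is $$E_{\rm rf}^{(\alpha)}(\mathcal W,r)=\sup\Big\{\liminf_{n\to\infty}\frac{-1}{n}\log\mathsf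 D_\alpha(\mathcal W^{\times n},c_n)\ \Big|\ \limsup_{n\to\infty}\frac{c_n}{n}\le r\Big\},$$ the supremum being over real sequences $(c_n)_{n\ge1}$. **Theorem 2.** For every discrete memoryless channel $\mathcal W:\mathcal X\to\mathcal Y$: 1. If $0\le r<I_\infty(\mathcal W)$, then $$E_{\rm rf}^{(\alpha)}(\mathcal W,r)=\begin{cases}\sup\limits_{\beta\ge1}(\beta-1)\big(r-I_\beta(\mathcal W)\big),&\alpha\in(0,1],\\[4pt]\Big|\sup\limits_{\beta\ge\alpha}(\beta-1)\big(r-I_\beta(\mathcal W)\big)\Big|^+,&\alpha\in(1,\infty],\end{cases}$$ where $\beta$ ranges over extended reals up to and including $\infty$, and the term for $\beta=\infty$ is $-\infty$ (so the value for $\alpha=\infty$ is $0$). 2. If $r\ge I_\infty(\mathcal W)$, then $E_{\rm rf}^{(\alpha)}(\mathcal W,r)=\infty$ for every $\alpha\in[0,\infty]$. 3. For $\alpha=0$: $E_{\rm rf}^{(0)}(\mathcal W,r)=\infty$ if $r>I_0(\mathcal W)$, and $E_{\rm rf}^{(0)}(\mathcal W,r)=0$ if $0\le r<I_0(\mathcal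 W)$. -/

import Mathlib

open Filter
open scoped ENNReal

noncomputable section

namespace ChannelSimulation

/-- Logarithm to base `2` on `[0, ∞]`, with `log 0 = -∞` and `log ∞ = ∞`. -/
def log2 (x : ℝ≥0∞) : EReal := ENNReal.log x / ((Real.log 2 : ℝ) : EReal)

/-- Order-`α` fidelity of two nonnegative vectors on a finite alphabet, `α ∈ [0, ∞]`.
The arithmetic of `[0, ∞]` supplies the conventions `0 / 0 = 0` and `a / 0 = ∞` (`a > 0`)
for `P ^ α * Q ^ (1 - α)` when `α > 1`. -/
def fidelity {ι : Type*} [Fintype ι] (α : ℝ≥0∞) (P Q : ι → ℝ≥0∞) : ℝ≥0∞ :=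
  if α = 0 then ∑ x, (Function.support P).indicator Q x
  else if α = 1 then ∏ x, (Q x / P x) ^ (P x).toReal
  else if α = ∞ then ⨅ x ∈ Function.support P, Q x / P x
  else (∑ x, P x ^ α.toReal * Q x ^ (1 - α.toReal)) ^ (1 / (1 - α.toReal))

/-- Order-`α` Rényi divergence (in bits). -/
def renyiDiv {ι : Type*} [Fintype ι] (α : ℝ≥0∞) (P Q : ι → ℝ≥0∞) : EReal :=
  -log2 (fidelity α P Q)

/-- A discrete memoryless channel: `W x y` is the probability of output `y` on input `x`. -/
abbrev Channel (X Y : Type*) := X → PMF Y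

/-- The joint distribution `P · W` of input and output. -/
def joint {X Y : Type*} (P : PMF X) (W : Channel X Y) : X × Y → ℝ≥0∞ :=
  fun z => P z.1 * W z.1 z.2

/-- The product distribution `P × Q`. -/
def prodDist {X Y : Type*} (P : PMF X) (Q : PMF Y) : X × Y → ℝ≥0∞ :=
  fun z => P z.1 * Q z.2

/-- Rényi mutual information of order `α` of the joint distribution `P · W`. -/
def mutualInfo {X Y : Type*} [Fintype X] [Fintype Y] (α : ℝ≥0∞) (P : PMF X)
    (W : Channel X Y) : EReal :=
  ⨅ Q : PMF Y, renyiDiv α (joint P W) (prodDist P Q)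

/-- Rényi capacity of order `α`. -/
def capacity {X Y : Type*} [Fintype X] [Fintype Y] (α : ℝ≥0∞) (W : Channel X Y) : EReal :=
  ⨆ P : PMF X, mutualInfo α P W

/-- `n` independent uses of `W`. -/
def power {X Y : Type*} [Fintype Y] (W : Channel X Y) (n : ℕ) :
    Channel (Fin n → X) (Fin n → Y) := fun x =>
  PMF.ofFintype (fun y => ∏ i, W (x i) (y i)) (by
    classical
    rw [← Fintype.prod_sum (fun i b => W (x i) b)]
    exact Finset.prod_eq_one fun i _ => by simpa [tsum_fintype] using (W (x i)).tsum_coe)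

/-- `N` is realised by a simulation with shared randomness and at most `c` bits of
communication: the parties share `k ∼ PK`, the sender applies the stochastic map `E` to `(x, k)`
and sends the resulting symbol `j`, one of `M`, and the receiver applies the stochastic map `D`
to `(j, k)`. -/
def IsSimulation {X Y : Type*} (N : Channel X Y) (c : ℝ) : Prop :=
  ∃ M : ℕ, 1 ≤ M ∧ Real.logb 2 M ≤ c ∧
    ∃ (K : Type) (_ : Fintype K) (PK : PMF K)
      (E : Channel (X × K) (Fin M)) (D : Channel (Fin M × K) Y),
      ∀ x y, N x y = ∑ k, ∑ j, PK k * E (x, k) j * D (j, k) y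

/-- Order-`α` Rényi divergence between two channels. -/
def channelDiv {X Y : Type*} [Fintype X] [Fintype Y] (α : ℝ≥0∞) (W N : Channel X Y) : EReal :=
  ⨆ P : PMF X, renyiDiv α (joint P W) (joint P N)

/-- Least order-`α` divergence from `W` of a simulation using at most `c` bits. -/
def simDiv {X Y : Type*} [Fintype X] [Fintype Y] (α : ℝ≥0∞) (W : Channel X Y) (c : ℝ) : EReal :=
  ⨅ (N : Channel X Y) (_ : IsSimulation N c), channelDiv α W N

/-- The reliability function: the best exponential rate of decay of the simulation divergence of
`n` uses of `W`, over all sequences of communication costs of rate at most `r`. Since `simDiv`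
is nonnegative, `toENNReal` only changes its type. -/
def reliability {X Y : Type*} [Fintype X] [Fintype Y] (α : ℝ≥0∞) (W : Channel X Y)
    (r : ℝ) : EReal :=
  ⨆ (c : ℕ → ℝ) (_ : limsup (fun n : ℕ => ((c n / n : ℝ) : EReal)) atTop ≤ (r : EReal)),
    liminf (fun n : ℕ =>
      ((-1 / n : ℝ) : EReal) * log2 (simDiv α (power W n) (c n)).toENNReal) atTop

end ChannelSimulation

end

/-!
A simulation `N` with `M` messages satisfies `N(y|x) ≤ M q(y)` for some output distribution `q`.
Conversely, rejection sampling of proposals drawn from `q` simulates, with slightly more than `M`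
messages and a superexponentially small error, every subchannel dominated by `M q`. The question is
therefore how much of `W^n` survives when its likelihood ratio to an output distribution is
truncated at `2^{nr}`.

Achievability: by minimax, for each order `β` one output distribution `q` is good for all inputs,
and truncating at `2^{nr}` the ratio of `W^n` to the `n`-fold product of `q` costs, by a Chernoff
bound, a mass of exponent at least `(β - 1)(r - I_β)`.

Converse: `(β - 1) I_β(P, W)` is concave in the input `P`, and convex and differentiable in `β`. By
minimax over inputs and orders there is one `P` for which `(β - 1)(r - I_β(P, W))` is bounded, at
all orders at once, by essentially the claimed exponent. An arbitrary output distribution is first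
mixed with the optimal outputs of two orders on either side of the maximiser. Comparing the
affinities to this mixture at three nearby orders shows that a mass of the claimed exponent lies
where the likelihood ratio exceeds `2^{nr}` by an exponential factor. There `N ≤ M q` keeps `N` far
below `W^n`, whatever the simulation, so that this mass is lost and bounds the divergence below.

The supports of the rows (order `0`) and the maxima of the columns (order `∞`) tensorise exactly,
which settles the two extreme orders.
-/

noncomputable section

namespace ChannelSimulation

open Real Topology

/-! ### Minimax -/

-- `F` need not be compact, so Mathlib's saddle point theorems do not apply: compactness of `S`
-- reduces the claim to finitely many `y`, for which Sion's argument is available.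
theorem exists_forall_le_of_forall_exists_le {E F β : Type*}
    [TopologicalSpace E] [AddCommGroup E] [Module ℝ E] [IsTopologicalAddGroup E]
    [ContinuousSMul ℝ E] [TopologicalSpace F] [AddCommGroup F] [Module ℝ F]
    [IsTopologicalAddGroup F] [ContinuousSMul ℝ F] [LinearOrder β] [DenselyOrdered β]
    {S : Set E} {T : Set F} {f : E → F → β} {C : β}
    (neS : S.Nonempty) (cS : Convex ℝ S) (kS : IsCompact S) (cT : Convex ℝ T)
    (hlsc : ∀ y ∈ T, LowerSemicontinuousOn (fun x => f x y) S)
    (hconv : ∀ y ∈ T, QuasiconvexOn ℝ S fun x => f x y)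
    (husc : ∀ x ∈ S, UpperSemicontinuousOn (fun y => f x y) T)
    (hconc : ∀ x ∈ S, QuasiconcaveOn ℝ T fun y => f x y)
    (h : ∀ y ∈ T, ∃ x ∈ S, f x y ≤ C) : ∃ x ∈ S, ∀ y ∈ T, f x y ≤ C := by
  by_contra! hne
  have hopen : ∀ y : T, ∃ U : Set E, IsOpen U ∧ S ∩ {x | C < f x y} = S ∩ U := fun y =>
    lowerSemicontinuousOn_iff_preimage_Ioi.mp (hlsc y y.2) C
  choose U hUo hU using hopen
  have hcover : S ⊆ ⋃ y, U y := fun x hx =>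
    let ⟨y, hy, hxy⟩ := hne x hx
    Set.mem_iUnion.mpr ⟨⟨y, hy⟩, ((hU ⟨y, hy⟩).subset ⟨hx, hxy⟩).2⟩
  obtain ⟨t, ht⟩ := kS.elim_finite_subcover U hUo hcover
  have hfin : ∀ x ∈ S, ∃ y ∈ ((↑) : T → F) '' (t : Set T), C < f x y := by
    intro x hx
    obtain ⟨y, hyt, hxy⟩ : ∃ y ∈ t, x ∈ U y := by simpa using ht hx
    exact ⟨y, ⟨y, hyt, rfl⟩, ((hU y).symm.subset ⟨hx, hxy⟩).2⟩
  obtain ⟨y, hy, hyC⟩ := Sion.exists_lt_iInf_of_lt_iInf_of_finite neS kS hlsc hconv cT husc hconc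
    cS (t.finite_toSet.image _) (by rintro _ ⟨y, _, rfl⟩; exact y.2) hfin
  obtain ⟨x, hx, hxC⟩ := h y hy
  exact hxC.not_gt (hyC x hx)

/-! ### Power inequalities -/

section Affinity

variable {ι : Type*}

theorem sum_rpow_mul_rpow_le (s : Finset ι) {f g : ι → ℝ} {a b : ℝ} (hf : ∀ i ∈ s, 0 ≤ f i)
    (hg : ∀ i ∈ s, 0 ≤ g i) (ha : 0 < a) (hb : 0 < b) (hab : a + b = 1) :
    ∑ i ∈ s, f i ^ a * g i ^ b ≤ (∑ i ∈ s, f i) ^ a * (∑ i ∈ s, g i) ^ b := by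
  have holder := inner_le_Lp_mul_Lq_of_nonneg s (HolderConjugate.inv_inv ha hb hab)
    (fun i hi => rpow_nonneg (hf i hi) a) (fun i hi => rpow_nonneg (hg i hi) b)
  rw [one_div, one_div, inv_inv, inv_inv] at holder
  rwa [Finset.sum_congr rfl fun i hi => rpow_rpow_inv (hf i hi) ha.ne',
    Finset.sum_congr rfl fun i hi => rpow_rpow_inv (hg i hi) hb.ne'] at holder

theorem convexOn_rpow_of_nonpos {s : ℝ} (hs : s ≤ 0) :
    ConvexOn ℝ (Set.Ioi 0) fun x : ℝ => x ^ s := by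
  refine ⟨convex_Ioi 0, fun x (hx : 0 < x) y (hy : 0 < y) a b ha hb hab => ?_⟩
  calc (a * x + b * y) ^ s ≤ (x ^ a * y ^ b) ^ s :=
        rpow_le_rpow_of_nonpos (by positivity)
          (geom_mean_le_arith_mean2_weighted ha hb hx.le hy.le hab) hs
    _ = (x ^ s) ^ a * (y ^ s) ^ b := by
        rw [mul_rpow (by positivity) (by positivity), ← rpow_mul hx.le, ← rpow_mul hx.le,
          ← rpow_mul hy.le, ← rpow_mul hy.le, mul_comm a, mul_comm b]
    _ ≤ a * x ^ s + b * y ^ s := geom_mean_le_arith_mean2_weighted ha hb (by positivity)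
        (by positivity) hab

/-- The affinity `∑ pᵃ q¹⁻ᵃ` of two vectors: its logarithm is `a - 1` times the Rényi divergence
of order `a`, measured in nats. For `a > 1` and `q i = 0 < p i` real powers make the `i`-th
term `0` instead of `∞`, so absolute continuity has to be assumed separately. -/
def affinity [Fintype ι] (a : ℝ) (p q : ι → ℝ) : ℝ := ∑ i, p i ^ a * q i ^ (1 - a)

variable [Fintype ι] {p q : ι → ℝ}

theorem affinity_nonneg (a : ℝ) (hp : ∀ i, 0 ≤ p i) (hq : ∀ i, 0 ≤ q i) : 0 ≤ affinity a p q :=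
  Finset.sum_nonneg fun i _ => mul_nonneg (rpow_nonneg (hp i) _) (rpow_nonneg (hq i) _)

theorem rpow_sum_le_affinity {b : ℝ} (hb : 1 ≤ b) (hp : ∀ i, 0 ≤ p i) (hq : ∀ i, 0 ≤ q i)
    (hpq : ∀ i, p i ≠ 0 → q i ≠ 0) (hq1 : ∑ i, q i ≤ 1) : (∑ i, p i) ^ b ≤ affinity b p q := by
  have hb0 : 0 < b := one_pos.trans_le hb
  have hmul : ∀ i, q i * (p i / q i) = p i := fun i =>
    mul_div_cancel_of_imp' (not_imp_not.mp (hpq i))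
  have hpow : ∀ i, q i * (p i / q i) ^ b = p i ^ b * q i ^ (1 - b) := by
    intro i
    rcases (hq i).eq_or_lt with h | h
    · have hpi : p i = 0 := not_imp_not.mp (hpq i) h.symm
      rw [hpi, zero_div, zero_rpow hb0.ne', mul_zero, zero_mul]
    · rw [div_rpow (hp i) h.le, rpow_sub h, rpow_one]
      ring
  have holder := inner_le_weight_mul_Lp_of_nonneg Finset.univ hb q (fun i => p i / q i) hq
    fun i => div_nonneg (hp i) (hq i)
  simp only [hmul, hpow] at holder
  refine (le_rpow_inv_iff_of_pos (Finset.sum_nonneg fun i _ => hp i)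
    (affinity_nonneg b hp hq) hb0).mp (holder.trans (mul_le_of_le_one_left ?_ ?_))
  · exact rpow_nonneg (affinity_nonneg b hp hq) _
  · exact rpow_le_one (Finset.sum_nonneg fun i _ => hq i) hq1
      (sub_nonneg.mpr (inv_le_one_of_one_le₀ hb))

theorem exists_pos_of_mem_stdSimplex (hp : p ∈ stdSimplex ℝ ι) : ∃ i, 0 < p i := by
  obtain ⟨i, -, hi⟩ := Finset.exists_lt_of_sum_lt (s := Finset.univ) (f := fun _ : ι => (0 : ℝ))
    (g := p) (by simp [hp.2])
  exact ⟨i, hi⟩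

end Affinity

/-! ### The Sibson functional -/

section Sibson

variable {X Y : Type*} [Fintype X]

/-- The `b`-th moment of the column `w · y` under the input distribution `P`. -/
def columnMoment (P : X → ℝ) (w : X → Y → ℝ) (b : ℝ) (y : Y) : ℝ := ∑ x, P x * w x y ^ b

variable {P : X → ℝ} {w : X → Y → ℝ}

theorem columnMoment_nonneg (hP : ∀ x, 0 ≤ P x) (hw : ∀ x y, 0 ≤ w x y) (b : ℝ) (y : Y) :
    0 ≤ columnMoment P w b y :=
  Finset.sum_nonneg fun x _ => mul_nonneg (hP x) (rpow_nonneg (hw x y) _)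

theorem columnMoment_pos (hP : ∀ x, 0 ≤ P x) (hw : ∀ x y, 0 ≤ w x y) (b : ℝ) {x : X} {y : Y}
    (h : P x * w x y ≠ 0) : 0 < columnMoment P w b y := by
  have hPx : 0 < P x := (hP x).lt_of_ne' (left_ne_zero_of_mul h)
  have hwx : 0 < w x y := (hw x y).lt_of_ne' (right_ne_zero_of_mul h)
  exact Finset.sum_pos' (fun x _ => mul_nonneg (hP x) (rpow_nonneg (hw x y) _))
    ⟨x, Finset.mem_univ _, by positivity⟩

theorem columnMoment_eq_zero {b : ℝ} (hb : b ≠ 0) {y : Y} (h : ∀ x, P x * w x y = 0) :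
    columnMoment P w b y = 0 := by
  refine Finset.sum_eq_zero fun x _ => ?_
  rcases mul_eq_zero.mp (h x) with h | h
  · rw [h, zero_mul]
  · rw [h, zero_rpow hb, mul_zero]

theorem columnMoment_convex_comb_le (hP : ∀ x, 0 ≤ P x) (hw : ∀ x y, 0 ≤ w x y) {b c s t : ℝ}
    (hb : 0 < b) (hc : 0 < c) (hs : 0 < s) (ht : 0 < t) (hst : s + t = 1) (y : Y) :
    columnMoment P w (s * b + t * c) y ≤ columnMoment P w b y ^ s * columnMoment P w c y ^ t := by
  refine (Finset.sum_le_sum fun x _ => le_of_eq ?_).trans (sum_rpow_mul_rpow_le Finset.univ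
    (fun x _ => mul_nonneg (hP x) (rpow_nonneg (hw x y) b))
    (fun x _ => mul_nonneg (hP x) (rpow_nonneg (hw x y) c)) hs ht hst)
  have hwpow : w x y ^ (s * b + t * c) = (w x y ^ b) ^ s * (w x y ^ c) ^ t := by
    rw [← rpow_mul (hw x y), ← rpow_mul (hw x y), mul_comm b, mul_comm c,
      rpow_add_of_nonneg (hw x y) (by positivity) (by positivity)]
  have hPpow : P x = P x ^ s * P x ^ t := by
    rw [← rpow_add_of_nonneg (hP x) hs.le ht.le, hst, rpow_one]
  rw [mul_rpow (hP x) (rpow_nonneg (hw x y) _), mul_rpow (hP x) (rpow_nonneg (hw x y) _),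
    mul_mul_mul_comm, ← hPpow, hwpow]

theorem differentiableAt_columnMoment (hw : ∀ x y, 0 ≤ w x y) {b : ℝ} (hb : 0 < b) (y : Y) :
    DifferentiableAt ℝ (fun b => columnMoment P w b y) b := by
  refine DifferentiableAt.fun_sum fun x _ => DifferentiableAt.const_mul ?_ _
  rcases (hw x y).eq_or_lt with h | h
  · have hzero : (fun b : ℝ => w x y ^ b) =ᶠ[𝓝 b] fun _ => 0 := by
      filter_upwards [lt_mem_nhds hb] with c hc
      rw [← h, zero_rpow hc.ne']
    exact (differentiableAt_const _).congr_of_eventuallyEq hzero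
  · exact (hasStrictDerivAt_const_rpow h b).hasDerivAt.differentiableAt

variable [Fintype Y]

/-- Sibson's functional: the sum of the `L^b(P)` norms of the columns of `w`. -/
def sibson (P : X → ℝ) (w : X → Y → ℝ) (b : ℝ) : ℝ := ∑ y, columnMoment P w b y ^ (1 / b)

/-- `b - 1` times the order-`b` Rényi mutual information (in nats) of `P · w`. Unlike the
information itself, it is differentiable in `b` across `b = 1`. -/
def scaledInfo (P : X → ℝ) (w : X → Y → ℝ) (b : ℝ) : ℝ := b * log (sibson P w b)

/-- The output distribution minimising the order-`b` divergence of `P · w` from `P × Q`. -/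
def sibsonOutput (P : X → ℝ) (w : X → Y → ℝ) (b : ℝ) (y : Y) : ℝ :=
  columnMoment P w b y ^ (1 / b) / sibson P w b

theorem sum_mul_affinity (b : ℝ) (P : X → ℝ) (w : X → Y → ℝ) (q : Y → ℝ) :
    ∑ x, P x * affinity b (w x) q = ∑ y, columnMoment P w b y * q y ^ (1 - b) := by
  simp only [affinity, columnMoment, Finset.mul_sum, Finset.sum_mul, mul_assoc]
  exact Finset.sum_comm

theorem sibson_pos (hP : P ∈ stdSimplex ℝ X) (hw : ∀ x, w x ∈ stdSimplex ℝ Y) (b : ℝ) :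
    0 < sibson P w b := by
  obtain ⟨x, hx⟩ := exists_pos_of_mem_stdSimplex hP
  obtain ⟨y, hy⟩ := exists_pos_of_mem_stdSimplex (hw x)
  exact Finset.sum_pos'
    (fun y _ => rpow_nonneg (columnMoment_nonneg hP.1 (fun x => (hw x).1) b y) _)
    ⟨y, Finset.mem_univ _,
      rpow_pos_of_pos (columnMoment_pos hP.1 (fun x => (hw x).1) b (mul_pos hx hy).ne') _⟩

theorem scaledInfo_one (hP : P ∈ stdSimplex ℝ X) (hw : ∀ x, w x ∈ stdSimplex ℝ Y) :
    scaledInfo P w 1 = 0 := by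
  have hsum : sibson P w 1 = 1 := by
    simp only [sibson, columnMoment, rpow_one, div_one]
    rw [Finset.sum_comm]
    simp only [← Finset.mul_sum, (hw _).2, mul_one, hP.2]
  rw [scaledInfo, hsum, log_one, mul_zero]

theorem exp_scaledInfo (hP : P ∈ stdSimplex ℝ X) (hw : ∀ x, w x ∈ stdSimplex ℝ Y) (b : ℝ) :
    exp (scaledInfo P w b) = sibson P w b ^ b := by
  rw [scaledInfo, rpow_def_of_pos (sibson_pos hP hw b), mul_comm]

theorem exp_scaledInfo_le (hP : P ∈ stdSimplex ℝ X) (hw : ∀ x, w x ∈ stdSimplex ℝ Y) {b : ℝ}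
    (hb : 1 ≤ b) {Q : Y → ℝ} (hQ : ∀ y, 0 ≤ Q y) (hQ1 : ∑ y, Q y ≤ 1)
    (hPQ : ∀ x y, P x * w x y ≠ 0 → Q y ≠ 0) :
    exp (scaledInfo P w b) ≤ ∑ x, P x * affinity b (w x) Q := by
  have hb0 : b ≠ 0 := (one_pos.trans_le hb).ne'
  have hnn := columnMoment_nonneg hP.1 (fun x => (hw x).1) b
  have hac : ∀ y, columnMoment P w b y ^ (1 / b) ≠ 0 → Q y ≠ 0 := by
    intro y hy hQy
    refine hy ?_
    rw [columnMoment_eq_zero hb0 fun x => not_imp_not.mp (hPQ x y) hQy,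
      zero_rpow (one_div_ne_zero hb0)]
  calc exp (scaledInfo P w b) = sibson P w b ^ b := exp_scaledInfo hP hw b
    _ ≤ affinity b (fun y => columnMoment P w b y ^ (1 / b)) Q :=
        rpow_sum_le_affinity hb (fun y => rpow_nonneg (hnn y) _) hQ hac hQ1
    _ = ∑ x, P x * affinity b (w x) Q := by
        rw [sum_mul_affinity]
        simp only [affinity, ← rpow_mul (hnn _), one_div_mul_cancel hb0, rpow_one]

theorem sibsonOutput_mem (hP : P ∈ stdSimplex ℝ X) (hw : ∀ x, w x ∈ stdSimplex ℝ Y) (b : ℝ) :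
    sibsonOutput P w b ∈ stdSimplex ℝ Y := by
  refine ⟨fun y => div_nonneg (rpow_nonneg (columnMoment_nonneg hP.1 (fun x => (hw x).1) b y) _)
    (sibson_pos hP hw b).le, ?_⟩
  simp only [sibsonOutput]
  rw [← Finset.sum_div]
  exact div_self (sibson_pos hP hw b).ne'

theorem sibsonOutput_pos (hP : P ∈ stdSimplex ℝ X) (hw : ∀ x, w x ∈ stdSimplex ℝ Y) (b : ℝ)
    {x : X} {y : Y} (h : P x * w x y ≠ 0) : 0 < sibsonOutput P w b y :=
  div_pos (rpow_pos_of_pos (columnMoment_pos hP.1 (fun x => (hw x).1) b h) _) (sibson_pos hP hw b)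

theorem sum_mul_affinity_sibsonOutput (hP : P ∈ stdSimplex ℝ X) (hw : ∀ x, w x ∈ stdSimplex ℝ Y)
    {b : ℝ} (hb : 0 < b) :
    ∑ x, P x * affinity b (w x) (sibsonOutput P w b) = exp (scaledInfo P w b) := by
  have hs := sibson_pos hP hw b
  have hterm : ∀ y, columnMoment P w b y * sibsonOutput P w b y ^ (1 - b) =
      columnMoment P w b y ^ (1 / b) * sibson P w b ^ (b - 1) := by
    intro y
    rcases (columnMoment_nonneg hP.1 (fun x => (hw x).1) b y).eq_or_lt with h | h
    · rw [← h, zero_mul, zero_rpow (by positivity), zero_mul]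
    · have hexp : 1 + 1 / b * (1 - b) = 1 / b := by field_simp; ring
      rw [sibsonOutput, div_rpow (by positivity) hs.le, ← rpow_mul h.le, div_eq_mul_inv,
        ← rpow_neg hs.le, ← mul_assoc, neg_sub, ← rpow_one_add' h.le (by rw [hexp]; positivity),
        hexp]
  calc ∑ x, P x * affinity b (w x) (sibsonOutput P w b)
      = sibson P w b * sibson P w b ^ (b - 1) := by
        simp only [sum_mul_affinity, hterm, ← Finset.sum_mul, sibson]
    _ = exp (scaledInfo P w b) := by
        rw [exp_scaledInfo hP hw, ← rpow_one_add' hs.le (by linarith), add_sub_cancel]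

theorem sibson_convex_comb_le (hP : ∀ x, 0 ≤ P x) (hw : ∀ x y, 0 ≤ w x y) {b c s t : ℝ}
    (hb : 0 < b) (hc : 0 < c) (hs : 0 < s) (ht : 0 < t) (hst : s + t = 1) :
    sibson P w (s * b + t * c) ≤ sibson P w b ^ (s * b / (s * b + t * c)) *
      sibson P w c ^ (t * c / (s * b + t * c)) := by
  have hnn := columnMoment_nonneg hP hw
  refine le_trans (Finset.sum_le_sum fun y _ => ?_) (sum_rpow_mul_rpow_le Finset.univ
    (fun y _ => rpow_nonneg (hnn b y) (1 / b)) (fun y _ => rpow_nonneg (hnn c y) (1 / c))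
    (by positivity) (by positivity) (by field_simp))
  refine (rpow_le_rpow (hnn _ y) (columnMoment_convex_comb_le hP hw hb hc hs ht hst y)
    (by positivity)).trans_eq ?_
  rw [mul_rpow (rpow_nonneg (hnn _ _) _) (rpow_nonneg (hnn _ _) _), ← rpow_mul (hnn _ _),
    ← rpow_mul (hnn _ _), ← rpow_mul (hnn _ _), ← rpow_mul (hnn _ _)]
  congr 2 <;> field_simp

theorem convexOn_scaledInfo (hP : P ∈ stdSimplex ℝ X) (hw : ∀ x, w x ∈ stdSimplex ℝ Y) :
    ConvexOn ℝ (Set.Ioi 0) (scaledInfo P w) := by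
  refine convexOn_iff_forall_pos.mpr
    ⟨convex_Ioi 0, fun b (hb : 0 < b) c (hc : 0 < c) s t hs ht hst => ?_⟩
  have hpos := sibson_pos hP hw
  calc scaledInfo P w (s * b + t * c)
      ≤ (s * b + t * c) * log (sibson P w b ^ (s * b / (s * b + t * c)) *
          sibson P w c ^ (t * c / (s * b + t * c))) := by
        rw [scaledInfo]
        gcongr
        · exact hpos _
        · exact sibson_convex_comb_le hP.1 (fun x => (hw x).1) hb hc hs ht hst
    _ = s * scaledInfo P w b + t * scaledInfo P w c := by
        rw [log_mul (rpow_pos_of_pos (hpos _) _).ne' (rpow_pos_of_pos (hpos _) _).ne',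
          log_rpow (hpos _), log_rpow (hpos _), scaledInfo, scaledInfo]
        field_simp

theorem differentiableAt_scaledInfo (hP : P ∈ stdSimplex ℝ X) (hw : ∀ x, w x ∈ stdSimplex ℝ Y)
    {b : ℝ} (hb : 0 < b) : DifferentiableAt ℝ (scaledInfo P w) b := by
  have hwnn := fun x => (hw x).1
  have hsib : DifferentiableAt ℝ (fun b => sibson P w b) b := by
    refine DifferentiableAt.fun_sum fun y _ => ?_
    by_cases h : ∃ x, P x * w x y ≠ 0
    · obtain ⟨x, hx⟩ := h
      exact (differentiableAt_columnMoment hwnn hb y).rpow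
        ((differentiableAt_const _).div differentiableAt_id hb.ne')
        (columnMoment_pos hP.1 hwnn b hx).ne'
    · push Not at h
      have hzero : (fun b => columnMoment P w b y ^ (1 / b)) =ᶠ[𝓝 b] fun _ => 0 := by
        filter_upwards [lt_mem_nhds hb] with c hc
        rw [columnMoment_eq_zero hc.ne' h, zero_rpow (one_div_ne_zero hc.ne')]
      exact (differentiableAt_const _).congr_of_eventuallyEq hzero
  exact differentiableAt_id.mul (hsib.log (sibson_pos hP hw b).ne')

theorem concaveOn_sibson (hw : ∀ x y, 0 ≤ w x y) {b : ℝ} (hb : 1 ≤ b) :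
    ConcaveOn ℝ (stdSimplex ℝ X) (fun P => sibson P w b) := by
  refine ⟨convex_stdSimplex ℝ X, fun P hP P' hP' s t hs ht hst => ?_⟩
  simp only [sibson, smul_eq_mul]
  rw [Finset.mul_sum, Finset.mul_sum, ← Finset.sum_add_distrib]
  refine Finset.sum_le_sum fun y _ => ?_
  have hlin : columnMoment (s • P + t • P') w b y =
      s * columnMoment P w b y + t * columnMoment P' w b y := by
    simp only [columnMoment, Pi.add_apply, Pi.smul_apply, smul_eq_mul, Finset.mul_sum,
      ← Finset.sum_add_distrib, add_mul, mul_assoc]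
  rw [hlin]
  exact (concaveOn_rpow (by positivity) ((div_le_one (one_pos.trans_le hb)).mpr hb)).2
    (columnMoment_nonneg hP.1 hw b y) (columnMoment_nonneg hP'.1 hw b y) hs ht hst

theorem continuousOn_scaledInfo (hw : ∀ x, w x ∈ stdSimplex ℝ Y) {b : ℝ} (hb : 0 ≤ b) :
    ContinuousOn (fun P => scaledInfo P w b) (stdSimplex ℝ X) := by
  have hsib : Continuous fun P : X → ℝ => sibson P w b := by
    refine continuous_finsetSum _ fun y _ =>
      Continuous.rpow_const (by unfold columnMoment; fun_prop) fun P => Or.inr (by positivity)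
  exact continuousOn_const.mul (hsib.continuousOn.log fun P hP => (sibson_pos hP hw b).ne')

end Sibson

/-! ### Products -/

section Product

variable {X Y : Type*}

/-- The `n`-fold product of a vector: the law of `n` independent copies. -/
def prodVec (P : X → ℝ) (n : ℕ) (x : Fin n → X) : ℝ := ∏ i, P (x i)

/-- The `n`-fold product of a matrix: the transition matrix of `n` independent uses. -/
def prodMat (w : X → Y → ℝ) (n : ℕ) (x : Fin n → X) (y : Fin n → Y) : ℝ := ∏ i, w (x i) (y i)

theorem prodVec_mem [Fintype X] {P : X → ℝ} (hP : P ∈ stdSimplex ℝ X) (n : ℕ) :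
    prodVec P n ∈ stdSimplex ℝ (Fin n → X) :=
  ⟨fun x => Finset.prod_nonneg fun i _ => hP.1 (x i), by
    simp only [prodVec, ← Fintype.sum_pow, hP.2, one_pow]⟩

theorem prodMat_mem [Fintype Y] {w : X → Y → ℝ} (hw : ∀ x, w x ∈ stdSimplex ℝ Y) (n : ℕ)
    (x : Fin n → X) : prodMat w n x ∈ stdSimplex ℝ (Fin n → Y) :=
  ⟨fun y => Finset.prod_nonneg fun i _ => (hw (x i)).1 (y i), by
    simp only [prodMat, ← Fintype.prod_sum fun i y => w (x i) y, (hw _).2, Finset.prod_const_one]⟩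

variable [Fintype X] {w : X → Y → ℝ}

theorem columnMoment_prod (P : X → ℝ) (hw : ∀ x y, 0 ≤ w x y) (b : ℝ) (n : ℕ) (y : Fin n → Y) :
    columnMoment (prodVec P n) (prodMat w n) b y = ∏ i, columnMoment P w b (y i) := by
  simp only [columnMoment]
  rw [Fintype.prod_sum fun i x => P x * w x (y i) ^ b]
  refine Finset.sum_congr rfl fun x _ => ?_
  rw [prodVec, prodMat, ← finsetProd_rpow _ _ fun i _ => hw (x i) (y i), Finset.prod_mul_distrib]

theorem scaledInfo_prod [Fintype Y] {P : X → ℝ} (hP : ∀ x, 0 ≤ P x) (hw : ∀ x y, 0 ≤ w x y)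
    (b : ℝ) (n : ℕ) :
    scaledInfo (prodVec P n) (prodMat w n) b = n * scaledInfo P w b := by
  have hpow : sibson (prodVec P n) (prodMat w n) b = sibson P w b ^ n := by
    simp only [sibson]
    rw [Fintype.sum_pow]
    refine Finset.sum_congr rfl fun y _ => ?_
    rw [columnMoment_prod P hw, finsetProd_rpow _ _ fun i _ => columnMoment_nonneg hP hw b (y i)]
  rw [scaledInfo, hpow, log_pow, scaledInfo, mul_left_comm]

end Product

/-! ### Tails of the likelihood ratio -/

section Tail

variable {ι : Type*} [Fintype ι]

/-- The part of `affinity a p q` on the event that the likelihood ratio `p / q` exceeds `κ`. -/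
def tailAffinity (κ a : ℝ) (p q : ι → ℝ) : ℝ :=
  ∑ i, if κ * q i < p i then p i ^ a * q i ^ (1 - a) else 0

theorem tailAffinity_smul {p q : ι → ℝ} {s : ℝ} (hs : 0 ≤ s) (hq : ∀ i, 0 ≤ q i) (κ a : ℝ) :
    tailAffinity κ a p (s • q) = s ^ (1 - a) * tailAffinity (κ * s) a p q := by
  simp only [tailAffinity, Finset.mul_sum, mul_ite, mul_zero, Pi.smul_apply, smul_eq_mul, mul_assoc]
  refine Finset.sum_congr rfl fun i _ => ?_
  rw [mul_rpow hs (hq i), mul_left_comm (p i ^ a)]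

theorem rpow_mul_rpow_one_sub {v u : ℝ} (hv : 0 < v) (hu : 0 < u) (b c : ℝ) :
    v ^ b * u ^ (1 - b) = (v / u) ^ (b - c) * (v ^ c * u ^ (1 - c)) := by
  rw [div_rpow hv.le hu.le, div_eq_mul_inv, ← rpow_neg hu.le]
  calc v ^ b * u ^ (1 - b) = v ^ ((b - c) + c) * u ^ (-(b - c) + (1 - c)) := by ring_nf
    _ = _ := by rw [rpow_add hv, rpow_add hu]; ring

-- The likelihood ratio is at most `κ`, at least `R`, or in between; these cases give the summands.
theorem affinity_le_add_tailAffinity {p q : ι → ℝ} (hp : ∀ i, 0 ≤ p i) (hq : ∀ i, 0 < q i)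
    {a b b₁ b₂ κ R : ℝ} (hb : 0 < b) (hab : a ≤ b) (hb₁ : b₁ ≤ b) (hb₂ : b ≤ b₂) (hκ : 0 < κ)
    (hR : 0 < R) :
    affinity b p q ≤ κ ^ (b - b₁) * affinity b₁ p q + R ^ (b - b₂) * affinity b₂ p q +
      R ^ (b - a) * tailAffinity κ a p q := by
  simp only [affinity, tailAffinity, Finset.mul_sum, ← Finset.sum_add_distrib]
  refine Finset.sum_le_sum fun i _ => ?_
  have hqi := hq i
  have hpq : ∀ c : ℝ, 0 ≤ p i ^ c * q i ^ (1 - c) := fun c =>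
    mul_nonneg (rpow_nonneg (hp i) c) (rpow_nonneg hqi.le _)
  have low_nonneg : 0 ≤ κ ^ (b - b₁) * (p i ^ b₁ * q i ^ (1 - b₁)) :=
    mul_nonneg (by positivity) (hpq b₁)
  have high_nonneg : 0 ≤ R ^ (b - b₂) * (p i ^ b₂ * q i ^ (1 - b₂)) :=
    mul_nonneg (by positivity) (hpq b₂)
  have mid_nonneg : 0 ≤ R ^ (b - a) *
      if κ * q i < p i then p i ^ a * q i ^ (1 - a) else 0 := by
    split_ifs
    · exact mul_nonneg (by positivity) (hpq a)
    · rw [mul_zero]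
  rcases (hp i).eq_or_lt with hzero | hpi
  · rw [← hzero, zero_rpow hb.ne', zero_mul]
    rw [← hzero] at low_nonneg high_nonneg mid_nonneg
    positivity
  have change_order : ∀ {c s : ℝ}, (p i / q i) ^ (b - c) ≤ s →
      p i ^ b * q i ^ (1 - b) ≤ s * (p i ^ c * q i ^ (1 - c)) := fun {c s} h => by
    rw [rpow_mul_rpow_one_sub hpi hqi b c]
    exact mul_le_mul_of_nonneg_right h (hpq c)
  by_cases hlow : κ * q i < p i
  · rw [if_pos hlow] at mid_nonneg ⊢
    rcases le_total (p i / q i) R with h | h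
    · linarith [change_order (c := a) (rpow_le_rpow (by positivity) h (sub_nonneg.mpr hab))]
    · linarith [change_order (c := b₂) (rpow_le_rpow_of_nonpos hR h (sub_nonpos.mpr hb₂))]
  · have h : p i / q i ≤ κ := (div_le_iff₀ hqi).mpr (not_lt.mp hlow)
    linarith [change_order (c := b₁) (rpow_le_rpow (by positivity) h (sub_nonneg.mpr hb₁))]

theorem exists_pos_dominating [Nonempty ι] {m : ℕ} {q : Fin m → ι → ℝ}
    (hq : ∀ k, q k ∈ stdSimplex ℝ ι) :
    ∃ u : ι → ℝ, (∀ i, 0 < u i) ∧ ∑ i, u i = 1 ∧ ∀ k i, q k i ≤ (m + 1) * u i := by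
  have hcard : (0 : ℝ) < Fintype.card ι := by exact_mod_cast Fintype.card_pos
  have hm : (0 : ℝ) < m + 1 := by positivity
  have hnn : ∀ i, ∀ k ∈ Finset.univ, 0 ≤ q k i := fun i k _ => (hq k).1 i
  refine ⟨fun i => (∑ k, q k i + (Fintype.card ι : ℝ)⁻¹) / (m + 1), fun i => ?_, ?_,
    fun k i => ?_⟩
  · have hsum := Finset.sum_nonneg (hnn i)
    positivity
  · have hmass : ∑ i, ∑ k, q k i = m := by
      rw [Finset.sum_comm]
      simp only [(hq _).2, Finset.sum_const, Finset.card_univ, Fintype.card_fin, nsmul_eq_mul,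
        mul_one]
    rw [← Finset.sum_div, Finset.sum_add_distrib, hmass, Finset.sum_const, Finset.card_univ,
      nsmul_eq_mul, mul_inv_cancel₀ hcard.ne', div_self hm.ne']
  · rw [mul_div_cancel₀ _ hm.ne']
    exact (Finset.single_le_sum (hnn i) (Finset.mem_univ k)).trans
      (le_add_of_nonneg_right (inv_nonneg.mpr hcard.le))

variable {X Y : Type*} [Fintype X] [Fintype Y] {P : X → ℝ} {w : X → Y → ℝ}

theorem sum_mul_affinity_le_of_sibsonOutput_le (hP : P ∈ stdSimplex ℝ X)
    (hw : ∀ x, w x ∈ stdSimplex ℝ Y) {c K : ℝ} (hc : 1 ≤ c) (hK : 0 < K) {u : Y → ℝ}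
    (hu : ∀ y, sibsonOutput P w c y ≤ K * u y) :
    ∑ x, P x * affinity c (w x) u ≤ K ^ (c - 1) * exp (scaledInfo P w c) := by
  have hc0 : 0 < c := one_pos.trans_le hc
  rw [← sum_mul_affinity_sibsonOutput hP hw hc0, sum_mul_affinity, sum_mul_affinity,
    Finset.mul_sum]
  refine Finset.sum_le_sum fun y _ => ?_
  have hmoment := columnMoment_nonneg hP.1 (fun x => (hw x).1) c y
  rcases hmoment.eq_or_lt with h | h
  · rw [← h, zero_mul, zero_mul, mul_zero]
  · have hpos : 0 < sibsonOutput P w c y := div_pos (rpow_pos_of_pos h _) (sibson_pos hP hw c)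
    have huy : 0 ≤ u y := (pos_of_mul_pos_right (hpos.trans_le (hu y)) hK.le).le
    calc columnMoment P w c y * u y ^ (1 - c)
        = K ^ (c - 1) * (columnMoment P w c y * (K * u y) ^ (1 - c)) := by
          rw [mul_rpow hK.le huy, mul_left_comm, ← mul_assoc (K ^ (c - 1)), ← rpow_add hK,
            sub_add_sub_cancel, sub_self, rpow_zero, one_mul]
      _ ≤ _ := by
          have hpow := rpow_le_rpow_of_nonpos hpos (hu y) (sub_nonpos.mpr hc)
          gcongr

theorem exists_exp_scaledInfo_le_add_tailAffinity (hP : P ∈ stdSimplex ℝ X)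
    (hw : ∀ x, w x ∈ stdSimplex ℝ Y) {a b b₁ b₂ κ R : ℝ} (hab : a ≤ b) (hb₁ : 1 ≤ b₁)
    (hb₁b : b₁ ≤ b) (hbb₂ : b ≤ b₂) (hκ : 0 < κ) (hR : 0 < R) {Q : Y → ℝ}
    (hQ : Q ∈ stdSimplex ℝ Y) :
    ∃ u : Y → ℝ, (∀ y, 0 < u y) ∧ (∀ y, Q y ≤ 4 * u y) ∧
      exp (scaledInfo P w b) ≤ κ ^ (b - b₁) * (4 ^ (b₁ - 1) * exp (scaledInfo P w b₁)) +
        R ^ (b - b₂) * (4 ^ (b₂ - 1) * exp (scaledInfo P w b₂)) +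
        R ^ (b - a) * ∑ x, P x * tailAffinity κ a (w x) u := by
  have : Nonempty Y := ⟨(exists_pos_of_mem_stdSimplex hQ).choose⟩
  obtain ⟨u, hu0, hu1, hdom⟩ := exists_pos_dominating
    (q := ![Q, sibsonOutput P w b₁, sibsonOutput P w b₂])
    (Fin.forall_fin_succ.mpr ⟨hQ, Fin.forall_fin_two.mpr
      ⟨sibsonOutput_mem hP hw b₁, sibsonOutput_mem hP hw b₂⟩⟩)
  have hfour : ((3 : ℕ) : ℝ) + 1 = 4 := by norm_num
  rw [hfour] at hdom
  have hb : 1 ≤ b := hb₁.trans hb₁b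
  have low := sum_mul_affinity_le_of_sibsonOutput_le hP hw hb₁ four_pos (hdom 1)
  have high := sum_mul_affinity_le_of_sibsonOutput_le hP hw (hb.trans hbb₂) four_pos (hdom 2)
  refine ⟨u, hu0, hdom 0, ?_⟩
  calc exp (scaledInfo P w b) ≤ ∑ x, P x * affinity b (w x) u :=
        exp_scaledInfo_le hP hw hb (fun y => (hu0 y).le) hu1.le fun _ y _ => (hu0 y).ne'
    _ ≤ ∑ x, P x * (κ ^ (b - b₁) * affinity b₁ (w x) u + R ^ (b - b₂) * affinity b₂ (w x) u +
          R ^ (b - a) * tailAffinity κ a (w x) u) :=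
        Finset.sum_le_sum fun x _ => mul_le_mul_of_nonneg_left (affinity_le_add_tailAffinity
          (hw x).1 hu0 (one_pos.trans_le hb) hab hb₁b hbb₂ hκ hR) (hP.1 x)
    _ = κ ^ (b - b₁) * ∑ x, P x * affinity b₁ (w x) u +
          R ^ (b - b₂) * ∑ x, P x * affinity b₂ (w x) u +
          R ^ (b - a) * ∑ x, P x * tailAffinity κ a (w x) u := by
        simp only [mul_add, Finset.sum_add_distrib, Finset.mul_sum, mul_left_comm (P _)]
    _ ≤ _ := by gcongr

end Tail

/-! ### Choice of orders -/

section Orders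

variable {g : ℝ → ℝ} {a r₁ r₂ C : ℝ}

theorem exists_forall_mul_sub_le (hg : ContinuousOn g (Set.Ici a)) (hr : r₁ < r₂)
    (hC : ∀ b, a ≤ b → (b - 1) * r₂ - g b ≤ C) :
    ∃ c, a ≤ c ∧ ∀ b, a ≤ b → (b - 1) * r₁ - g b ≤ (c - 1) * r₁ - g c := by
  have hcont : ContinuousOn (fun b => (b - 1) * r₁ - g b) (Set.Ici a) := by fun_prop
  have hlin : Tendsto (fun b => (b - 1) * (r₂ - r₁)) atTop atTop :=
    (tendsto_atTop_add_const_right _ (-1) tendsto_id).atTop_mul_const (sub_pos.mpr hr)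
  refine hcont.exists_isMaxOn' isClosed_Ici Set.self_mem_Ici (eventually_inf_principal.mpr ?_)
  rw [cocompact_eq_atBot_atTop, eventually_sup]
  refine ⟨(eventually_lt_atBot a).mono fun b hb hab => absurd hab hb.not_ge, ?_⟩
  filter_upwards [hlin.eventually_ge_atTop (C - ((a - 1) * r₁ - g a))] with b hb hab
  linarith [hC b hab]

variable {c ρ r : ℝ}

theorem le_deriv_of_forall_mul_sub_le (hρ : HasDerivAt g ρ c)
    (hmax : ∀ b, c ≤ b → (b - 1) * r - g b ≤ (c - 1) * r - g c) : r ≤ ρ := by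
  refine ge_of_tendsto hρ.tendsto_slope_zero_right ?_
  filter_upwards [self_mem_nhdsWithin] with s (hs : 0 < s)
  rw [smul_eq_mul, inv_mul_eq_div, le_div_iff₀ hs]
  linarith [hmax (c + s) (by linarith)]

theorem deriv_eq_of_forall_mul_sub_le (hρ : HasDerivAt g ρ c) (hac : a < c)
    (hmax : ∀ b, a ≤ b → (b - 1) * r - g b ≤ (c - 1) * r - g c) : ρ = r := by
  have hderiv : HasDerivAt (fun b => (b - 1) * r - g b) (1 * r - ρ) c :=
    (((hasDerivAt_id c).sub_const 1).mul_const r).sub hρ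
  have hloc : IsLocalMax (fun b => (b - 1) * r - g b) c := by
    filter_upwards [lt_mem_nhds hac] with b hb using hmax b hb.le
  linarith [hloc.hasDerivAt_eq_zero hderiv]

theorem tendsto_slope_add_two_mul (hρ : HasDerivAt g ρ c) :
    Tendsto (fun s => s⁻¹ * (g (c + 2 * s) - g (c + s))) (𝓝[>] 0) (𝓝 ρ) := by
  have hslope := hρ.tendsto_slope_zero_right
  have hdouble : Tendsto (fun s : ℝ => 2 * s) (𝓝[>] 0) (𝓝[>] 0) := fun _ hs =>
    eventually_nhdsGT_zero_mul_left two_pos hs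
  have hdiff := ((hslope.comp hdouble).const_mul 2).sub hslope
  rw [two_mul, add_sub_cancel_right] at hdiff
  refine hdiff.congr' ?_
  filter_upwards [self_mem_nhdsWithin] with s (hs : 0 < s)
  simp only [Function.comp, smul_eq_mul]
  field_simp
  ring

-- `b₁ < b < b₂` are equally spaced orders just above the constrained maximiser, so that both
-- difference quotients of `g` approximate the derivative there.
theorem exists_orders_of_forall_mul_sub_le (hg : ∀ b, a ≤ b → DifferentiableAt ℝ g b)
    (hr : r₁ < r₂) (hC : ∀ b, a ≤ b → (b - 1) * r₂ - g b ≤ C) {ε : ℝ} (ha : 1 ≤ a) (hε : 0 < ε) :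
    ∃ b₁ b b₂ R δ : ℝ, a ≤ b₁ ∧ b₁ < b ∧ b < b₂ ∧ 0 < δ ∧
      (r₁ + δ) * (b - b₁) + g b₁ < g b ∧ g b₂ - R * (b₂ - b) < g b ∧
      R * (b - a) + r₁ * (a - 1) - g b < C + ε := by
  obtain ⟨r, hr₁, hr₂⟩ := exists_between hr
  obtain ⟨c, hac, hmax⟩ := exists_forall_mul_sub_le
    (fun b hb => (hg b hb).continuousAt.continuousWithinAt) hr₂ hC
  obtain ⟨ρ, hρ⟩ : ∃ ρ, HasDerivAt g ρ c := ⟨_, (hg c hac).hasDerivAt⟩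
  have hrρ : r ≤ ρ := le_deriv_of_forall_mul_sub_le hρ fun b hb => hmax b (hac.trans hb)
  have hslack : (ρ - r) * (c - a) = 0 := by
    rcases hac.eq_or_lt with h | h
    · rw [h, sub_self, mul_zero]
    · rw [deriv_eq_of_forall_mul_sub_le hρ h hmax, sub_self, zero_mul]
  obtain ⟨r', hr'₁, hr'⟩ := exists_between (hr₁.trans_le hrρ)
  have hslope := hρ.tendsto_slope_zero_right
  have hid : Tendsto (fun s : ℝ => s) (𝓝[>] 0) (𝓝 0) :=
    tendsto_nhdsWithin_of_tendsto_nhds tendsto_id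
  have hgc : Tendsto (fun s : ℝ => g (c + s)) (𝓝[>] 0) (𝓝 (g c)) :=
    hρ.continuousAt.tendsto.comp (by simpa using hid.const_add c)
  have hlim := ((((tendsto_slope_add_two_mul hρ).add hid).mul
    ((hid.const_add c).sub_const a)).add_const (r₁ * (a - 1))).sub hgc
  have hlim_lt : (ρ + 0) * (c + 0 - a) + r₁ * (a - 1) - g c < C + ε := by
    nlinarith [hC c hac]
  obtain ⟨s, ⟨hs₁, hs₂⟩, hs : 0 < s⟩ := (((hslope.eventually_const_lt hr').and
    (hlim.eventually_lt_const hlim_lt)).and self_mem_nhdsWithin).exists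
  refine ⟨c, c + s, c + 2 * s, s⁻¹ * (g (c + 2 * s) - g (c + s)) + s, r' - r₁, hac,
    by linarith, by linarith, by linarith, ?_, ?_, hs₂⟩
  · rw [smul_eq_mul, inv_mul_eq_div, lt_div_iff₀ hs] at hs₁
    linarith
  · have hquot : (s⁻¹ * (g (c + 2 * s) - g (c + s)) + s) * (c + 2 * s - (c + s)) =
        g (c + 2 * s) - g (c + s) + s ^ 2 := by
      field_simp
      ring
    rw [hquot]
    linarith [pow_pos hs 2]

end Orders

/-! ### Exponential tail bound for product channels -/

section ProductTail

theorem eventually_mul_exp_le {x y : ℝ} (h : x < y) (c : ℝ) :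
    ∀ᶠ n : ℕ in atTop, c * exp (n * x) ≤ exp (n * y) := by
  have hgrow : Tendsto (fun n : ℕ => exp ((n : ℝ) * (y - x))) atTop atTop :=
    tendsto_exp_atTop.comp (tendsto_natCast_atTop_atTop.atTop_mul_const (sub_pos.mpr h))
  filter_upwards [hgrow.eventually_ge_atTop c] with n hn
  calc c * exp (n * x) ≤ exp (n * (y - x)) * exp (n * x) := by gcongr
    _ = exp (n * y) := by rw [← exp_add]; ring_nf

variable {X Y : Type*} [Fintype X] [Fintype Y] {P : X → ℝ} {w : X → Y → ℝ}

theorem exists_exp_scaledInfo_prod_le_add_tailAffinity (hP : P ∈ stdSimplex ℝ X)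
    (hw : ∀ x, w x ∈ stdSimplex ℝ Y) {a b b₁ b₂ : ℝ} (hab : a ≤ b) (hb₁ : 1 ≤ b₁) (hb₁b : b₁ ≤ b)
    (hbb₂ : b ≤ b₂) (r R δ : ℝ) (n : ℕ) {Q : (Fin n → Y) → ℝ}
    (hQ : Q ∈ stdSimplex ℝ (Fin n → Y)) :
    ∃ B : (Fin n → Y) → ℝ, (∀ y, exp (n * r) * Q y ≤ B y) ∧
      exp (n * scaledInfo P w b) ≤
        4 ^ (b - 1) * exp (n * ((r + δ) * (b - b₁) + scaledInfo P w b₁)) +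
        4 ^ (b₂ - 1) * exp (n * (scaledInfo P w b₂ - R * (b₂ - b))) +
        4 ^ (a - 1) * exp (n * (R * (b - a) + r * (a - 1))) *
          ∑ x, prodVec P n x * tailAffinity (exp (n * δ)) a (prodMat w n x) B := by
  obtain ⟨u, hu, hQu, hle⟩ := exists_exp_scaledInfo_le_add_tailAffinity (prodVec_mem hP n)
    (prodMat_mem hw n) hab hb₁ hb₁b hbb₂ (by positivity : 0 < exp (n * δ) * (4 * exp (n * r)))
    (exp_pos (n * R)) hQ
  have hK : 0 < 4 * exp (n * r) := by positivity
  refine ⟨(4 * exp (n * r)) • u, fun y => ?_, ?_⟩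
  · calc exp (n * r) * Q y ≤ exp (n * r) * (4 * u y) := by gcongr; exact hQu y
      _ = 4 * exp (n * r) * u y := by ring
  simp only [scaledInfo_prod hP.1 fun x => (hw x).1] at hle
  have hlow : (exp (n * δ) * (4 * exp (n * r))) ^ (b - b₁) *
      (4 ^ (b₁ - 1) * exp (n * scaledInfo P w b₁)) =
        4 ^ (b - 1) * exp (n * ((r + δ) * (b - b₁) + scaledInfo P w b₁)) := by
    rw [mul_left_comm (exp _), ← exp_add, mul_rpow four_pos.le (exp_pos _).le, ← exp_mul,
      mul_mul_mul_comm, ← rpow_add four_pos, ← exp_add]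
    ring_nf
  have hhigh : exp (n * R) ^ (b - b₂) * (4 ^ (b₂ - 1) * exp (n * scaledInfo P w b₂)) =
      4 ^ (b₂ - 1) * exp (n * (scaledInfo P w b₂ - R * (b₂ - b))) := by
    rw [← exp_mul, mul_left_comm, ← exp_add]
    ring_nf
  have hmid : exp (n * R) ^ (b - a) = 4 ^ (a - 1) * exp (n * (R * (b - a) + r * (a - 1))) *
      (4 * exp (n * r)) ^ (1 - a) := by
    rw [mul_rpow four_pos.le (exp_pos _).le, ← exp_mul, ← exp_mul, mul_mul_mul_comm,
      ← rpow_add four_pos, ← exp_add, sub_add_sub_cancel, sub_self, rpow_zero, one_mul]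
    ring_nf
  rw [hlow, hhigh, hmid] at hle
  simpa only [tailAffinity_smul hK.le fun y => (hu y).le, mul_left_comm (prodVec P n _),
    ← Finset.mul_sum, mul_assoc] using hle

theorem eventually_exp_le_sum_mul_tailAffinity (hP : P ∈ stdSimplex ℝ X)
    (hw : ∀ x, w x ∈ stdSimplex ℝ Y) {a r₁ r₂ C ε : ℝ} (ha : 1 ≤ a) (hr : r₁ < r₂)
    (hC : ∀ b, a ≤ b → (b - 1) * r₂ - scaledInfo P w b ≤ C) (hε : 0 < ε) :
    ∃ δ > 0, ∀ᶠ n : ℕ in atTop, ∀ Q ∈ stdSimplex ℝ (Fin n → Y), ∃ B : (Fin n → Y) → ℝ,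
      (∀ y, exp (n * r₁) * Q y ≤ B y) ∧
      exp (n * -(C + ε)) ≤
        ∑ x, prodVec P n x * tailAffinity (exp (n * δ)) a (prodMat w n x) B := by
  obtain ⟨b₁, b, b₂, R, δ, hab₁, hb₁b, hbb₂, hδ, low, high, mid⟩ :=
    exists_orders_of_forall_mul_sub_le
      (fun b hb => differentiableAt_scaledInfo hP hw (one_pos.trans_le (ha.trans hb))) hr hC ha hε
  refine ⟨δ, hδ, ?_⟩
  filter_upwards [eventually_mul_exp_le low (4 * 4 ^ (b - 1)),
    eventually_mul_exp_le high (4 * 4 ^ (b₂ - 1)),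
    eventually_mul_exp_le (neg_lt_neg mid) (2 * 4 ^ (a - 1))] with n low high mid Q hQ
  obtain ⟨B, hQB, hle⟩ := exists_exp_scaledInfo_prod_le_add_tailAffinity hP hw
    (hab₁.trans hb₁b.le) (ha.trans hab₁) hb₁b.le hbb₂.le r₁ R δ n hQ
  refine ⟨B, hQB, le_of_mul_le_mul_left ?_ (by positivity : (0 : ℝ) < 2 * 4 ^ (a - 1))⟩
  set T := ∑ x, prodVec P n x * tailAffinity (exp (n * δ)) a (prodMat w n x) B
  set E := R * (b - a) + r₁ * (a - 1)
  have hhalf : exp (n * scaledInfo P w b) ≤ 2 * (4 ^ (a - 1) * exp (n * E) * T) := by linarith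
  calc 2 * 4 ^ (a - 1) * exp (n * -(C + ε))
      ≤ exp (n * scaledInfo P w b) * exp (-(n * E)) := by
        rw [← exp_add]
        exact mid.trans_eq (by ring_nf)
    _ ≤ 2 * (4 ^ (a - 1) * exp (n * E) * T) * exp (-(n * E)) := by gcongr
    _ = 2 * 4 ^ (a - 1) * T * (exp (n * E) * exp (-(n * E))) := by ring
    _ = 2 * 4 ^ (a - 1) * T := by rw [← exp_add, add_neg_cancel, exp_zero, mul_one]

end ProductTail

/-! ### Distributions as real vectors -/

section Vectors

variable {ι X Y : Type*}

/-- The real vector underlying a `[0, ∞]`-valued one; the analysis is carried out on these. -/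
def toVec (f : ι → ℝ≥0∞) (i : ι) : ℝ := (f i).toReal

/-- The transition matrix of a channel, with real entries. -/
def toMat (W : Channel X Y) (x : X) : Y → ℝ := toVec (W x)

/-- The distribution with a given probability vector. -/
def ofVec [Fintype ι] (p : ι → ℝ) (hp : p ∈ stdSimplex ℝ ι) : PMF ι :=
  PMF.ofFintype (fun i => ENNReal.ofReal (p i)) (by
    rw [← ENNReal.ofReal_sum_of_nonneg fun i _ => hp.1 i, hp.2, ENNReal.ofReal_one])

theorem toVec_nonneg (f : ι → ℝ≥0∞) (i : ι) : 0 ≤ toVec f i := ENNReal.toReal_nonneg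

theorem toVec_pos {f : ι → ℝ≥0∞} {i : ι} (h0 : f i ≠ 0) (hT : f i ≠ ∞) : 0 < toVec f i :=
  ENNReal.toReal_pos h0 hT

theorem ofReal_toVec {f : ι → ℝ≥0∞} {i : ι} (hT : f i ≠ ∞) : ENNReal.ofReal (toVec f i) = f i :=
  ENNReal.ofReal_toReal hT

theorem toVec_ofVec [Fintype ι] (p : ι → ℝ) (hp : p ∈ stdSimplex ℝ ι) :
    toVec (ofVec p hp) = p :=
  funext fun i => ENNReal.toReal_ofReal (hp.1 i)

theorem toVec_mem_of_sum_eq_one [Fintype ι] {f : ι → ℝ≥0∞} (h : ∑ i, f i = 1) :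
    toVec f ∈ stdSimplex ℝ ι := by
  have hT : ∀ i ∈ Finset.univ, f i ≠ ∞ := ENNReal.sum_ne_top.mp (h ▸ ENNReal.one_ne_top)
  refine ⟨toVec_nonneg f, ?_⟩
  simp only [toVec]
  rw [← ENNReal.toReal_sum hT, h, ENNReal.toReal_one]

theorem sum_coe_eq_one [Fintype ι] (μ : PMF ι) : ∑ i, μ i = 1 := by
  simpa [tsum_fintype] using μ.tsum_coe

theorem toVec_mem [Fintype ι] (μ : PMF ι) : toVec μ ∈ stdSimplex ℝ ι :=
  toVec_mem_of_sum_eq_one (sum_coe_eq_one μ)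

theorem toMat_mem [Fintype Y] (W : Channel X Y) (x : X) : toMat W x ∈ stdSimplex ℝ Y :=
  toVec_mem _

theorem toMat_power [Fintype Y] (W : Channel X Y) (n : ℕ) :
    toMat (power W n) = prodMat (toMat W) n := by
  ext x y
  simp [toMat, toVec, power, prodMat, PMF.ofFintype_apply, ENNReal.toReal_prod]

theorem sum_joint [Fintype X] [Fintype Y] (P : PMF X) (W : Channel X Y) :
    ∑ z, joint P W z = 1 := by
  rw [Fintype.sum_prod_type]
  simp only [joint, ← Finset.mul_sum, sum_coe_eq_one, mul_one]

theorem joint_ne_top (P : PMF X) (W : Channel X Y) (z : X × Y) : joint P W z ≠ ∞ :=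
  ENNReal.mul_ne_top (P.apply_ne_top _) ((W _).apply_ne_top _)

theorem joint_ne_zero_iff {P : PMF X} {W : Channel X Y} {z : X × Y} :
    joint P W z ≠ 0 ↔ toVec P z.1 ≠ 0 ∧ toMat W z.1 z.2 ≠ 0 := by
  simp [joint, toVec, toMat, ENNReal.toReal_eq_zero_iff, PMF.apply_ne_top]

theorem toVec_joint (P : PMF X) (W : Channel X Y) (x : X) (y : Y) :
    toVec (joint P W) (x, y) = toVec P x * toMat W x y :=
  ENNReal.toReal_mul

theorem prodDist_eq_joint (P : PMF X) (Q : PMF Y) : prodDist P Q = joint P fun _ => Q := rfl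

theorem affinity_joint [Fintype X] [Fintype Y] (a : ℝ) (P : PMF X) (W N : Channel X Y) :
    affinity a (toVec (joint P W)) (toVec (joint P N)) =
      ∑ x, toVec P x * affinity a (toMat W x) (toMat N x) := by
  simp only [affinity, Fintype.sum_prod_type, Finset.mul_sum, toVec, toMat, joint,
    ENNReal.toReal_mul]
  refine Finset.sum_congr rfl fun x _ => Finset.sum_congr rfl fun y _ => ?_
  rw [mul_rpow ENNReal.toReal_nonneg ENNReal.toReal_nonneg,
    mul_rpow ENNReal.toReal_nonneg ENNReal.toReal_nonneg]
  have hP : (P x).toReal ^ a * (P x).toReal ^ (1 - a) = (P x).toReal := by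
    rw [← rpow_add' ENNReal.toReal_nonneg (by norm_num), add_sub_cancel, rpow_one]
  rw [mul_mul_mul_comm, hP]

end Vectors

/-! ### Divergences and affinities -/

section Renyi

theorem log2_le_coe {x : ℝ≥0∞} {c : ℝ} :
    log2 x ≤ (c : EReal) ↔ x ≤ ENNReal.ofReal (exp (c * log 2)) := by
  have h2 : (0 : EReal) < ((log 2 : ℝ) : EReal) := by exact_mod_cast log_pos one_lt_two
  rw [log2, EReal.div_le_iff_le_mul h2 (EReal.coe_ne_top _), ← EReal.coe_mul, mul_comm,
    ← ENNReal.log_le_log_iff, ENNReal.log_ofReal_of_pos (exp_pos _), log_exp]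

theorem coe_le_log2 {x : ℝ≥0∞} {c : ℝ} :
    (c : EReal) ≤ log2 x ↔ ENNReal.ofReal (exp (c * log 2)) ≤ x := by
  have h2 : (0 : EReal) < ((log 2 : ℝ) : EReal) := by exact_mod_cast log_pos one_lt_two
  rw [log2, EReal.le_div_iff_mul_le h2 (EReal.coe_ne_top _), ← EReal.coe_mul,
    ← ENNReal.log_le_log_iff, ENNReal.log_ofReal_of_pos (exp_pos _), log_exp]

variable {ι : Type*} [Fintype ι] {α : ℝ≥0∞} {p q : ι → ℝ≥0∞} {d : ℝ}

theorem coe_le_renyiDiv :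
    (d : EReal) ≤ renyiDiv α p q ↔ fidelity α p q ≤ ENNReal.ofReal (exp (-(d * log 2))) := by
  rw [renyiDiv, EReal.le_neg, ← EReal.coe_neg, log2_le_coe, neg_mul]

theorem renyiDiv_le_coe :
    renyiDiv α p q ≤ (d : EReal) ↔ ENNReal.ofReal (exp (-(d * log 2))) ≤ fidelity α p q := by
  rw [renyiDiv, EReal.neg_le, ← EReal.coe_neg, coe_le_log2, neg_mul]

theorem renyiDiv_eq_top (h : fidelity α p q = 0) : renyiDiv α p q = ⊤ := by
  have h2 : (0 : EReal) < ((log 2 : ℝ) : EReal) := by exact_mod_cast log_pos one_lt_two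
  rw [renyiDiv, h, log2, ENNReal.log_zero, EReal.bot_div_of_pos_ne_top h2 (EReal.coe_ne_top _),
    EReal.neg_bot]

theorem toReal_lt_one (h : α < 1) : α.toReal < 1 := by
  simpa using (ENNReal.toReal_lt_toReal h.ne_top ENNReal.one_ne_top).mpr h

theorem one_lt_toReal (h : 1 < α) (hT : α ≠ ∞) : 1 < α.toReal := by
  simpa using (ENNReal.toReal_lt_toReal ENNReal.one_ne_top hT).mpr h

theorem fidelity_eq_rpow (h0 : α ≠ 0) (h1 : α ≠ 1) (hT : α ≠ ∞) :
    fidelity α p q = (∑ i, p i ^ α.toReal * q i ^ (1 - α.toReal)) ^ (1 / (1 - α.toReal)) := by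
  rw [fidelity, if_neg h0, if_neg h1, if_neg hT]

theorem sum_rpow_eq_ofReal_affinity {a : ℝ} (ha : 0 < a) (hp : ∀ i, p i ≠ ∞) (hq : ∀ i, q i ≠ ∞)
    (hpq : 1 < a → ∀ i, p i ≠ 0 → q i ≠ 0) :
    ∑ i, p i ^ a * q i ^ (1 - a) = ENNReal.ofReal (affinity a (toVec p) (toVec q)) := by
  rw [affinity, ENNReal.ofReal_sum_of_nonneg fun i _ =>
    mul_nonneg (rpow_nonneg (toVec_nonneg p i) _) (rpow_nonneg (toVec_nonneg q i) _)]
  refine Finset.sum_congr rfl fun i _ => ?_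
  by_cases hi : p i = 0
  · simp [toVec, hi, ENNReal.zero_rpow_of_pos ha, zero_rpow ha.ne']
  have hqT : q i ^ (1 - a) ≠ ∞ := by
    rcases le_or_gt a 1 with h | h
    · exact ENNReal.rpow_ne_top_of_nonneg (sub_nonneg.mpr h) (hq i)
    · exact ENNReal.rpow_ne_top_of_ne_zero (hpq h i hi) (hq i)
  rw [ENNReal.ofReal_mul (rpow_nonneg (toVec_nonneg p i) _), toVec, toVec, ENNReal.toReal_rpow,
    ENNReal.toReal_rpow, ENNReal.ofReal_toReal hqT,
    ENNReal.ofReal_toReal (ENNReal.rpow_ne_top_of_nonneg ha.le (hp i))]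

section LtOne

variable (h0 : α ≠ 0) (h1 : α < 1) (hp : ∀ i, p i ≠ ∞) (hq : ∀ i, q i ≠ ∞)

include h0 h1 hp hq

theorem fidelity_of_lt_one :
    fidelity α p q =
      ENNReal.ofReal (affinity α.toReal (toVec p) (toVec q)) ^ (1 - α.toReal)⁻¹ := by
  rw [fidelity_eq_rpow h0 h1.ne h1.ne_top, one_div, sum_rpow_eq_ofReal_affinity
    (ENNReal.toReal_pos h0 h1.ne_top) hp hq fun h => absurd h (toReal_lt_one h1).not_gt]

theorem coe_le_renyiDiv_of_lt_one :
    (d : EReal) ≤ renyiDiv α p q ↔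
      affinity α.toReal (toVec p) (toVec q) ≤ exp (d * log 2 * (α.toReal - 1)) := by
  rw [coe_le_renyiDiv, fidelity_of_lt_one h0 h1 hp hq,
    ENNReal.rpow_inv_le_iff (sub_pos.mpr (toReal_lt_one h1)),
    ENNReal.ofReal_rpow_of_pos (exp_pos _), ENNReal.ofReal_le_ofReal_iff (by positivity), ← exp_mul]
  ring_nf

theorem renyiDiv_le_coe_of_lt_one :
    renyiDiv α p q ≤ (d : EReal) ↔
      exp (d * log 2 * (α.toReal - 1)) ≤ affinity α.toReal (toVec p) (toVec q) := by
  rw [renyiDiv_le_coe, fidelity_of_lt_one h0 h1 hp hq,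
    ENNReal.le_rpow_inv_iff (sub_pos.mpr (toReal_lt_one h1)),
    ENNReal.ofReal_rpow_of_pos (exp_pos _), ENNReal.ofReal_le_ofReal_iff
      (affinity_nonneg _ (toVec_nonneg p) (toVec_nonneg q)), ← exp_mul]
  ring_nf

end LtOne

theorem renyiDiv_eq_top_of_one_le (h1 : 1 ≤ α) (hT : α ≠ ∞) (hp : ∀ i, p i ≠ ∞) {i : ι}
    (hi : p i ≠ 0) (hqi : q i = 0) : renyiDiv α p q = ⊤ := by
  refine renyiDiv_eq_top ?_
  rcases h1.eq_or_lt with rfl | h1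
  · rw [fidelity, if_neg one_ne_zero, if_pos rfl]
    refine Finset.prod_eq_zero (Finset.mem_univ i) ?_
    rw [hqi, ENNReal.zero_div, ENNReal.zero_rpow_of_pos (ENNReal.toReal_pos hi (hp i))]
  · have ha := one_lt_toReal h1 hT
    have hsum : ∑ i, p i ^ α.toReal * q i ^ (1 - α.toReal) = ∞ := by
      refine ENNReal.sum_eq_top.mpr ⟨i, Finset.mem_univ _, ?_⟩
      rw [hqi, ENNReal.zero_rpow_of_neg (sub_neg.mpr ha), ENNReal.mul_top]
      exact (ENNReal.rpow_pos (pos_iff_ne_zero.mpr hi) (hp i)).ne'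
    rw [fidelity_eq_rpow (one_pos.trans h1).ne' h1.ne' hT, hsum,
      ENNReal.top_rpow_of_neg (one_div_neg.mpr (sub_neg.mpr ha))]

section OneLt

variable (h1 : 1 < α) (hT : α ≠ ∞) (hp : ∀ i, p i ≠ ∞) (hq : ∀ i, q i ≠ ∞)

include h1 hT hp hq

theorem fidelity_of_one_lt (hpq : ∀ i, p i ≠ 0 → q i ≠ 0) :
    fidelity α p q =
      (ENNReal.ofReal (affinity α.toReal (toVec p) (toVec q)) ^ (α.toReal - 1)⁻¹)⁻¹ := by
  rw [fidelity_eq_rpow (one_pos.trans h1).ne' h1.ne' hT, ← ENNReal.rpow_neg, ← inv_neg, neg_sub,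
    one_div, sum_rpow_eq_ofReal_affinity (one_pos.trans (one_lt_toReal h1 hT)) hp hq fun _ => hpq]

theorem renyiDiv_le_coe_of_one_lt (hpq : ∀ i, p i ≠ 0 → q i ≠ 0) :
    renyiDiv α p q ≤ (d : EReal) ↔
      affinity α.toReal (toVec p) (toVec q) ≤ exp (d * log 2 * (α.toReal - 1)) := by
  rw [renyiDiv_le_coe, fidelity_of_one_lt h1 hT hp hq hpq, exp_neg,
    ENNReal.ofReal_inv_of_pos (exp_pos _), ENNReal.inv_le_inv,
    ENNReal.rpow_inv_le_iff (sub_pos.mpr (one_lt_toReal h1 hT)),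
    ENNReal.ofReal_rpow_of_pos (exp_pos _), ENNReal.ofReal_le_ofReal_iff (by positivity), ← exp_mul]

theorem coe_le_renyiDiv_of_one_lt (h : (∀ i, p i ≠ 0 → q i ≠ 0) →
      exp (d * log 2 * (α.toReal - 1)) ≤ affinity α.toReal (toVec p) (toVec q)) :
    (d : EReal) ≤ renyiDiv α p q := by
  by_cases hpq : ∀ i, p i ≠ 0 → q i ≠ 0
  · rw [coe_le_renyiDiv, fidelity_of_one_lt h1 hT hp hq hpq, exp_neg,
      ENNReal.ofReal_inv_of_pos (exp_pos _), ENNReal.inv_le_inv,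
      ENNReal.le_rpow_inv_iff (sub_pos.mpr (one_lt_toReal h1 hT)),
      ENNReal.ofReal_rpow_of_pos (exp_pos _), ← exp_mul]
    exact ENNReal.ofReal_le_ofReal (h hpq)
  · push Not at hpq
    obtain ⟨i, hi, hqi⟩ := hpq
    rw [renyiDiv_eq_top_of_one_le h1.le hT hp hi hqi]
    exact le_top

end OneLt

/-! ### Comparison with order one -/

/-- The relative entropy of two real vectors, in nats; meaningful only if `p` vanishes wherever
`q` does, since `log (p / 0) = 0`. -/
def relEntropy (p q : ι → ℝ) : ℝ := ∑ i, p i * log (p i / q i)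

theorem exp_mul_relEntropy_le_affinity {p q : ι → ℝ} (hp : p ∈ stdSimplex ℝ ι)
    (hq : ∀ i, 0 ≤ q i) (hpq : ∀ i, p i ≠ 0 → q i ≠ 0) {a : ℝ} (ha : 0 < a) :
    exp ((a - 1) * relEntropy p q) ≤ affinity a p q := by
  have jensen := convexOn_exp.map_sum_le (t := Finset.univ) (w := p)
    (p := fun i => (a - 1) * log (p i / q i)) (fun i _ => hp.1 i) hp.2 fun i _ => Set.mem_univ _
  simp only [smul_eq_mul] at jensen
  have hterm : ∀ i, p i * exp ((a - 1) * log (p i / q i)) = p i ^ a * q i ^ (1 - a) := by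
    intro i
    by_cases hi : p i = 0
    · rw [hi, zero_rpow ha.ne', zero_mul, zero_mul]
    · have hpi : 0 < p i := (hp.1 i).lt_of_ne' hi
      have hqi : 0 < q i := (hq i).lt_of_ne' (hpq i hi)
      rw [mul_comm (a - 1), ← rpow_def_of_pos (by positivity), rpow_mul_rpow_one_sub hpi hqi a 1]
      simp [mul_comm]
  calc exp ((a - 1) * relEntropy p q) = exp (∑ i, p i * ((a - 1) * log (p i / q i))) := by
        rw [relEntropy, Finset.mul_sum]
        exact congrArg exp (Finset.sum_congr rfl fun i _ => mul_left_comm _ _ _)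
    _ ≤ affinity a p q := jensen.trans_eq (Finset.sum_congr rfl fun i _ => hterm i)

theorem fidelity_one (hp : ∀ i, p i ≠ ∞) (hq : ∀ i, q i ≠ ∞) (hpq : ∀ i, p i ≠ 0 → q i ≠ 0) :
    fidelity 1 p q = ENNReal.ofReal (exp (-relEntropy (toVec p) (toVec q))) := by
  rw [fidelity, if_neg one_ne_zero, if_pos rfl, relEntropy, ← Finset.sum_neg_distrib, exp_sum,
    ENNReal.ofReal_prod_of_nonneg fun i _ => (exp_pos _).le]
  refine Finset.prod_congr rfl fun i _ => ?_
  by_cases hi : p i = 0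
  · simp [toVec, hi]
  · have hpi := toVec_pos hi (hp i)
    have hqi := toVec_pos (hpq i hi) (hq i)
    rw [← ofReal_toVec (hp i), ← ofReal_toVec (hq i), ← ENNReal.ofReal_div_of_pos hpi,
      ENNReal.ofReal_rpow_of_pos (by positivity), rpow_def_of_pos (by positivity),
      ENNReal.toReal_ofReal hpi.le, ← inv_div (toVec p i), log_inv]
    ring_nf

theorem renyiDiv_one (hp : ∀ i, p i ≠ ∞) (hq : ∀ i, q i ≠ ∞) (hpq : ∀ i, p i ≠ 0 → q i ≠ 0) :
    renyiDiv 1 p q = ((relEntropy (toVec p) (toVec q) / log 2 : ℝ) : EReal) := by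
  have h2 : log 2 ≠ 0 := (log_pos one_lt_two).ne'
  refine le_antisymm (renyiDiv_le_coe.mpr ?_) (coe_le_renyiDiv.mpr ?_)
  all_goals rw [fidelity_one hp hq hpq, div_mul_cancel₀ _ h2]

theorem renyiDiv_le_renyiDiv_one (hp : ∑ i, p i = 1) (hq : ∀ i, q i ≠ ∞) (h0 : α ≠ 0)
    (h1 : α ≤ 1) : renyiDiv α p q ≤ renyiDiv 1 p q := by
  rcases h1.eq_or_lt with rfl | h1
  · exact le_rfl
  have hT : ∀ i, p i ≠ ∞ := fun i =>
    ENNReal.sum_ne_top.mp (hp ▸ ENNReal.one_ne_top) i (Finset.mem_univ i)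
  by_cases hpq : ∀ i, p i ≠ 0 → q i ≠ 0
  · rw [renyiDiv_one hT hq hpq, renyiDiv_le_coe_of_lt_one h0 h1 hT hq,
      div_mul_cancel₀ _ (log_pos one_lt_two).ne', mul_comm]
    refine exp_mul_relEntropy_le_affinity (toVec_mem_of_sum_eq_one hp) (toVec_nonneg q)
      (fun i hi => ?_) (ENNReal.toReal_pos h0 h1.ne_top)
    exact (toVec_pos (hpq i fun h => hi (by simp [toVec, h])) (hq i)).ne'
  · push Not at hpq
    obtain ⟨i, hi, hqi⟩ := hpq
    rw [renyiDiv_eq_top_of_one_le (α := 1) le_rfl ENNReal.one_ne_top hT hi hqi]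
    exact le_top

theorem renyiDiv_one_le_renyiDiv (hp : ∑ i, p i = 1) (hq : ∀ i, q i ≠ ∞) (h1 : 1 < α)
    (hαT : α ≠ ∞) : renyiDiv 1 p q ≤ renyiDiv α p q := by
  have hT : ∀ i, p i ≠ ∞ := fun i =>
    ENNReal.sum_ne_top.mp (hp ▸ ENNReal.one_ne_top) i (Finset.mem_univ i)
  by_cases hpq : ∀ i, p i ≠ 0 → q i ≠ 0
  · rw [renyiDiv_one hT hq hpq]
    refine coe_le_renyiDiv_of_one_lt h1 hαT hT hq fun _ => ?_
    rw [div_mul_cancel₀ _ (log_pos one_lt_two).ne', mul_comm]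
    refine exp_mul_relEntropy_le_affinity (toVec_mem_of_sum_eq_one hp) (toVec_nonneg q)
      (fun i hi => ?_) (one_pos.trans (one_lt_toReal h1 hαT))
    exact (toVec_pos (hpq i fun h => hi (by simp [toVec, h])) (hq i)).ne'
  · push Not at hpq
    obtain ⟨i, hi, hqi⟩ := hpq
    rw [renyiDiv_eq_top_of_one_le h1.le hαT hT hi hqi]
    exact le_top

end Renyi

/-! ### Monotonicity of the fidelity -/

section Monotone

variable {ι : Type*} {α : ℝ≥0∞} {p q q' : ι → ℝ≥0∞}

theorem rpow_le_rpow_of_exponent_nonpos {s : ℝ} (hs : s ≤ 0) {u v : ℝ≥0∞} (h : u ≤ v) :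
    v ^ s ≤ u ^ s := by
  rw [← neg_neg s, ENNReal.rpow_neg v, ENNReal.rpow_neg u]
  exact ENNReal.inv_le_inv.mpr (ENNReal.rpow_le_rpow h (neg_nonneg.mpr hs))

theorem prod_const_rpow {c : ℝ≥0∞} (hc0 : c ≠ 0) (hcT : c ≠ ∞) (s : Finset ι) (f : ι → ℝ) :
    ∏ i ∈ s, c ^ f i = c ^ ∑ i ∈ s, f i := by
  induction s using Finset.cons_induction with
  | empty => simp
  | cons i s hi ih => rw [Finset.prod_cons, Finset.sum_cons, ih, ENNReal.rpow_add _ _ hc0 hcT]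

variable [Fintype ι]

theorem fidelity_mono (h : q ≤ q') : fidelity α p q ≤ fidelity α p q' := by
  by_cases h0 : α = 0
  · simp only [fidelity, if_pos h0]
    exact Finset.sum_le_sum fun i _ => Set.indicator_le_indicator (h i)
  by_cases h1 : α = 1
  · simp only [fidelity, if_neg h0, if_pos h1]
    exact Finset.prod_le_prod' fun i _ =>
      ENNReal.rpow_le_rpow (ENNReal.div_le_div_right (h i) _) ENNReal.toReal_nonneg
  by_cases hT : α = ∞
  · simp only [fidelity, if_neg h0, if_neg h1, if_pos hT]
    exact iInf₂_mono fun i _ => ENNReal.div_le_div_right (h i) _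
  rw [fidelity_eq_rpow h0 h1 hT, fidelity_eq_rpow h0 h1 hT]
  rcases lt_or_gt_of_ne h1 with h1 | h1
  · have hs : 0 ≤ 1 - α.toReal := sub_nonneg.mpr (toReal_lt_one h1).le
    exact ENNReal.rpow_le_rpow (Finset.sum_le_sum fun i _ => by gcongr; exact h i)
      (one_div_nonneg.mpr hs)
  · have hs : 1 - α.toReal ≤ 0 := sub_nonpos.mpr (one_lt_toReal h1 hT).le
    exact rpow_le_rpow_of_exponent_nonpos (one_div_nonpos.mpr hs) (Finset.sum_le_sum fun i _ =>
      mul_le_mul_right (rpow_le_rpow_of_exponent_nonpos hs (h i)) _)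

theorem le_fidelity_smul_self (hp : ∑ i, p i = 1) {c : ℝ≥0∞} (hc0 : c ≠ 0) (hcT : c ≠ ∞) :
    c ≤ fidelity α p (c • p) := by
  have hpT : ∀ i, p i ≠ ∞ := fun i =>
    ENNReal.sum_ne_top.mp (hp ▸ ENNReal.one_ne_top) i (Finset.mem_univ i)
  have hdiv : ∀ i, p i ≠ 0 → c * p i / p i = c := fun i hi =>
    ENNReal.mul_div_cancel_right hi (hpT i)
  by_cases h0 : α = 0
  · have hsupp : (Function.support p).indicator (c • p) = c • p :=
      Set.indicator_eq_self.mpr (Function.support_const_smul_subset c p)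
    simp only [fidelity, if_pos h0, hsupp, Pi.smul_apply, smul_eq_mul]
    rw [← Finset.mul_sum, hp, mul_one]
  by_cases h1 : α = 1
  · simp only [fidelity, if_neg h0, if_pos h1, Pi.smul_apply, smul_eq_mul]
    have hterm : ∀ i, (c * p i / p i) ^ (p i).toReal = c ^ toVec p i := by
      intro i
      by_cases hi : p i = 0
      · simp [toVec, hi]
      · rw [hdiv i hi, toVec]
    rw [Finset.prod_congr rfl fun i _ => hterm i, prod_const_rpow hc0 hcT,
      (toVec_mem_of_sum_eq_one hp).2, ENNReal.rpow_one]
  by_cases hT : α = ∞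
  · simp only [fidelity, if_neg h0, if_neg h1, if_pos hT]
    exact le_iInf₂ fun i hi => (hdiv i hi).ge
  rw [fidelity_eq_rpow h0 h1 hT]
  have hterm : ∀ i, p i ^ α.toReal * (c * p i) ^ (1 - α.toReal) = c ^ (1 - α.toReal) * p i := by
    intro i
    by_cases hi : p i = 0
    · simp [hi, ENNReal.zero_rpow_of_pos (ENNReal.toReal_pos h0 hT)]
    · rw [ENNReal.mul_rpow_of_ne_top hcT (hpT i), mul_left_comm, ← ENNReal.rpow_add _ _ hi (hpT i)]
      simp
  have hs : 1 - α.toReal ≠ 0 :=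
    sub_ne_zero.mpr fun h => h1 ((ENNReal.toReal_eq_one_iff α).mp h.symm)
  simp only [Pi.smul_apply, smul_eq_mul, hterm]
  rw [← Finset.mul_sum, hp, mul_one, ← ENNReal.rpow_mul, mul_one_div_cancel hs, ENNReal.rpow_one]

end Monotone

/-! ### Simulation by rejection sampling -/

section Simulation

variable {X Y : Type*}

/-- `N` is realised by shared randomness and one of `M` messages; `IsSimulation` with the number
of messages in place of the cost and with real transition matrices. -/
def IsSimulationOfSize (N : Channel X Y) (M : ℕ) : Prop :=
  ∃ (K : Type) (_ : Fintype K) (PK : PMF K)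
    (E : Channel (X × K) (Fin M)) (D : Channel (Fin M × K) Y),
    ∀ x y, toMat N x y = ∑ k, toVec PK k * ∑ j, toVec (E (x, k)) j * toVec (D (j, k)) y

theorem isSimulation_iff {N : Channel X Y} {c : ℝ} :
    IsSimulation N c ↔ ∃ M : ℕ, 1 ≤ M ∧ logb 2 M ≤ c ∧ IsSimulationOfSize N M := by
  refine exists_congr fun M => and_congr_right fun _ => and_congr_right fun _ => ?_
  refine exists_congr fun K => exists_congr fun _ => exists_congr fun PK =>
    exists_congr fun E => exists_congr fun D => forall_congr' fun x => forall_congr' fun y => ?_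
  have hT : ∀ k j, PK k * E (x, k) j * D (j, k) y ≠ ∞ := fun k j =>
    ENNReal.mul_ne_top (ENNReal.mul_ne_top (PK.apply_ne_top _) ((E _).apply_ne_top _))
      ((D _).apply_ne_top _)
  have hsumT : ∀ k, ∑ j, PK k * E (x, k) j * D (j, k) y ≠ ∞ := fun k =>
    ENNReal.sum_ne_top.mpr fun j _ => hT k j
  rw [← ENNReal.toReal_eq_toReal_iff' ((N x).apply_ne_top y)
    (ENNReal.sum_ne_top.mpr fun k _ => hsumT k), ENNReal.toReal_sum fun k _ => hsumT k]
  have hsum : ∀ k, (∑ j, PK k * E (x, k) j * D (j, k) y).toReal =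
      toVec PK k * ∑ j, toVec (E (x, k)) j * toVec (D (j, k)) y := fun k => by
    rw [ENNReal.toReal_sum fun j _ => hT k j]
    simp only [ENNReal.toReal_mul, toVec, Finset.mul_sum, mul_assoc]
  simp only [hsum, toMat, toVec]

theorem isSimulationOfSize_of_sum {N : Channel X Y} {M : ℕ} {K : Type*} [Fintype K] [Fintype Y]
    {P : K → ℝ} {e : K → X → Fin M → ℝ} {d : K → Fin M → Y → ℝ} (hP : P ∈ stdSimplex ℝ K)
    (he : ∀ k x, e k x ∈ stdSimplex ℝ (Fin M)) (hd : ∀ k j, d k j ∈ stdSimplex ℝ Y)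
    (hN : ∀ x y, toMat N x y = ∑ k, P k * ∑ j, e k x j * d k j y) : IsSimulationOfSize N M := by
  let φ := (Fintype.equivFin K).symm
  have hPφ : P ∘ φ ∈ stdSimplex ℝ (Fin (Fintype.card K)) :=
    ⟨fun k => hP.1 (φ k), (φ.sum_comp P).trans hP.2⟩
  refine ⟨Fin (Fintype.card K), inferInstance, ofVec _ hPφ, fun z => ofVec _ (he (φ z.2) z.1),
    fun z => ofVec _ (hd (φ z.2) z.1), fun x y => ?_⟩
  simp only [toVec_ofVec, hN]
  exact (φ.sum_comp fun k => P k * ∑ j, e k x j * d k j y).symm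

theorem IsSimulationOfSize.exists_le [Fintype Y] {N : Channel X Y} {M : ℕ} (hM : M ≠ 0)
    (h : IsSimulationOfSize N M) :
    ∃ q ∈ stdSimplex ℝ Y, ∀ x y, toMat N x y ≤ M * q y := by
  obtain ⟨K, _, PK, E, D, hN⟩ := h
  have hM0 : (M : ℝ) ≠ 0 := Nat.cast_ne_zero.mpr hM
  have hPK := toVec_mem PK
  have hD : ∀ k y, 0 ≤ ∑ j, toVec (D (j, k)) y := fun k y =>
    Finset.sum_nonneg fun j _ => toVec_nonneg _ y
  have hDsum : ∀ k, ∑ y, ∑ j, toVec (D (j, k)) y = M := fun k => by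
    rw [Finset.sum_comm]
    simp [(toVec_mem _).2]
  have hEN : ∀ x y, toMat N x y ≤ ∑ k, toVec PK k * ∑ j, toVec (D (j, k)) y := by
    intro x y
    rw [hN]
    refine Finset.sum_le_sum fun k _ => mul_le_mul_of_nonneg_left (Finset.sum_le_sum fun j _ => ?_)
      (hPK.1 k)
    exact mul_le_of_le_one_left (toVec_nonneg _ y)
      ((mem_Icc_of_mem_stdSimplex (toVec_mem (E (x, k))) j).2)
  refine ⟨fun y => (M : ℝ)⁻¹ * ∑ k, toVec PK k * ∑ j, toVec (D (j, k)) y,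
    ⟨fun y => mul_nonneg (by positivity) (Finset.sum_nonneg fun k _ =>
      mul_nonneg (hPK.1 k) (hD k y)), ?_⟩, fun x y => ?_⟩
  · rw [← Finset.mul_sum, Finset.sum_comm]
    simp only [← Finset.mul_sum, hDsum]
    rw [← Finset.sum_mul, hPK.2, one_mul, inv_mul_cancel₀ hM0]
  · rw [mul_inv_cancel_left₀ hM0]
    exact hEN x y

theorem IsSimulation.exists_le [Fintype Y] {N : Channel X Y} {c : ℝ} (h : IsSimulation N c) :
    ∃ q ∈ stdSimplex ℝ Y, ∀ x y, toMat N x y ≤ exp (c * log 2) * q y := by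
  obtain ⟨M, hM, hMc, hN⟩ := isSimulation_iff.mp h
  have hM0 : (0 : ℝ) < M := by exact_mod_cast hM
  have hMle : (M : ℝ) ≤ exp (c * log 2) := by
    rwa [← log_le_iff_le_exp hM0, ← div_le_iff₀ (log_pos one_lt_two)]
  obtain ⟨q, hq, hle⟩ := hN.exists_le (Nat.one_le_iff_ne_zero.mp hM)
  exact ⟨q, hq, fun x y => (hle x y).trans (mul_le_mul_of_nonneg_right hMle (hq.1 y))⟩

theorem isSimulationOfSize_const (Q : PMF Y) : IsSimulationOfSize (fun _ : X => Q) 1 := by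
  refine ⟨Unit, inferInstance, PMF.pure (), fun _ => PMF.pure 0, fun _ => Q, fun x y => ?_⟩
  simp [toMat, toVec]

theorem cons_mem_stdSimplex {M : ℕ} {p : Fin M → ℝ} (hp : p ∈ stdSimplex ℝ (Fin M)) {a : ℝ}
    (ha0 : 0 ≤ a) (ha1 : a ≤ 1) :
    (Fin.cons a fun j => (1 - a) * p j : Fin (M + 1) → ℝ) ∈ stdSimplex ℝ (Fin (M + 1)) := by
  refine ⟨fun j => ?_, ?_⟩
  · refine Fin.cases ?_ (fun j => ?_) j
    · simpa using ha0
    · simpa using mul_nonneg (sub_nonneg.mpr ha1) (hp.1 j)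
  · rw [Fin.sum_univ_succ]
    simp [← Finset.mul_sum, hp.2]

variable [Fintype Y]

theorem mul_mem_stdSimplex_prod {K : Type*} [Fintype K] {p : K → ℝ} {q : Y → ℝ}
    (hp : p ∈ stdSimplex ℝ K) (hq : q ∈ stdSimplex ℝ Y) :
    (fun z : K × Y => p z.1 * q z.2) ∈ stdSimplex ℝ (K × Y) := by
  refine ⟨fun z => mul_nonneg (hp.1 _) (hq.1 _), ?_⟩
  simp only [Fintype.sum_prod_type, ← Finset.mul_sum, hq.2, mul_one, hp.2]

theorem add_one_sub_sum_mul_mem_stdSimplex {v p : Y → ℝ} (hv : ∀ y, 0 ≤ v y)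
    (hv1 : ∑ y, v y ≤ 1) (hp : p ∈ stdSimplex ℝ Y) :
    (fun y => v y + (1 - ∑ y', v y') * p y) ∈ stdSimplex ℝ Y := by
  refine ⟨fun y => add_nonneg (hv y) (mul_nonneg (sub_nonneg.mpr hv1) (hp.1 y)), ?_⟩
  rw [Finset.sum_add_distrib, ← Finset.mul_sum, hp.2]
  ring

-- The shared randomness proposes a symbol `y ∼ Q`, which the sender accepts with probability
-- `v x y / Q y` by sending the additional message; otherwise the given simulation takes over.
theorem IsSimulationOfSize.exists_succ {N : Channel X Y} {M : ℕ} (h : IsSimulationOfSize N M)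
    (Q : PMF Y) {v : X → Y → ℝ} (hv : ∀ x y, 0 ≤ v x y) (hvQ : ∀ x y, v x y ≤ toVec Q y) :
    ∃ N' : Channel X Y, IsSimulationOfSize N' (M + 1) ∧
      ∀ x y, toMat N' x y = v x y + (1 - ∑ y', v x y') * toMat N x y := by
  classical
  have hQ := toVec_mem Q
  have hv1 : ∀ x, ∑ y, v x y ≤ 1 := fun x =>
    hQ.2 ▸ Finset.sum_le_sum fun y _ => hvQ x y
  obtain ⟨K, _, PK, E, D, hN⟩ := h
  set a : X → Y → ℝ := fun x y => v x y / toVec Q y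
  have ha0 : ∀ x y, 0 ≤ a x y := fun x y => div_nonneg (hv _ _) (hQ.1 _)
  have ha1 : ∀ x y, a x y ≤ 1 := fun x y => div_le_one_of_le₀ (hvQ _ _) (hQ.1 _)
  have haQ : ∀ x y, toVec Q y * a x y = v x y := fun x y =>
    mul_div_cancel_of_imp' fun h => ((hvQ x y).trans h.le).antisymm (hv x y)
  refine ⟨fun x => ofVec _ (add_one_sub_sum_mul_mem_stdSimplex (hv x) (hv1 x) (toMat_mem N x)),
    isSimulationOfSize_of_sum (K := K × Y) (mul_mem_stdSimplex_prod (toVec_mem PK) hQ)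
      (e := fun z x => Fin.cons (a x z.2) fun j => (1 - a x z.2) * toVec (E (x, z.1)) j)
      (d := fun z => Fin.cons (Pi.single z.2 1) fun j => toVec (D (j, z.1)))
      (fun z x => cons_mem_stdSimplex (toVec_mem _) (ha0 _ _) (ha1 _ _))
      (fun z => Fin.cases (single_mem_stdSimplex ℝ z.2) fun j => toVec_mem _) fun x y => ?_,
    fun x y => by rw [toMat, toVec_ofVec]⟩
  have hround : ∀ S : ℝ, ∑ z, toVec Q z * (a x z * (Pi.single z 1 : Y → ℝ) y + (1 - a x z) * S) =
      v x y + (1 - ∑ y', v x y') * S := by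
    intro S
    simp only [mul_add, ← mul_assoc, mul_sub, haQ, mul_one]
    rw [Finset.sum_add_distrib, ← Finset.sum_mul, Finset.sum_sub_distrib, hQ.2]
    simp [Pi.single_apply]
  simp only [toMat, toVec_ofVec, Fin.sum_univ_succ, Fin.cons_zero, Fin.cons_succ,
    Fintype.sum_prod_type, mul_assoc, ← Finset.mul_sum, hround]
  simp only [mul_add, Finset.sum_add_distrib, mul_left_comm (toVec PK _), ← Finset.mul_sum,
    ← Finset.sum_mul, (toVec_mem PK).2, one_mul, ← hN, toMat]

theorem exists_isSimulationOfSize_geom_sum_mul_le (Q : PMF Y) {v : X → Y → ℝ}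
    (hv : ∀ x y, 0 ≤ v x y) (hvQ : ∀ x y, v x y ≤ toVec Q y) (M : ℕ) :
    ∃ N : Channel X Y, IsSimulationOfSize N (M + 1) ∧
      ∀ x y, (∑ j ∈ Finset.range (M + 1), (1 - ∑ y', v x y') ^ j) * v x y ≤ toMat N x y := by
  induction M with
  | zero => exact ⟨_, isSimulationOfSize_const Q, fun x y => by simpa [toMat] using hvQ x y⟩
  | succ M ih =>
    obtain ⟨N, hN, hle⟩ := ih
    obtain ⟨N', hN', heq⟩ := hN.exists_succ Q hv hvQ
    refine ⟨N', hN', fun x y => ?_⟩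
    have hreject : 0 ≤ 1 - ∑ y', v x y' := by
      rw [← (toVec_mem Q).2, sub_nonneg]
      exact Finset.sum_le_sum fun y _ => hvQ x y
    rw [heq, geom_sum_succ, add_mul, one_mul, add_comm, mul_assoc]
    gcongr
    exact hle x y

theorem geom_sum_one_sub_inv {L : ℝ} (hL : L ≠ 0) (M : ℕ) :
    ∑ j ∈ Finset.range M, (1 - L⁻¹) ^ j = (1 - (1 - L⁻¹) ^ M) * L := by
  have h := mul_neg_geom_sum (1 - L⁻¹) M
  rw [sub_sub_cancel] at h
  rw [← h, mul_comm, mul_inv_cancel_left₀ hL]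

theorem exists_isSimulationOfSize_mul_le (Q : PMF Y) {u : X → Y → ℝ} {L : ℝ} (hL : 1 ≤ L)
    (hu : ∀ x y, 0 ≤ u x y) (huQ : ∀ x y, u x y ≤ L * toVec Q y) (hu1 : ∀ x, ∑ y, u x y ≤ 1)
    {M : ℕ} (hM : M ≠ 0) :
    ∃ N : Channel X Y, IsSimulationOfSize N M ∧
      ∀ x y, (1 - exp (-(M / L))) * u x y ≤ toMat N x y := by
  have hL0 : 0 < L := one_pos.trans_le hL
  obtain ⟨m, rfl⟩ := Nat.exists_eq_succ_of_ne_zero hM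
  obtain ⟨N, hN, hle⟩ := exists_isSimulationOfSize_geom_sum_mul_le Q (v := fun x y => L⁻¹ * u x y)
    (fun x y => mul_nonneg (inv_nonneg.mpr hL0.le) (hu x y))
    (fun x y => (inv_mul_le_iff₀ hL0).mpr (huQ x y)) m
  refine ⟨N, hN, fun x y => le_trans ?_ (hle x y)⟩
  have hL1 : 0 ≤ 1 - L⁻¹ := sub_nonneg.mpr (inv_le_one_of_one_le₀ hL)
  have haccept : ∑ y', L⁻¹ * u x y' ≤ L⁻¹ := by
    rw [← Finset.mul_sum]
    exact mul_le_of_le_one_right (inv_nonneg.mpr hL0.le) (hu1 x)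
  have hexp : (1 - L⁻¹) ^ (m + 1) ≤ exp (-((m + 1 : ℕ) / L)) := by
    calc (1 - L⁻¹) ^ (m + 1) ≤ exp (-L⁻¹) ^ (m + 1) :=
          pow_le_pow_left₀ hL1 (one_sub_le_exp_neg L⁻¹) _
      _ = exp (-((m + 1 : ℕ) / L)) := by rw [← exp_nat_mul, div_eq_mul_inv, mul_neg]
  calc (1 - exp (-((m + 1 : ℕ) / L))) * u x y ≤ (1 - (1 - L⁻¹) ^ (m + 1)) * u x y :=
        mul_le_mul_of_nonneg_right (sub_le_sub_left hexp 1) (hu x y)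
    _ = (∑ j ∈ Finset.range (m + 1), (1 - L⁻¹) ^ j) * (L⁻¹ * u x y) := by
        rw [geom_sum_one_sub_inv hL0.ne', mul_assoc, mul_inv_cancel_left₀ hL0.ne']
    _ ≤ (∑ j ∈ Finset.range (m + 1), (1 - ∑ y', L⁻¹ * u x y') ^ j) * (L⁻¹ * u x y) :=
        mul_le_mul_of_nonneg_right (Finset.sum_le_sum fun j _ => pow_le_pow_left₀ hL1
          (sub_le_sub_left haccept 1) _) (mul_nonneg (inv_nonneg.mpr hL0.le) (hu x y))

end Simulation

/-! ### Capacities of finite order -/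

section Capacity

variable {X Y : Type*} [Fintype X] [Fintype Y]

theorem mutualInfo_eq {β : ℝ≥0∞} (h1 : 1 < β) (hT : β ≠ ∞) (P : PMF X) (W : Channel X Y) :
    mutualInfo β P W =
      ((scaledInfo (toVec P) (toMat W) β.toReal / ((β.toReal - 1) * log 2) : ℝ) : EReal) := by
  have hb := one_lt_toReal h1 hT
  have hb0 : 0 < β.toReal := one_pos.trans hb
  have hP := toVec_mem P
  have hW := toMat_mem W
  have hscale : scaledInfo (toVec P) (toMat W) β.toReal / ((β.toReal - 1) * log 2) * log 2 *
      (β.toReal - 1) = scaledInfo (toVec P) (toMat W) β.toReal := by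
    have hb1 : β.toReal - 1 ≠ 0 := (sub_pos.mpr hb).ne'
    have h2 : log 2 ≠ 0 := (log_pos one_lt_two).ne'
    field_simp
  refine le_antisymm ?_ (le_iInf fun Q => ?_)
  · refine iInf_le_of_le (ofVec _ (sibsonOutput_mem hP hW β.toReal)) ?_
    rw [prodDist_eq_joint, renyiDiv_le_coe_of_one_lt h1 hT (joint_ne_top _ _) (joint_ne_top _ _),
      hscale, affinity_joint, ← sum_mul_affinity_sibsonOutput hP hW hb0]
    · simp only [toMat, toVec_ofVec, le_refl]
    · rintro ⟨x, y⟩ h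
      rw [joint_ne_zero_iff] at h ⊢
      rw [toMat, toVec_ofVec]
      exact ⟨h.1, (sibsonOutput_pos hP hW _ (mul_ne_zero h.1 h.2)).ne'⟩
  · rw [prodDist_eq_joint]
    refine coe_le_renyiDiv_of_one_lt h1 hT (joint_ne_top _ _) (joint_ne_top _ _) fun hpq => ?_
    rw [hscale, affinity_joint]
    refine exp_scaledInfo_le hP hW hb.le (toVec_mem Q).1 (toVec_mem Q).2.le fun x y h => ?_
    exact (joint_ne_zero_iff.mp (hpq (x, y) (joint_ne_zero_iff.mpr (mul_ne_zero_iff.mp h)))).2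

theorem stdSimplex_nonempty (ι : Type*) [Fintype ι] [Nonempty ι] : (stdSimplex ℝ ι).Nonempty := by
  classical
  exact ⟨_, single_mem_stdSimplex ℝ (Classical.arbitrary ι)⟩

theorem exists_capacity_eq [Nonempty X] {β : ℝ≥0∞} (h1 : 1 < β) (hT : β ≠ ∞) (W : Channel X Y) :
    ∃ P ∈ stdSimplex ℝ X,
      capacity β W =
        ((scaledInfo P (toMat W) β.toReal / ((β.toReal - 1) * log 2) : ℝ) : EReal) ∧
      ∀ P' ∈ stdSimplex ℝ X,
        scaledInfo P' (toMat W) β.toReal ≤ scaledInfo P (toMat W) β.toReal := by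
  have hb := one_lt_toReal h1 hT
  obtain ⟨P, hP, hmax⟩ := (isCompact_stdSimplex ℝ X).exists_isMaxOn (stdSimplex_nonempty X)
    (continuousOn_scaledInfo (toMat_mem W) (zero_le_one.trans hb.le))
  refine ⟨P, hP, le_antisymm (iSup_le fun P' => ?_) ?_, hmax⟩
  · rw [mutualInfo_eq h1 hT, EReal.coe_le_coe_iff]
    refine div_le_div_of_nonneg_right (hmax (toVec_mem P')) ?_
    exact mul_nonneg (sub_nonneg.mpr hb.le) (log_pos one_lt_two).le
  · refine le_iSup_of_le (ofVec P hP) ?_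
    rw [mutualInfo_eq h1 hT, toVec_ofVec]

end Capacity

/-! ### Minimax for outputs and for inputs -/

section Minimax

theorem convexOn_affinity {ι : Type*} [Fintype ι] {p : ι → ℝ} (hp : ∀ i, 0 ≤ p i) {b : ℝ}
    (hb : 1 ≤ b) : ConvexOn ℝ {q : ι → ℝ | ∀ i, 0 < q i} (affinity b p) := by
  refine ⟨fun q hq q' hq' c d hc hd hcd i => convex_Ioi (0 : ℝ) (hq i) (hq' i) hc hd hcd,
    fun q hq q' hq' c d hc hd hcd => ?_⟩
  simp only [affinity, smul_eq_mul, Finset.mul_sum, ← Finset.sum_add_distrib]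
  refine Finset.sum_le_sum fun i _ => ?_
  calc p i ^ b * (c • q + d • q') i ^ (1 - b)
      ≤ p i ^ b * (c * q i ^ (1 - b) + d * q' i ^ (1 - b)) :=
        mul_le_mul_of_nonneg_left ((convexOn_rpow_of_nonpos (sub_nonpos.mpr hb)).2 (hq i) (hq' i)
          hc hd hcd) (rpow_nonneg (hp i) b)
    _ = c * (p i ^ b * q i ^ (1 - b)) + d * (p i ^ b * q' i ^ (1 - b)) := by ring

theorem continuousOn_affinity {ι : Type*} [Fintype ι] (p : ι → ℝ) (b : ℝ) :
    ContinuousOn (affinity b p) {q : ι → ℝ | ∀ i, 0 < q i} :=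
  continuousOn_finsetSum _ fun i _ => continuousOn_const.mul
    ((continuous_apply i).continuousOn.rpow_const fun _ hq => Or.inl (hq i).ne')

variable {X Y : Type*} [Fintype X] [Fintype Y] {w : X → Y → ℝ}

theorem exists_mem_stdSimplex_forall_sum_mul_affinity_le [Nonempty X]
    (hw : ∀ x y, 0 ≤ w x y) {b η C : ℝ} (hb : 1 ≤ b) (hη : 0 < η)
    (h : ∀ P ∈ stdSimplex ℝ X, ∃ q ∈ stdSimplex ℝ Y, (∀ y, η ≤ q y) ∧
      ∑ x, P x * affinity b (w x) q ≤ C) :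
    ∃ q ∈ stdSimplex ℝ Y, (∀ y, η ≤ q y) ∧ ∀ x, affinity b (w x) q ≤ C := by
  classical
  set S : Set (Y → ℝ) := stdSimplex ℝ Y ∩ Set.Ici fun _ => η
  have hSpos : S ⊆ {q | ∀ y, 0 < q y} := fun q hq y => hη.trans_le (hq.2 y)
  have hSconv : Convex ℝ S := (convex_stdSimplex ℝ Y).inter (convex_Ici _)
  have hSne : S.Nonempty := by
    obtain ⟨P, hP⟩ := stdSimplex_nonempty X
    obtain ⟨q, hq, hηq, -⟩ := h P hP
    exact ⟨q, hq, hηq⟩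
  obtain ⟨q, hq, hle⟩ := exists_forall_le_of_forall_exists_le (S := S) (T := stdSimplex ℝ X)
    (f := fun q P => ∑ x, P x * affinity b (w x) q) (C := C) hSne hSconv
    ((isCompact_stdSimplex ℝ Y).inter_right isClosed_Ici) (convex_stdSimplex ℝ X)
    (fun P _ => (continuousOn_finsetSum _ fun x _ => continuousOn_const.mul
      ((continuousOn_affinity (w x) b).mono hSpos)).lowerSemicontinuousOn)
    (fun P hP => by
      refine ConvexOn.quasiconvexOn ⟨hSconv, fun q hq q' hq' c d hc hd hcd => ?_⟩
      simp only [smul_eq_mul, Finset.mul_sum, ← Finset.sum_add_distrib]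
      refine Finset.sum_le_sum fun x _ => ?_
      rw [mul_left_comm c, mul_left_comm d, ← mul_add]
      exact mul_le_mul_of_nonneg_left ((convexOn_affinity (hw x) hb).2 (hSpos hq) (hSpos hq')
        hc hd hcd) (hP.1 x))
    (fun q _ => (Continuous.continuousOn (by fun_prop)).upperSemicontinuousOn)
    (fun q _ => ConcaveOn.quasiconcaveOn ⟨convex_stdSimplex ℝ X, fun P _ P' _ c d _ _ _ => by
      simp only [smul_eq_mul, Pi.add_apply, Pi.smul_apply, Finset.mul_sum, add_mul,
        Finset.sum_add_distrib, mul_assoc, le_refl]⟩)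
    (fun P hP => by
      obtain ⟨q, hq, hηq, hle⟩ := h P hP
      exact ⟨q, ⟨hq, hηq⟩, hle⟩)
  refine ⟨q, hq.1, hq.2, fun x => ?_⟩
  simpa [Pi.single_apply] using hle _ (single_mem_stdSimplex ℝ x)

-- Mixing Sibson's output with the uniform distribution keeps the candidates away from the boundary
-- of the simplex, where the affinity is not continuous.
theorem exists_output_of_scaledInfo_lt [Nonempty X] (hw : ∀ x, w x ∈ stdSimplex ℝ Y) {b s t : ℝ}
    (hb : 1 < b) (hs : ∀ P ∈ stdSimplex ℝ X, scaledInfo P w b ≤ s) (hst : s < t) :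
    ∃ q ∈ stdSimplex ℝ Y, (∀ y, 0 < q y) ∧ ∀ x, affinity b (w x) q ≤ exp t := by
  have hY : Nonempty Y := ⟨(exists_pos_of_mem_stdSimplex (hw (Classical.arbitrary X))).choose⟩
  have hcard : (0 : ℝ) < Fintype.card Y := by exact_mod_cast Fintype.card_pos
  have hb1 : 0 < b - 1 := sub_pos.mpr hb
  set K := exp ((t - s) / (b - 1))
  have hK0 : 0 < K := exp_pos _
  have hK1 : K⁻¹ < 1 := inv_lt_one_of_one_lt₀ (one_lt_exp_iff.mpr (div_pos (sub_pos.mpr hst) hb1))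
  have hKpow : K ^ (b - 1) = exp (t - s) := by rw [← exp_mul, div_mul_cancel₀ _ hb1.ne']
  set η := (1 - K⁻¹) / Fintype.card Y with hη
  have hη0 : 0 < η := div_pos (sub_pos.mpr hK1) hcard
  obtain ⟨q, hq, hηq, hle⟩ := exists_mem_stdSimplex_forall_sum_mul_affinity_le (C := exp t)
    (fun x => (hw x).1) hb.le hη0 fun P hP => by
      have hsib := sibsonOutput_mem hP hw b
      have hsib0 : ∀ y, 0 ≤ K⁻¹ * sibsonOutput P w b y := fun y =>
        mul_nonneg (inv_nonneg.mpr hK0.le) (hsib.1 y)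
      refine ⟨fun y => K⁻¹ * sibsonOutput P w b y + η, ⟨fun y => add_nonneg (hsib0 y) hη0.le, ?_⟩,
        fun y => le_add_of_nonneg_left (hsib0 y), ?_⟩
      · rw [Finset.sum_add_distrib, ← Finset.mul_sum, hsib.2, Finset.sum_const, Finset.card_univ,
          nsmul_eq_mul, hη, mul_div_cancel₀ _ hcard.ne', mul_one, add_sub_cancel]
      · refine (sum_mul_affinity_le_of_sibsonOutput_le hP hw hb.le hK0 fun y => ?_).trans ?_
        · rw [mul_add, mul_inv_cancel_left₀ hK0.ne']
          exact le_add_of_nonneg_right (mul_pos hK0 hη0).le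
        · rw [hKpow, ← exp_add, exp_le_exp]
          linarith [hs P hP]
  exact ⟨q, hq, fun y => hη0.trans_le (hηq y), hle⟩

theorem quasiconvexOn_mul_sub_scaledInfo (hw : ∀ x, w x ∈ stdSimplex ℝ Y) {b : ℝ} (hb : 1 ≤ b)
    (r : ℝ) : QuasiconvexOn ℝ (stdSimplex ℝ X) fun P => (b - 1) * r - scaledInfo P w b := by
  intro c
  have hsublevel : {P ∈ stdSimplex ℝ X | (b - 1) * r - scaledInfo P w b ≤ c} =
      {P ∈ stdSimplex ℝ X | exp (((b - 1) * r - c) / b) ≤ sibson P w b} := by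
    refine Set.ext fun P => and_congr_right fun hP => ?_
    rw [← le_log_iff_exp_le (sibson_pos hP hw b), div_le_iff₀ (one_pos.trans_le hb), scaledInfo,
      mul_comm (log _), sub_le_comm]
  exact hsublevel ▸ (concaveOn_sibson (fun x => (hw x).1) hb).quasiconcaveOn _

theorem exists_input_forall_order [Nonempty X] (hw : ∀ x, w x ∈ stdSimplex ℝ Y) {a r C : ℝ}
    (ha : 1 ≤ a) (h : ∀ b, a ≤ b → ∃ P ∈ stdSimplex ℝ X, (b - 1) * r - scaledInfo P w b ≤ C) :
    ∃ P ∈ stdSimplex ℝ X, ∀ b, a ≤ b → (b - 1) * r - scaledInfo P w b ≤ C := by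
  have hpos : ∀ b ∈ Set.Ici a, 0 < b := fun b hb => one_pos.trans_le (ha.trans hb)
  refine exists_forall_le_of_forall_exists_le (S := stdSimplex ℝ X) (T := Set.Ici a)
    (f := fun P b => (b - 1) * r - scaledInfo P w b) (stdSimplex_nonempty X)
    (convex_stdSimplex ℝ X) (isCompact_stdSimplex ℝ X) (convex_Ici a) (fun b hb => ?_)
    (fun b hb => quasiconvexOn_mul_sub_scaledInfo hw (ha.trans hb) r) (fun P hP => ?_)
    (fun P hP => ?_) h
  · exact (continuousOn_const.sub (continuousOn_scaledInfo hw (hpos b hb).le)).lowerSemicontinuousOn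
  · refine ContinuousOn.upperSemicontinuousOn fun b hb => ContinuousAt.continuousWithinAt ?_
    have := (differentiableAt_scaledInfo hP hw (hpos b hb)).continuousAt
    fun_prop
  · refine ConcaveOn.quasiconcaveOn ⟨convex_Ici a, fun b hb b' hb' c d hc hd hcd => ?_⟩
    have hconv := (convexOn_scaledInfo hP hw).2 (hpos b hb) (hpos b' hb') hc hd hcd
    have hlinear : (c * b + d * b' - 1) * r = c * ((b - 1) * r) + d * ((b' - 1) * r) := by
      linear_combination r * hcd
    simp only [smul_eq_mul] at hconv ⊢
    linarith

end Minimax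

/-! ### Capacity of order infinity -/

section CapacityTop

variable {X Y : Type*} [Fintype X] [Fintype Y] {P : PMF X} {W : Channel X Y} {ξ : Y → X} {r : ℝ}

theorem renyiDiv_top_joint_le_coe {N : Channel X Y} {d : ℝ} :
    renyiDiv ∞ (joint P W) (joint P N) ≤ d ↔
      ∀ x y, toVec P x ≠ 0 → toMat W x y ≤ exp (d * log 2) * toMat N x y := by
  have hpoint (x y) (hPW : joint P W (x, y) ≠ 0) :
      ENNReal.ofReal (exp (-(d * log 2))) ≤ joint P N (x, y) / joint P W (x, y) ↔
        toMat W x y ≤ exp (d * log 2) * toMat N x y := by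
    have hP : 0 < toVec P x := (toVec_nonneg P x).lt_of_ne' (joint_ne_zero_iff.mp hPW).1
    rw [ENNReal.le_div_iff_mul_le (Or.inl hPW) (Or.inl (joint_ne_top _ _ _)),
      ← ofReal_toVec (joint_ne_top P W _), ← ofReal_toVec (joint_ne_top P N _),
      ← ENNReal.ofReal_mul (exp_pos _).le, ENNReal.ofReal_le_ofReal_iff (toVec_nonneg _ _),
      toVec_joint, toVec_joint, mul_left_comm, mul_le_mul_iff_right₀ hP, exp_neg,
      inv_mul_le_iff₀ (exp_pos _)]
  rw [renyiDiv_le_coe, fidelity, if_neg ENNReal.top_ne_zero, if_neg ENNReal.top_ne_one, if_pos rfl,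
    le_iInf₂_iff]
  refine ⟨fun h x y hP => ?_, fun h ⟨x, y⟩ hPW => (hpoint x y hPW).mpr
    (h x y (joint_ne_zero_iff.mp hPW).1)⟩
  by_cases hW : toMat W x y = 0
  · rw [hW]
    exact mul_nonneg (exp_pos _).le (toVec_nonneg _ y)
  · have hPW : joint P W (x, y) ≠ 0 := joint_ne_zero_iff.mpr ⟨hP, hW⟩
    exact (hpoint x y hPW).mp (h (x, y) hPW)

theorem mutualInfo_top_le (hξ : ∀ x y, toVec P x ≠ 0 → toMat W x y ≤ toMat W (ξ y) y)
    (hs : 0 < ∑ y, toMat W (ξ y) y) :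
    mutualInfo ∞ P W ≤ (log (∑ y, toMat W (ξ y) y) / log 2 : ℝ) := by
  have hmem : (fun y => toMat W (ξ y) y / ∑ y, toMat W (ξ y) y) ∈ stdSimplex ℝ Y :=
    ⟨fun y => div_nonneg (toVec_nonneg _ y) hs.le, by rw [← Finset.sum_div, div_self hs.ne']⟩
  refine iInf_le_of_le (ofVec _ hmem) ?_
  rw [prodDist_eq_joint, renyiDiv_top_joint_le_coe]
  intro x y hx
  rw [div_mul_cancel₀ _ (log_pos one_lt_two).ne', exp_log hs, toMat, toMat, toVec_ofVec,
    mul_div_cancel₀ _ hs.ne']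
  exact hξ x y hx

theorem le_mutualInfo_top (hξ : ∀ y, toVec P (ξ y) ≠ 0) (hs : 0 < ∑ y, toMat W (ξ y) y) :
    (log (∑ y, toMat W (ξ y) y) / log 2 : ℝ) ≤ mutualInfo ∞ P W := by
  refine le_iInf fun Q => EReal.le_of_forall_lt_iff_le.mp fun d hd => ?_
  rw [prodDist_eq_joint] at hd
  rw [EReal.coe_le_coe_iff, div_le_iff₀ (log_pos one_lt_two), log_le_iff_le_exp hs,
    ← mul_one (exp _), ← (toVec_mem Q).2, Finset.mul_sum]
  exact Finset.sum_le_sum fun y _ => renyiDiv_top_joint_le_coe.mp hd.le (ξ y) y (hξ y)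

omit [Fintype X] in
theorem sum_apply_pos_of_forall_le {x : X} (h : ∀ y, toMat W x y ≤ toMat W (ξ y) y) :
    0 < ∑ y, toMat W (ξ y) y :=
  one_pos.trans_le <| (toMat_mem W x).2 ▸ Finset.sum_le_sum fun y _ => h y

theorem exists_output_of_capacity_top_le [Nonempty X] (h : capacity ∞ W ≤ r) :
    ∃ q ∈ stdSimplex ℝ Y, ∀ x y, toMat W x y ≤ exp (r * log 2) * q y := by
  have hcard : (0 : ℝ) < Fintype.card X := by exact_mod_cast Fintype.card_pos
  have hU : (fun _ : X => (Fintype.card X : ℝ)⁻¹) ∈ stdSimplex ℝ X :=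
    ⟨fun _ => inv_nonneg.mpr hcard.le, by simp⟩
  choose ξ hmax using fun y => Finite.exists_max fun x => toMat W x y
  have hs : 0 < ∑ y, toMat W (ξ y) y :=
    sum_apply_pos_of_forall_le fun y => hmax y (Classical.arbitrary X)
  have hle : (log (∑ y, toMat W (ξ y) y) / log 2 : ℝ) ≤ (r : EReal) :=
    (le_mutualInfo_top (P := ofVec _ hU) (fun _ => by rw [toVec_ofVec]; exact (inv_pos.2 hcard).ne')
      hs).trans ((le_iSup (mutualInfo ∞ · W) _).trans h)
  rw [EReal.coe_le_coe_iff, div_le_iff₀ (log_pos one_lt_two), log_le_iff_le_exp hs] at hle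
  refine ⟨fun y => toMat W (ξ y) y / ∑ y, toMat W (ξ y) y,
    ⟨fun y => div_nonneg (toVec_nonneg _ y) hs.le, by rw [← Finset.sum_div, div_self hs.ne']⟩,
    fun x y => (hmax y x).trans ?_⟩
  rw [mul_div_left_comm]
  exact le_mul_of_one_le_right (toVec_nonneg _ y) ((one_le_div hs).mpr hle)

theorem exists_input_of_lt_capacity_top (h : r < capacity ∞ W) :
    ∃ P ∈ stdSimplex ℝ X, ∃ ξ : Y → X, (∀ y, 0 < P (ξ y)) ∧
      exp (r * log 2) < ∑ y, toMat W (ξ y) y := by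
  obtain ⟨P, hP⟩ := lt_iSup_iff.mp h
  obtain ⟨x₀, hx₀⟩ := exists_pos_of_mem_stdSimplex (toVec_mem P)
  choose ξ hξ hmax using fun y => Set.exists_max_image {x | 0 < toVec P x} (toMat W · y)
    (Set.toFinite _) ⟨x₀, hx₀⟩
  have hs : 0 < ∑ y, toMat W (ξ y) y := sum_apply_pos_of_forall_le fun y => hmax y x₀ hx₀
  have hlt := hP.trans_le (mutualInfo_top_le
    (fun x y hx => hmax y x ((toVec_nonneg P x).lt_of_ne' hx)) hs)
  rw [EReal.coe_lt_coe_iff, lt_div_iff₀ (log_pos one_lt_two), lt_log_iff_exp_lt hs] at hlt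
  exact ⟨toVec P, toVec_mem P, ξ, hξ, hlt⟩

theorem log_add_mul_log_le_scaledInfo {P : X → ℝ} {w : X → Y → ℝ} (hP : P ∈ stdSimplex ℝ X)
    (hw : ∀ x y, 0 ≤ w x y) {c b : ℝ} (hc : 0 < c) (hcξ : ∀ y, c ≤ P (ξ y))
    (hs : 0 < ∑ y, w (ξ y) y) (hb : 0 < b) :
    log c + b * log (∑ y, w (ξ y) y) ≤ scaledInfo P w b := by
  have hcolumn (y) : c * w (ξ y) y ^ b ≤ columnMoment P w b y :=
    (mul_le_mul_of_nonneg_right (hcξ y) (rpow_nonneg (hw _ y) b)).trans <|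
      Finset.single_le_sum (f := fun x => P x * w x y ^ b)
        (fun x _ => mul_nonneg (hP.1 x) (rpow_nonneg (hw x y) b)) (Finset.mem_univ (ξ y))
  have hsibson : c ^ (1 / b) * ∑ y, w (ξ y) y ≤ sibson P w b := by
    rw [Finset.mul_sum]
    refine Finset.sum_le_sum fun y _ => le_of_eq_of_le ?_ <| rpow_le_rpow
      (mul_nonneg hc.le (rpow_nonneg (hw _ y) b)) (hcolumn y) (one_div_pos.mpr hb).le
    rw [mul_rpow hc.le (rpow_nonneg (hw _ y) b), ← rpow_mul (hw _ y), mul_one_div_cancel hb.ne',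
      rpow_one]
  have hlog := log_le_log (mul_pos (rpow_pos_of_pos hc _) hs) hsibson
  rw [log_mul (rpow_pos_of_pos hc _).ne' hs.ne', log_rpow hc] at hlog
  calc log c + b * log (∑ y, w (ξ y) y)
      = b * (1 / b * log c + log (∑ y, w (ξ y) y)) := by field_simp
    _ ≤ scaledInfo P w b := mul_le_mul_of_nonneg_left hlog hb.le

end CapacityTop

/-! ### Capacity of order zero -/

section CapacityZero

variable {X Y : Type*} [Fintype X] [Fintype Y] {W : Channel X Y} {r : ℝ}

/-- The mass that `q` gives to the support of `p`: the order-zero counterpart of `affinity`. -/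
def supportMass {ι : Type*} [Fintype ι] (p q : ι → ℝ) : ℝ := ∑ i, if p i = 0 then 0 else q i

theorem fidelity_zero_joint (P : PMF X) (W N : Channel X Y) :
    fidelity 0 (joint P W) (joint P N) =
      ENNReal.ofReal (∑ x, toVec P x * supportMass (toMat W x) (toMat N x)) := by
  classical
  have hterm (x y) : 0 ≤ toVec P x * if toMat W x y = 0 then 0 else toMat N x y :=
    mul_nonneg (toVec_nonneg P x) (ite_nonneg le_rfl (toVec_nonneg _ y))
  rw [fidelity, if_pos rfl, Fintype.sum_prod_type]
  simp only [supportMass, Finset.mul_sum]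
  rw [ENNReal.ofReal_sum_of_nonneg fun x _ => Finset.sum_nonneg fun y _ => hterm x y]
  refine Finset.sum_congr rfl fun x _ => ?_
  rw [ENNReal.ofReal_sum_of_nonneg fun y _ => hterm x y]
  refine Finset.sum_congr rfl fun y _ => ?_
  rw [Set.indicator_apply, Function.mem_support, joint_ne_zero_iff]
  by_cases hP : toVec P x = 0 <;> by_cases hW : toMat W x y = 0 <;>
    simp [hP, hW, ← toVec_joint, ofReal_toVec, joint_ne_top]

open Matrix in
theorem exists_mem_stdSimplex_forall_le_mulVec [Nonempty Y] (A : Matrix X Y ℝ) {C : ℝ}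
    (h : ∀ P ∈ stdSimplex ℝ X, ∃ q ∈ stdSimplex ℝ Y, C ≤ P ⬝ᵥ A *ᵥ q) :
    ∃ q ∈ stdSimplex ℝ Y, ∀ x, C ≤ (A *ᵥ q) x := by
  classical
  obtain ⟨q, hq, hle⟩ := exists_forall_le_of_forall_exists_le (S := stdSimplex ℝ Y)
    (T := stdSimplex ℝ X) (f := fun q P => -(P ⬝ᵥ A *ᵥ q)) (C := -C) (stdSimplex_nonempty Y)
    (convex_stdSimplex ℝ Y) (isCompact_stdSimplex ℝ Y) (convex_stdSimplex ℝ X)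
    (fun P _ => (Continuous.continuousOn (by fun_prop)).lowerSemicontinuousOn)
    (fun P _ => ConvexOn.quasiconvexOn ⟨convex_stdSimplex ℝ Y, fun q _ q' _ c d _ _ _ => by
      simp only [mulVec_add, mulVec_smul, dotProduct_add, dotProduct_smul, smul_neg, neg_add,
        le_refl]⟩)
    (fun q _ => (Continuous.continuousOn (by fun_prop)).upperSemicontinuousOn)
    (fun q _ => ConcaveOn.quasiconcaveOn ⟨convex_stdSimplex ℝ X, fun P _ P' _ c d _ _ _ => by
      simp only [add_dotProduct, smul_dotProduct, smul_neg, neg_add, le_refl]⟩)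
    (by simpa only [neg_le_neg_iff] using h)
  refine ⟨q, hq, fun x => ?_⟩
  simpa using hle _ (single_mem_stdSimplex ℝ x)

theorem exists_output_of_capacity_zero_lt [Nonempty X] (h : capacity 0 W < r) :
    ∃ q ∈ stdSimplex ℝ Y, ∀ x, exp (-(r * log 2)) ≤ supportMass (toMat W x) q := by
  have : Nonempty Y :=
    ⟨(exists_pos_of_mem_stdSimplex (toMat_mem W (Classical.arbitrary X))).choose⟩
  set A : Matrix X Y ℝ := fun x y => if toMat W x y = 0 then 0 else 1
  have hA (q x) : A.mulVec q x = supportMass (toMat W x) q := by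
    simp [A, Matrix.mulVec, dotProduct, supportMass]
  simp only [← hA]
  refine exists_mem_stdSimplex_forall_le_mulVec A fun P hP => ?_
  obtain ⟨Q, hQ⟩ := iInf_lt_iff.mp ((le_iSup (mutualInfo 0 · W) (ofVec P hP)).trans_lt h)
  have hfidelity := renyiDiv_le_coe.mp hQ.le
  rw [prodDist_eq_joint, fidelity_zero_joint, toVec_ofVec] at hfidelity
  refine ⟨toVec Q, toVec_mem Q, ?_⟩
  simp only [dotProduct, hA]
  exact (ENNReal.ofReal_le_ofReal_iff'.mp hfidelity).resolve_right (exp_pos _).not_ge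

theorem exists_input_of_lt_capacity_zero (h : r < capacity 0 W) :
    ∃ r' > r, ∃ P ∈ stdSimplex ℝ X, ∀ y,
      supportMass (toMat W · y) P ≤ exp (-(r' * log 2)) := by
  obtain ⟨P, hP⟩ := lt_iSup_iff.mp h
  obtain ⟨r', hr, hr'⟩ := EReal.lt_iff_exists_real_btwn.mp hP
  refine ⟨r', EReal.coe_lt_coe_iff.mp hr, toVec P, toVec_mem P, fun y => ?_⟩
  have hle : r' ≤ renyiDiv 0 (joint P W) (prodDist P (PMF.pure y)) := hr'.le.trans (iInf_le _ _)
  rw [coe_le_renyiDiv, prodDist_eq_joint, fidelity_zero_joint,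
    ENNReal.ofReal_le_ofReal_iff (exp_pos _).le] at hle
  refine le_of_eq_of_le (Finset.sum_congr rfl fun x _ => ?_) hle
  have hpure : toMat (fun _ : X => PMF.pure y) x y = 1 := by simp [toMat, toVec]
  rw [supportMass, Finset.sum_eq_single y (fun y' _ hy' => by simp [toMat, toVec, hy']) (by simp),
    hpure, mul_ite, mul_zero, mul_one]

end CapacityZero

/-! ### Bounds on the reliability function -/

section Reliability

theorem antitone_neg_inv_mul_log2 (n : ℕ) :
    Antitone fun D : EReal => ((-1 / n : ℝ) : EReal) * log2 D.toENNReal := by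
  intro D D' h
  have hlog2 : log2 D.toENNReal ≤ log2 D'.toENNReal :=
    EReal.div_le_div_right_of_nonneg (EReal.coe_nonneg.mpr (log_pos one_lt_two).le)
      (ENNReal.log_monotone (EReal.toENNReal_le_toENNReal h))
  have hneg : ((-1 / n : ℝ) : EReal) ≤ 0 :=
    EReal.coe_nonpos.mpr (div_nonpos_of_nonpos_of_nonneg neg_one_lt_zero.le n.cast_nonneg)
  simp only [mul_comm ((-1 / n : ℝ) : EReal)]
  exact EReal.mul_le_mul_of_nonpos_right hlog2 hneg

theorem neg_inv_mul_log2_exp {n : ℕ} (hn : n ≠ 0) (e : ℝ) :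
    ((-1 / n : ℝ) : EReal) * log2 ((exp (n * -(e * log 2)) : ℝ) : EReal).toENNReal = e := by
  have hlog2 : log2 ((exp (n * -(e * log 2)) : ℝ) : EReal).toENNReal = (-(n * e) : ℝ) := by
    rw [EReal.real_coe_toENNReal, mul_neg, ← mul_assoc, ← neg_mul]
    exact le_antisymm (log2_le_coe.mpr le_rfl) (coe_le_log2.mpr le_rfl)
  rw [hlog2, ← EReal.coe_mul]
  congr 1
  field_simp

variable {X Y : Type*} [Fintype X] [Fintype Y] {α : ℝ≥0∞} {W : Channel X Y} {r e : ℝ}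

theorem le_reliability (c : ℕ → ℝ)
    (hc : limsup (fun n : ℕ => ((c n / n : ℝ) : EReal)) atTop ≤ r)
    (h : ∀ᶠ n : ℕ in atTop, ∃ N, IsSimulation N (c n) ∧
      channelDiv α (power W n) N ≤ (exp (n * -(e * log 2)) : ℝ)) :
    e ≤ reliability α W r := by
  refine le_iSup₂_of_le c hc (le_liminf_of_le (h := ?_))
  filter_upwards [h, eventually_ne_atTop 0] with n ⟨N, hN, hle⟩ hn
  exact (neg_inv_mul_log2_exp hn e).symm.trans_le
    (antitone_neg_inv_mul_log2 n ((iInf₂_le N hN).trans hle))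

theorem reliability_le {r' : ℝ} (hr : r < r')
    (h : ∀ᶠ n : ℕ in atTop, ∀ N, IsSimulation N (n * r') →
      (exp (n * -(e * log 2)) : ℝ) ≤ channelDiv α (power W n) N) :
    reliability α W r ≤ e := by
  refine iSup₂_le fun c hc => liminf_le_of_frequently_le' (Eventually.frequently ?_)
  have hc' := eventually_lt_of_limsup_lt (hc.trans_lt (EReal.coe_lt_coe_iff.mpr hr))
  filter_upwards [h, eventually_ne_atTop 0, hc'] with n h hn hcn
  rw [EReal.coe_lt_coe_iff, div_lt_iff₀' (by positivity)] at hcn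
  refine (antitone_neg_inv_mul_log2 n (le_iInf₂ fun N hN => h N ?_)).trans_eq
    (neg_inv_mul_log2_exp hn e)
  obtain ⟨M, hM, hMc, hN⟩ := hN
  exact ⟨M, hM, hMc.trans hcn.le, hN⟩

theorem channelDiv_le_of_mul_le {N : Channel X Y} {d : ℝ}
    (h : ∀ x y, exp (-(d * log 2)) * toMat W x y ≤ toMat N x y) :
    channelDiv α W N ≤ d := by
  set c := ENNReal.ofReal (exp (-(d * log 2)))
  refine iSup_le fun P => renyiDiv_le_coe.mpr ?_
  have hsmul : c • joint P W ≤ joint P N := fun ⟨x, y⟩ => by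
    rw [Pi.smul_apply, smul_eq_mul, ← ofReal_toVec (joint_ne_top P W _),
      ← ofReal_toVec (joint_ne_top P N _), ← ENNReal.ofReal_mul (exp_pos _).le,
      toVec_joint, toVec_joint, mul_left_comm]
    exact ENNReal.ofReal_le_ofReal (mul_le_mul_of_nonneg_left (h x y) (toVec_nonneg P x))
  exact (le_fidelity_smul_self (sum_joint P W) (ENNReal.ofReal_pos.mpr (exp_pos _)).ne'
    ENNReal.ofReal_ne_top).trans (fidelity_mono hsmul)

theorem channelDiv_zero_le_of_le_supportMass {N : Channel X Y} {d : ℝ}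
    (h : ∀ x, exp (-(d * log 2)) ≤ supportMass (toMat W x) (toMat N x)) :
    channelDiv 0 W N ≤ d := by
  refine iSup_le fun P => renyiDiv_le_coe.mpr ?_
  rw [fidelity_zero_joint]
  refine ENNReal.ofReal_le_ofReal ?_
  rw [← one_mul (exp _), ← (toVec_mem P).2, Finset.sum_mul]
  exact Finset.sum_le_sum fun x _ => mul_le_mul_of_nonneg_left (h x) (toVec_nonneg P x)

end Reliability

/-! ### Simulations of superexponential accuracy -/

section Accuracy

theorem eventually_mul_pow_le_exp (c : ℝ) (k : ℕ) {δ : ℝ} (hδ : 0 < δ) :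
    ∀ᶠ n : ℕ in atTop, c * (n : ℝ) ^ k ≤ exp (n * δ) := by
  have hlittle := ((isLittleO_pow_exp_pos_mul_atTop (k := k) hδ).const_mul_left c).comp_tendsto
    (tendsto_natCast_atTop_atTop (R := ℝ))
  filter_upwards [hlittle.bound one_pos] with n hn
  simpa only [Function.comp_apply, one_mul, norm_of_nonneg (exp_pos _).le, mul_comm δ] using
    (le_norm_self _).trans hn

theorem eventually_mul_exp_neg_sq_le (c A : ℝ) :
    ∀ᶠ n : ℕ in atTop, c * exp (-(n : ℝ) ^ 2) ≤ exp (n * -A) := by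
  filter_upwards [eventually_mul_exp_le (by linarith : -A - 1 < -A) |c|,
    (tendsto_natCast_atTop_atTop (R := ℝ)).eventually_ge_atTop (A + 1)] with n hc hn
  refine (mul_le_mul (le_abs_self c) (exp_le_exp.mpr ?_) (exp_pos _).le (abs_nonneg c)).trans hc
  nlinarith [n.cast_nonneg (α := ℝ)]

theorem exp_neg_two_mul_le_one_sub {t : ℝ} (h0 : 0 ≤ t) (h1 : t ≤ 1 / 2) :
    exp (-(2 * t)) ≤ 1 - t := by
  rw [exp_neg]
  refine inv_le_of_inv_le₀ (by linarith) ((inv_le_iff_one_le_mul₀ (by linarith)).mpr ?_)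
  nlinarith [add_one_le_exp (2 * t)]

/-- Number of messages at rate `r`; the quadratic factor does not change the rate, and makes the
error of rejection sampling superexponentially small. -/
def messageCount (r : ℝ) (n : ℕ) : ℕ := ⌈(n : ℝ) ^ 2 * exp (n * (r * log 2))⌉₊

theorem messageCount_pos (r : ℝ) {n : ℕ} (hn : n ≠ 0) : 0 < messageCount r n :=
  Nat.ceil_pos.mpr (by positivity)

theorem eventually_messageCount_le_exp {r s : ℝ} (hr : 0 ≤ r) (hs : r * log 2 < s) :
    ∀ᶠ n : ℕ in atTop, (messageCount r n : ℝ) ≤ exp (n * s) := by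
  filter_upwards [eventually_ge_atTop 1, eventually_mul_pow_le_exp 2 2 (sub_pos.mpr hs)]
    with n hn hsq
  have hn1 : (1 : ℝ) ≤ n := by exact_mod_cast hn
  have hone : 1 ≤ (n : ℝ) ^ 2 * exp (n * (r * log 2)) :=
    one_le_mul_of_one_le_of_one_le (one_le_pow₀ hn1) (one_le_exp (by positivity))
  calc (messageCount r n : ℝ) ≤ (n : ℝ) ^ 2 * exp (n * (r * log 2)) + 1 :=
        (Nat.ceil_lt_add_one (zero_le_one.trans hone)).le
    _ ≤ 2 * (n : ℝ) ^ 2 * exp (n * (r * log 2)) := by linarith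
    _ ≤ exp (n * (s - r * log 2)) * exp (n * (r * log 2)) := by gcongr
    _ = exp (n * s) := by rw [← exp_add]; ring_nf

theorem limsup_logb_messageCount_le {r : ℝ} (hr : 0 ≤ r) :
    limsup (fun n : ℕ => ((logb 2 (messageCount r n) / n : ℝ) : EReal)) atTop ≤ r := by
  have h2 : 0 < log 2 := log_pos one_lt_two
  refine EReal.le_of_forall_lt_iff_le.mp fun r' hr' => limsup_le_of_le (h := ?_)
  filter_upwards [eventually_ne_atTop 0, eventually_messageCount_le_exp hr
    (mul_lt_mul_of_pos_right (EReal.coe_lt_coe_iff.mp hr') h2)] with n hn hle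
  have hM : (0 : ℝ) < messageCount r n := by exact_mod_cast messageCount_pos r hn
  rw [EReal.coe_le_coe_iff, logb, div_le_iff₀ (by positivity), div_le_iff₀ h2,
    log_le_iff_le_exp hM]
  exact hle.trans_eq (by ring_nf)

variable {X Y : Type*} [Fintype Y]

theorem eventually_exists_isSimulation_mul_le {r : ℝ} (hr : 0 ≤ r) (A : ℝ) :
    ∀ᶠ n : ℕ in atTop, ∀ q ∈ stdSimplex ℝ (Fin n → Y), ∀ u : (Fin n → X) → (Fin n → Y) → ℝ,
      (∀ x y, 0 ≤ u x y) → (∀ x y, u x y ≤ exp (n * (r * log 2)) * q y) →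
      (∀ x, ∑ y, u x y ≤ 1) → ∃ N, IsSimulation N (logb 2 (messageCount r n)) ∧
        ∀ x y, exp (-(exp (n * -A) * log 2)) * u x y ≤ toMat N x y := by
  have h2 : 0 < log 2 := log_pos one_lt_two
  filter_upwards [eventually_ne_atTop 0, eventually_mul_exp_neg_sq_le (2 / log 2) A,
    eventually_mul_exp_neg_sq_le 2 0] with n hn hA hhalf q hq u hu huq hu1
  obtain ⟨N, hN, hle⟩ := exists_isSimulationOfSize_mul_le (ofVec q hq)
    (one_le_exp (by positivity : 0 ≤ n * (r * log 2))) hu (by simpa only [toVec_ofVec] using huq)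
    hu1 (messageCount_pos r hn).ne'
  refine ⟨N, isSimulation_iff.mpr ⟨_, messageCount_pos r hn, le_rfl, hN⟩, fun x y =>
    (mul_le_mul_of_nonneg_right ?_ (hu x y)).trans (hle x y)⟩
  have hfail : exp (-(messageCount r n / exp (n * (r * log 2)))) ≤ exp (-(n : ℝ) ^ 2) := by
    rw [exp_le_exp, neg_le_neg_iff, le_div_iff₀ (exp_pos _)]
    exact Nat.le_ceil _
  rw [neg_zero, mul_zero, exp_zero] at hhalf
  rw [div_mul_eq_mul_div, div_le_iff₀ h2] at hA
  calc exp (-(exp (n * -A) * log 2)) ≤ exp (-(2 * exp (-(n : ℝ) ^ 2))) :=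
        exp_le_exp.mpr (neg_le_neg hA)
    _ ≤ 1 - exp (-(n : ℝ) ^ 2) := exp_neg_two_mul_le_one_sub (exp_pos _).le (by linarith)
    _ ≤ 1 - exp (-(messageCount r n / exp (n * (r * log 2)))) := sub_le_sub_left hfail 1

end Accuracy

/-! ### Infinite and nonnegative reliability -/

section Infinite

variable {X Y : Type*} [Fintype X] [Fintype Y] {α : ℝ≥0∞} {W : Channel X Y} {r : ℝ}

theorem eq_top_of_forall_coe_le {z : EReal} (h : ∀ e : ℝ, e ≤ z) : z = ⊤ :=
  (EReal.eq_top_iff_forall_lt z).mpr fun e =>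
    (EReal.coe_lt_coe_iff.mpr (lt_add_one e)).trans_le (h (e + 1))

omit [Fintype X] [Fintype Y] in
theorem prodMat_le_exp_mul_prodVec {w : X → Y → ℝ} (hw : ∀ x y, 0 ≤ w x y) {q : Y → ℝ} {s : ℝ}
    (h : ∀ x y, w x y ≤ exp s * q y) (n : ℕ) (x : Fin n → X) (y : Fin n → Y) :
    prodMat w n x y ≤ exp (n * s) * prodVec q n y := by
  calc prodMat w n x y ≤ ∏ i, exp s * q (y i) :=
        Finset.prod_le_prod (fun i _ => hw _ _) fun i _ => h _ _
    _ = exp (n * s) * prodVec q n y := by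
        rw [Finset.prod_mul_distrib, Finset.prod_const, Finset.card_univ, Fintype.card_fin,
          ← exp_nat_mul, prodVec]

theorem reliability_eq_top_of_capacity_top_le [Nonempty X] (h : capacity ∞ W ≤ r) :
    reliability α W r = ⊤ := by
  obtain ⟨q, hq, hle⟩ := exists_output_of_capacity_top_le h
  have hW := toMat_mem W
  have hr : 0 ≤ r := by
    have hone : (1 : ℝ) ≤ exp (r * log 2) := by
      rw [← (hW (Classical.arbitrary X)).2, ← mul_one (exp _), ← hq.2, Finset.mul_sum]
      exact Finset.sum_le_sum fun y _ => hle _ y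
    exact nonneg_of_mul_nonneg_left (one_le_exp_iff.mp hone) (log_pos one_lt_two)
  refine eq_top_of_forall_coe_le fun e => le_reliability _ (limsup_logb_messageCount_le hr) ?_
  filter_upwards [eventually_exists_isSimulation_mul_le (X := X) (Y := Y) hr
    (e * log 2)] with n hsim
  obtain ⟨N, hN, hNle⟩ := hsim (prodVec q n) (prodVec_mem hq n) (prodMat (toMat W) n)
    (fun x => (prodMat_mem hW n x).1)
    (prodMat_le_exp_mul_prodVec (fun x => (hW x).1) hle n)
    (fun x => (prodMat_mem hW n x).2.le)
  exact ⟨N, hN, channelDiv_le_of_mul_le (by rwa [toMat_power])⟩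

theorem supportMass_nonneg {p q : Y → ℝ} (hq : ∀ y, 0 ≤ q y) : 0 ≤ supportMass p q :=
  Finset.sum_nonneg fun y _ => ite_nonneg le_rfl (hq y)

theorem supportMass_le_one {p q : Y → ℝ} (hq : q ∈ stdSimplex ℝ Y) : supportMass p q ≤ 1 :=
  hq.2 ▸ Finset.sum_le_sum fun y _ => by split_ifs; exacts [hq.1 y, le_rfl]

omit [Fintype X] in
theorem supportMass_prod (w : X → Y → ℝ) (q : Y → ℝ) (n : ℕ) (x : Fin n → X) :
    supportMass (prodMat w n x) (prodVec q n) = ∏ i, supportMass (w (x i)) q := by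
  simp only [supportMass, Fintype.prod_sum]
  refine Finset.sum_congr rfl fun y _ => ?_
  by_cases h : prodMat w n x y = 0
  · obtain ⟨i, hi, h0⟩ := Finset.prod_eq_zero_iff.mp h
    rw [if_pos h, Finset.prod_eq_zero hi (by rw [if_pos h0])]
  · rw [if_neg h]
    exact Finset.prod_congr rfl fun i hi => (if_neg fun h0 => h (Finset.prod_eq_zero hi h0)).symm

theorem exists_le_of_inv_le_supportMass {p q : Y → ℝ} (hq : ∀ y, 0 ≤ q y) {L : ℝ} (hL : 0 < L)
    (h : L⁻¹ ≤ supportMass p q) :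
    ∃ u : Y → ℝ, (∀ y, 0 ≤ u y) ∧ (∀ y, u y ≤ L * q y) ∧ ∑ y, u y = 1 ∧ supportMass p u = 1 := by
  have hs : 0 < supportMass p q := (inv_pos.mpr hL).trans_le h
  have hu : ∑ y, (if p y = 0 then 0 else q y / supportMass p q) = 1 := by
    rw [← div_self hs.ne', supportMass, Finset.sum_div]
    exact Finset.sum_congr rfl fun y _ => by rw [ite_div, zero_div]
  refine ⟨fun y => if p y = 0 then 0 else q y / supportMass p q,
    fun y => ite_nonneg le_rfl (div_nonneg (hq y) hs.le), fun y => ?_, hu, ?_⟩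
  · dsimp only
    split_ifs
    · exact mul_nonneg hL.le (hq y)
    · rw [div_eq_inv_mul]
      exact mul_le_mul_of_nonneg_right (inv_le_of_inv_le₀ hL h) (hq y)
  · rw [← hu]
    exact Finset.sum_congr rfl fun y _ => by dsimp only; split_ifs <;> rfl

theorem supportMass_mono {p q q' : Y → ℝ} (h : q ≤ q') : supportMass p q ≤ supportMass p q' :=
  Finset.sum_le_sum fun y _ => by split_ifs; exacts [le_rfl, h y]

theorem supportMass_smul (c : ℝ) (p q : Y → ℝ) :
    supportMass p (c • q) = c * supportMass p q := by
  simp [supportMass, Finset.mul_sum, mul_ite]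

theorem reliability_zero_eq_top [Nonempty X] (h : capacity 0 W < r) : reliability 0 W r = ⊤ := by
  obtain ⟨q, hq, hle⟩ := exists_output_of_capacity_zero_lt h
  have hr : 0 ≤ r := by
    have hone := (hle (Classical.arbitrary X)).trans (supportMass_le_one hq)
    rw [exp_le_one_iff, neg_nonpos] at hone
    exact nonneg_of_mul_nonneg_left hone (log_pos one_lt_two)
  refine eq_top_of_forall_coe_le fun e => le_reliability _ (limsup_logb_messageCount_le hr) ?_
  filter_upwards [eventually_exists_isSimulation_mul_le (X := X) (Y := Y) hr
    (e * log 2)] with n hsim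
  have hmass (x) : (exp (n * (r * log 2)))⁻¹ ≤
      supportMass (prodMat (toMat W) n x) (prodVec q n) := by
    rw [supportMass_prod, ← exp_neg, ← mul_neg, exp_nat_mul]
    simpa using Finset.prod_le_prod (s := Finset.univ) (fun _ _ => (exp_pos _).le)
      fun i _ => hle (x i)
  choose u hu huq hu1 hmass_u using fun x =>
    exists_le_of_inv_le_supportMass (prodVec_mem hq n).1 (exp_pos _) (hmass x)
  obtain ⟨N, hN, hNle⟩ := hsim (prodVec q n) (prodVec_mem hq n) u hu huq fun x => (hu1 x).le
  refine ⟨N, hN, channelDiv_zero_le_of_le_supportMass fun x => ?_⟩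
  rw [toMat_power]
  calc exp (-(exp (n * -(e * log 2)) * log 2))
      = supportMass (prodMat (toMat W) n x) (exp (-(exp (n * -(e * log 2)) * log 2)) • u x) := by
        rw [supportMass_smul, hmass_u, mul_one]
    _ ≤ supportMass (prodMat (toMat W) n x) (toMat N x) := supportMass_mono (hNle x)

theorem exists_isSimulation_zero_channelDiv_le [Nonempty Y] (α : ℝ≥0∞) (W : Channel X Y) :
    ∃ N, IsSimulation N 0 ∧ channelDiv α W N ≤ logb 2 (Fintype.card Y) := by
  have hcard : (0 : ℝ) < Fintype.card Y := by exact_mod_cast Fintype.card_pos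
  have hU : (fun _ : Y => (Fintype.card Y : ℝ)⁻¹) ∈ stdSimplex ℝ Y :=
    ⟨fun _ => inv_nonneg.mpr hcard.le, by simp⟩
  refine ⟨fun _ => ofVec _ hU, isSimulation_iff.mpr ⟨1, le_rfl, by simp,
    isSimulationOfSize_const _⟩, channelDiv_le_of_mul_le fun x y => ?_⟩
  have hW1 : toMat W x y ≤ 1 := (toMat_mem W x).2 ▸
    Finset.single_le_sum (fun y _ => toVec_nonneg (W x) y) (Finset.mem_univ y)
  rw [logb, div_mul_cancel₀ _ (log_pos one_lt_two).ne', exp_neg, exp_log hcard, toMat, toMat,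
    toVec_ofVec]
  exact mul_le_of_le_one_right (inv_nonneg.mpr hcard.le) hW1

theorem reliability_nonneg [Nonempty X] (hr : 0 ≤ r) : 0 ≤ reliability α W r := by
  have : Nonempty Y :=
    ⟨(exists_pos_of_mem_stdSimplex (toMat_mem W (Classical.arbitrary X))).choose⟩
  refine EReal.ge_of_forall_gt_iff_ge.mp fun e he => ?_
  have hδ : 0 < -(e * log 2) :=
    neg_pos.mpr (mul_neg_of_neg_of_pos (EReal.coe_neg'.mp he) (log_pos one_lt_two))
  refine le_reliability (fun _ => 0) (by simpa using hr) ?_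
  filter_upwards [eventually_mul_pow_le_exp (logb 2 (Fintype.card Y)) 1 hδ] with n hn
  obtain ⟨N, hN, hle⟩ := exists_isSimulation_zero_channelDiv_le α (power W n)
  refine ⟨N, hN, hle.trans (EReal.coe_le_coe_iff.mpr ?_)⟩
  simpa [logb_pow, mul_comm] using hn

end Infinite

/-! ### Achievability at finite orders -/

section Achievability

theorem rpow_mul_min_rpow_le {v u a b : ℝ} (hv : 0 ≤ v) (hu : 0 < u) (ha : 0 < a) (hab : a ≤ b) :
    v ^ a * min v u ^ (1 - a) ≤ v + v ^ b * u ^ (1 - b) := by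
  rcases hv.eq_or_lt with rfl | hv
  · simp [zero_rpow ha.ne', zero_rpow (ha.trans_le hab).ne']
  rcases le_total v u with hle | hle
  · rw [min_eq_left hle, ← rpow_add hv, add_sub_cancel, rpow_one]
    exact le_add_of_nonneg_right (by positivity)
  · rw [min_eq_right hle, rpow_mul_rpow_one_sub hv hu b a]
    exact le_add_of_nonneg_of_le hv.le (le_mul_of_one_le_left (by positivity)
      (one_le_rpow ((one_le_div hu).mpr hle) (sub_nonneg.mpr hab)))

theorem affinity_le_of_mul_min_le {ι : Type*} [Fintype ι] {p q p' : ι → ℝ}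
    (hp : p ∈ stdSimplex ℝ ι) (hq : ∀ i, 0 < q i) {a b c L : ℝ} (ha : 1 ≤ a) (hab : a ≤ b)
    (hc : 0 < c) (hL : 0 < L) (h : ∀ i, c * min (p i) (L * q i) ≤ p' i) :
    affinity a p p' ≤ c ^ (1 - a) * (1 + L ^ (1 - b) * affinity b p q) := by
  have hpt (i) : p i ^ a * p' i ^ (1 - a) ≤
      c ^ (1 - a) * (p i + L ^ (1 - b) * (p i ^ b * q i ^ (1 - b))) := by
    rcases (hp.1 i).eq_or_lt with h0 | h0
    · simp [← h0, zero_rpow (by linarith : a ≠ 0), zero_rpow (by linarith : b ≠ 0)]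
    have hLq : 0 < L * q i := mul_pos hL (hq i)
    have hmin : 0 < min (p i) (L * q i) := lt_min h0 hLq
    calc p i ^ a * p' i ^ (1 - a) ≤ p i ^ a * (c * min (p i) (L * q i)) ^ (1 - a) :=
          mul_le_mul_of_nonneg_left (rpow_le_rpow_of_nonpos (mul_pos hc hmin) (h i)
            (by linarith)) (rpow_nonneg h0.le _)
      _ = c ^ (1 - a) * (p i ^ a * min (p i) (L * q i) ^ (1 - a)) := by
          rw [mul_rpow hc.le hmin.le, mul_left_comm]
      _ ≤ c ^ (1 - a) * (p i + p i ^ b * (L * q i) ^ (1 - b)) :=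
          mul_le_mul_of_nonneg_left (rpow_mul_min_rpow_le h0.le hLq (by linarith) hab)
            (rpow_nonneg hc.le _)
      _ = _ := by rw [mul_rpow hL.le (hq i).le, mul_left_comm (p i ^ b)]
  refine (Finset.sum_le_sum fun i _ => hpt i).trans_eq ?_
  rw [← Finset.mul_sum, Finset.sum_add_distrib, hp.2, ← Finset.mul_sum, affinity]

theorem affinity_prod {X Y : Type*} [Fintype Y] {w : X → Y → ℝ} (hw : ∀ x y, 0 ≤ w x y) {q : Y → ℝ}
    (hq : ∀ y, 0 ≤ q y) (b : ℝ) (n : ℕ) (x : Fin n → X) :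
    affinity b (prodMat w n x) (prodVec q n) = ∏ i, affinity b (w (x i)) q := by
  simp only [affinity, Fintype.prod_sum, prodMat, prodVec]
  refine Finset.sum_congr rfl fun y _ => ?_
  rw [Finset.prod_mul_distrib, finsetProd_rpow _ _ fun i _ => hw (x i) (y i),
    finsetProd_rpow _ _ fun i _ => hq (y i)]

variable {X Y : Type*} [Fintype X] [Fintype Y] {W N : Channel X Y} {α β : ℝ≥0∞}

theorem channelDiv_le_of_affinity_le (h1 : 1 < α) (hT : α ≠ ∞) {d : ℝ}
    (hWN : ∀ x y, toMat W x y ≠ 0 → toMat N x y ≠ 0)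
    (h : ∀ x, affinity α.toReal (toMat W x) (toMat N x) ≤ exp (d * log 2 * (α.toReal - 1))) :
    channelDiv α W N ≤ d := by
  refine iSup_le fun P => (renyiDiv_le_coe_of_one_lt h1 hT (joint_ne_top P W) (joint_ne_top P N)
    fun z hz => ?_).mpr ?_
  · rw [joint_ne_zero_iff] at hz ⊢
    exact ⟨hz.1, hWN _ _ hz.2⟩
  · rw [affinity_joint]
    calc ∑ x, toVec P x * affinity α.toReal (toMat W x) (toMat N x)
        ≤ ∑ x, toVec P x * exp (d * log 2 * (α.toReal - 1)) :=
          Finset.sum_le_sum fun x _ => mul_le_mul_of_nonneg_left (h x) (toVec_nonneg P x)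
      _ = exp (d * log 2 * (α.toReal - 1)) := by
          rw [← Finset.sum_mul, (toVec_mem P).2, one_mul]

theorem channelDiv_le_of_mul_min_le (h1 : 1 < α) (hT : α ≠ ∞) {b t L K : ℝ}
    (hb : α.toReal ≤ b) (hL : 0 < L) {q : Y → ℝ} (hq : ∀ y, 0 < q y)
    (hN : ∀ x y, exp (-(t * log 2)) * min (toMat W x y) (L * q y) ≤ toMat N x y)
    (hK : ∀ x, affinity b (toMat W x) q ≤ K) :
    channelDiv α W N ≤ (t + L ^ (1 - b) * K / ((α.toReal - 1) * log 2) : ℝ) := by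
  have ha := one_lt_toReal h1 hT
  set a := α.toReal
  refine channelDiv_le_of_affinity_le h1 hT (fun x y hxy => ?_) fun x => ?_
  · have hW : 0 < toMat W x y := (toVec_nonneg (W x) y).lt_of_ne' hxy
    exact ((mul_pos (exp_pos _) (lt_min hW (mul_pos hL (hq y)))).trans_le (hN x y)).ne'
  · have ha1 : a - 1 ≠ 0 := (sub_pos.mpr ha).ne'
    calc affinity a (toMat W x) (toMat N x)
        ≤ exp (-(t * log 2)) ^ (1 - a) * (1 + L ^ (1 - b) * affinity b (toMat W x) q) :=
          affinity_le_of_mul_min_le (toMat_mem W x) hq ha.le hb (exp_pos _) hL (hN x)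
      _ ≤ exp (-(t * log 2)) ^ (1 - a) * exp (L ^ (1 - b) * K) := by
          gcongr
          refine le_trans ?_ (add_one_le_exp _)
          rw [add_comm]
          gcongr
          exact hK x
      _ = _ := by
          rw [← exp_mul, ← exp_add]
          congr 1
          field_simp
          ring

theorem eventually_exists_isSimulation_channelDiv_le [Nonempty X] (h1 : 1 < α) (hαβ : α ≤ β)
    (hT : β ≠ ∞) {r s e : ℝ} (hr : 0 ≤ r)
    (hs : ∀ P ∈ stdSimplex ℝ X, scaledInfo P (toMat W) β.toReal ≤ s)
    (he : e * log 2 < (β.toReal - 1) * (r * log 2) - s) :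
    ∀ᶠ n : ℕ in atTop, ∃ N, IsSimulation N (logb 2 (messageCount r n)) ∧
      channelDiv α (power W n) N ≤ (exp (n * -(e * log 2)) : ℝ) := by
  have hαT : α ≠ ∞ := ne_top_of_le_ne_top hT hαβ
  set a := α.toReal
  set b := β.toReal
  have hab : a ≤ b := ENNReal.toReal_mono hT hαβ
  have hW := toMat_mem W
  obtain ⟨t, hst, ht⟩ := exists_between (by linarith : s < (b - 1) * (r * log 2) - e * log 2)
  obtain ⟨q, hq, hq0, hqle⟩ := exists_output_of_scaledInfo_lt hW
    (one_lt_toReal (h1.trans_le hαβ) hT) hs hst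
  filter_upwards [eventually_exists_isSimulation_mul_le (X := X) (Y := Y) hr (e * log 2 + 1),
    eventually_mul_exp_le (by linarith : -(e * log 2 + 1) < -(e * log 2)) 2,
    eventually_mul_exp_le (by linarith : t - (b - 1) * (r * log 2) < -(e * log 2))
      (2 / ((a - 1) * log 2))] with n hsim hsmall hterm
  have hqn := prodVec_mem hq n
  obtain ⟨N, hN, hNle⟩ := hsim (prodVec q n) hqn
    (fun x y => min (prodMat (toMat W) n x y) (exp (n * (r * log 2)) * prodVec q n y))
    (fun x y => le_min ((prodMat_mem hW n x).1 y) (mul_nonneg (exp_pos _).le (hqn.1 y)))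
    (fun x y => min_le_right _ _)
    (fun x => (Finset.sum_le_sum fun y _ => min_le_left _ _).trans (prodMat_mem hW n x).2.le)
  have hK (x : Fin n → X) : affinity b (prodMat (toMat W) n x) (prodVec q n) ≤ exp (n * t) := by
    rw [affinity_prod (fun x => (hW x).1) hq.1, exp_nat_mul]
    simpa using Finset.prod_le_prod (s := Finset.univ)
      (fun i _ => affinity_nonneg b (hW (x i)).1 hq.1) fun i _ => hqle (x i)
  refine ⟨N, hN, (channelDiv_le_of_mul_min_le h1 hαT hab (exp_pos (n * (r * log 2)))
    (fun y => Finset.prod_pos fun i _ => hq0 (y i)) (by rwa [toMat_power])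
    (by rwa [toMat_power])).trans (EReal.coe_le_coe_iff.mpr ?_)⟩
  have hexp : exp (n * (r * log 2)) ^ (1 - b) * exp (n * t) =
      exp (n * (t - (b - 1) * (r * log 2))) := by
    rw [← exp_mul, ← exp_add]
    ring_nf
  rw [hexp, div_eq_inv_mul]
  rw [div_eq_mul_inv, mul_assoc] at hterm
  linarith

theorem channelDiv_mono_of_le_one_of_one_lt (h0 : α ≠ 0) (h1 : α ≤ 1) (hβ : 1 < β) (hT : β ≠ ∞)
    (W N : Channel X Y) : channelDiv α W N ≤ channelDiv β W N :=
  iSup_mono fun P =>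
    (renyiDiv_le_renyiDiv_one (sum_joint P W) (joint_ne_top P N) h0 h1).trans
      (renyiDiv_one_le_renyiDiv (sum_joint P W) (joint_ne_top P N) hβ hT)

theorem mul_sub_capacity_eq {r s : ℝ} (h1 : 1 < β) (hT : β ≠ ∞)
    (hs : capacity β W = (s / ((β.toReal - 1) * log 2) : ℝ)) :
    ((β : EReal) - 1) * (r - capacity β W) =
      (((β.toReal - 1) * (r * log 2) - s) / log 2 : ℝ) := by
  have hb : β.toReal - 1 ≠ 0 := (sub_pos.mpr (one_lt_toReal h1 hT)).ne'
  have h2 : log 2 ≠ 0 := (log_pos one_lt_two).ne'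
  rw [hs, ← EReal.coe_ennreal_toReal hT, ← EReal.coe_one, ← EReal.coe_sub, ← EReal.coe_sub,
    ← EReal.coe_mul]
  congr 1
  field_simp

theorem mul_sub_capacity_le_reliability [Nonempty X] {r : ℝ} (hr : 0 ≤ r) (h0 : α ≠ 0)
    (hαβ : α ≤ β) (h1 : 1 < β) (hT : β ≠ ∞) :
    ((β : EReal) - 1) * (r - capacity β W) ≤ reliability α W r := by
  obtain ⟨P, -, hcap, hmax⟩ := exists_capacity_eq h1 hT W
  rw [mul_sub_capacity_eq h1 hT hcap]
  refine EReal.ge_of_forall_gt_iff_ge.mp fun e he => ?_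
  rw [EReal.coe_lt_coe_iff, lt_div_iff₀ (log_pos one_lt_two)] at he
  refine le_reliability _ (limsup_logb_messageCount_le hr) ?_
  rcases lt_or_ge 1 α with hα | hα
  · exact eventually_exists_isSimulation_channelDiv_le hα hαβ hT hr hmax he
  · filter_upwards [eventually_exists_isSimulation_channelDiv_le h1 le_rfl hT hr hmax he]
      with n ⟨N, hN, hle⟩
    exact ⟨N, hN, (channelDiv_mono_of_le_one_of_one_lt h0 hα h1 hT _ _).trans hle⟩

end Achievability

/-! ### Affinities and their tails -/

section Tail

variable {ι : Type*} {p q q' : ι → ℝ} {κ a b c : ℝ}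

/-- The part of `p` at which the likelihood ratio `p / q` is at most `κ`; it complements the range
of summation of `tailAffinity κ a p q`. -/
def truncation (κ : ℝ) (p q : ι → ℝ) (i : ι) : ℝ := if κ * q i < p i then 0 else p i

theorem truncation_nonneg (hp : ∀ i, 0 ≤ p i) (i : ι) : 0 ≤ truncation κ p q i :=
  ite_nonneg le_rfl (hp i)

variable [Fintype ι]

theorem affinity_one (p q : ι → ℝ) : affinity 1 p q = ∑ i, p i := by
  simp [affinity]

theorem affinity_truncation_add_tailAffinity (ha : a ≠ 0) :
    affinity a (truncation κ p q) q + tailAffinity κ a p q = affinity a p q := by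
  simp only [affinity, truncation, tailAffinity, ← Finset.sum_add_distrib]
  refine Finset.sum_congr rfl fun i _ => ?_
  split_ifs <;> simp [zero_rpow ha]

theorem sum_truncation (hp : ∑ i, p i = 1) :
    ∑ i, truncation κ p q i = 1 - tailAffinity κ 1 p q := by
  have h := affinity_truncation_add_tailAffinity (κ := κ) (p := p) (q := q) one_ne_zero
  rw [affinity_one, affinity_one, hp] at h
  exact eq_sub_of_add_eq h

theorem tailAffinity_nonneg (hp : ∀ i, 0 ≤ p i) (hq : ∀ i, 0 ≤ q i) : 0 ≤ tailAffinity κ a p q :=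
  Finset.sum_nonneg fun i _ =>
    ite_nonneg (mul_nonneg (rpow_nonneg (hp i) _) (rpow_nonneg (hq i) _)) le_rfl

theorem tailAffinity_one_le_one (hp : p ∈ stdSimplex ℝ ι) : tailAffinity κ 1 p q ≤ 1 := by
  have hhead : 0 ≤ ∑ i, truncation κ p q i :=
    Finset.sum_nonneg fun i _ => truncation_nonneg hp.1 i
  linarith [sum_truncation (κ := κ) (q := q) hp.2]

theorem rpow_sub_mul_tailAffinity_le (hq : ∀ i, 0 ≤ q i) (hκ : 0 < κ)
    (hbc : b ≤ c) (hpq : b < 1 ∨ ∀ i, p i ≠ 0 → q i ≠ 0) :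
    κ ^ (c - b) * tailAffinity κ b p q ≤ tailAffinity κ c p q := by
  simp only [tailAffinity, Finset.mul_sum]
  refine Finset.sum_le_sum fun i _ => ?_
  split_ifs with hi
  · have hpi : 0 < p i := (mul_nonneg hκ.le (hq i)).trans_lt hi
    rcases (hq i).eq_or_lt with hqi | hqi
    · have hb : b < 1 := hpq.resolve_right fun h => h i hpi.ne' hqi.symm
      rw [← hqi, zero_rpow (sub_pos.mpr hb).ne', mul_zero, mul_zero]
      exact mul_nonneg (rpow_nonneg hpi.le _) (rpow_nonneg le_rfl _)
    · rw [rpow_mul_rpow_one_sub hpi hqi c b]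
      have hκ_le : κ ≤ p i / q i := (le_div_iff₀ hqi).mpr hi.le
      gcongr
  · rw [mul_zero]

theorem tailAffinity_anti (hp : ∀ i, 0 ≤ p i) (hq : ∀ i, 0 ≤ q i) (hκ : 0 < κ) (ha : 1 ≤ a)
    (hpq : 1 < a → ∀ i, p i ≠ 0 → q i ≠ 0) (h : q ≤ q') :
    tailAffinity κ a p q' ≤ tailAffinity κ a p q := by
  refine Finset.sum_le_sum fun i _ => ?_
  split_ifs with h' hi hi
  · refine mul_le_mul_of_nonneg_left ?_ (rpow_nonneg (hp i) a)
    rcases ha.eq_or_lt with rfl | ha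
    · simp
    have hpi : 0 < p i := (mul_nonneg hκ.le (hq i)).trans_lt hi
    exact rpow_le_rpow_of_nonpos ((hq i).lt_of_ne' (hpq ha i hpi.ne')) (h i) (by linarith)
  · exact absurd ((mul_le_mul_of_nonneg_left (h i) hκ.le).trans_lt h') hi
  · exact mul_nonneg (rpow_nonneg (hp i) _) (rpow_nonneg (hq i) _)
  · exact le_rfl

theorem affinity_le_one_sub_tailAffinity (hp : p ∈ stdSimplex ℝ ι) (hq : q ∈ stdSimplex ℝ ι)
    (hκ : 0 < κ) (ha0 : 0 < a) (ha1 : a < 1) (hκa : κ ^ (a - 1) ≤ a / 2) :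
    affinity a p q ≤ 1 - a / 2 * tailAffinity κ 1 p q := by
  set T := tailAffinity κ 1 p q
  have htail : tailAffinity κ a p q ≤ a / 2 * T := by
    have hcmp := rpow_sub_mul_tailAffinity_le (p := p) hq.1 hκ ha1.le (Or.inl ha1)
    calc tailAffinity κ a p q
        = κ ^ (a - 1) * (κ ^ (1 - a) * tailAffinity κ a p q) := by
          rw [← mul_assoc, ← rpow_add hκ, sub_add_sub_cancel, sub_self, rpow_zero, one_mul]
      _ ≤ a / 2 * T := mul_le_mul hκa hcmp
          (mul_nonneg (rpow_nonneg hκ.le _) (tailAffinity_nonneg hp.1 hq.1)) (by positivity)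
  have hhead : affinity a (truncation κ p q) q ≤ 1 - a * T := by
    calc affinity a (truncation κ p q) q ≤ (1 - T) ^ a := by
          have hHolder := sum_rpow_mul_rpow_le Finset.univ
            (fun i _ => truncation_nonneg (κ := κ) (q := q) hp.1 i) (fun i _ => hq.1 i) ha0
            (sub_pos.mpr ha1) (add_sub_cancel a 1)
          rwa [sum_truncation hp.2, hq.2, one_rpow, mul_one] at hHolder
      _ ≤ 1 - a * T := by
          simpa only [mul_neg, ← sub_eq_add_neg] using rpow_one_add_le_one_add_mul_self
            (neg_le_neg (tailAffinity_one_le_one (κ := κ) (q := q) hp)) ha0.le ha1.le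
  rw [← affinity_truncation_add_tailAffinity (κ := κ) ha0.ne']
  linarith

theorem one_add_tailAffinity_le_affinity (hp : p ∈ stdSimplex ℝ ι) (hq : q ∈ stdSimplex ℝ ι)
    (hpq : ∀ i, p i ≠ 0 → q i ≠ 0) (hκ : 0 < κ) (ha : 1 ≤ a) (hκa : a * κ ^ (1 - a) ≤ 1 / 2) :
    1 + tailAffinity κ a p q / 2 ≤ affinity a p q := by
  have ha0 : 0 < a := one_pos.trans_le ha
  set T := tailAffinity κ 1 p q
  have htail : a * T ≤ tailAffinity κ a p q / 2 := by
    calc a * T = a * κ ^ (1 - a) * (κ ^ (a - 1) * T) := by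
          rw [mul_assoc, ← mul_assoc (κ ^ _), ← rpow_add hκ, sub_add_sub_cancel, sub_self,
            rpow_zero, one_mul]
      _ ≤ 1 / 2 * tailAffinity κ a p q :=
          mul_le_mul hκa (rpow_sub_mul_tailAffinity_le hq.1 hκ ha (Or.inr hpq))
            (mul_nonneg (rpow_nonneg hκ.le _) (tailAffinity_nonneg hp.1 hq.1)) one_half_pos.le
      _ = tailAffinity κ a p q / 2 := by ring
  have hhead : 1 - a * T ≤ affinity a (truncation κ p q) q := by
    calc 1 - a * T ≤ (1 - T) ^ a := by
          simpa only [mul_neg, ← sub_eq_add_neg] using one_add_mul_self_le_rpow_one_add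
            (neg_le_neg (tailAffinity_one_le_one (κ := κ) (q := q) hp)) ha
      _ ≤ affinity a (truncation κ p q) q := by
          rw [← sum_truncation hp.2]
          exact rpow_sum_le_affinity ha (truncation_nonneg hp.1) hq.1
            (fun i hi => hpq i fun h0 => hi (by simp [truncation, h0])) hq.2.le
  rw [← affinity_truncation_add_tailAffinity (κ := κ) ha0.ne']
  linarith

end Tail

/-! ### Converse at finite orders -/

section Converse

variable {X Y : Type*} [Fintype X] [Fintype Y]

section Row

variable {P : X → ℝ} {w v : X → Y → ℝ} {B : Y → ℝ} {κ a : ℝ}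

theorem sum_mul_affinity_le_one_sub (hP : P ∈ stdSimplex ℝ X) (hw : ∀ x, w x ∈ stdSimplex ℝ Y)
    (hv : ∀ x, v x ∈ stdSimplex ℝ Y) (hvB : ∀ x, v x ≤ B) (hκ : 0 < κ) (ha0 : 0 < a) (ha1 : a < 1)
    (hκa : κ ^ (a - 1) ≤ a / 2) :
    ∑ x, P x * affinity a (w x) (v x) ≤ 1 - a / 2 * ∑ x, P x * tailAffinity κ 1 (w x) B := by
  have hrow (x) : affinity a (w x) (v x) ≤ 1 - a / 2 * tailAffinity κ 1 (w x) B := by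
    refine (affinity_le_one_sub_tailAffinity (hw x) (hv x) hκ ha0 ha1 hκa).trans ?_
    gcongr
    exact tailAffinity_anti (hw x).1 (hv x).1 hκ le_rfl (fun h => absurd h (lt_irrefl _)) (hvB x)
  refine (Finset.sum_le_sum fun x _ => mul_le_mul_of_nonneg_left (hrow x) (hP.1 x)).trans_eq ?_
  simp only [mul_sub, mul_one, Finset.sum_sub_distrib, hP.2, Finset.mul_sum, mul_left_comm (a / 2)]

theorem one_add_le_sum_mul_affinity (hP : P ∈ stdSimplex ℝ X) (hw : ∀ x, w x ∈ stdSimplex ℝ Y)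
    (hv : ∀ x, v x ∈ stdSimplex ℝ Y) (hwv : ∀ x y, P x ≠ 0 → w x y ≠ 0 → v x y ≠ 0)
    (hvB : ∀ x, v x ≤ B) (hκ : 0 < κ) (ha : 1 ≤ a) (hκa : a * κ ^ (1 - a) ≤ 1 / 2) :
    1 + (∑ x, P x * tailAffinity κ a (w x) B) / 2 ≤ ∑ x, P x * affinity a (w x) (v x) := by
  have hrow (x) : P x * (1 + tailAffinity κ a (w x) B / 2) ≤ P x * affinity a (w x) (v x) := by
    rcases eq_or_ne (P x) 0 with h0 | h0
    · simp [h0]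
    refine mul_le_mul_of_nonneg_left (le_trans ?_ (one_add_tailAffinity_le_affinity (hw x) (hv x)
      (fun y => hwv x y h0) hκ ha hκa)) (hP.1 x)
    gcongr
    exact tailAffinity_anti (hw x).1 (hv x).1 hκ ha (fun _ y => hwv x y h0) (hvB x)
  refine le_of_eq_of_le ?_ (Finset.sum_le_sum fun x _ => hrow x)
  simp only [mul_add, mul_one, Finset.sum_add_distrib, hP.2, mul_div_assoc', Finset.sum_div]

end Row

variable {W : Channel X Y} {α : ℝ≥0∞} {P : X → ℝ} {r₁ r₂ C e : ℝ}

theorem eventually_le_channelDiv_of_lt_one (h0 : α ≠ 0) (h1 : α < 1) (hP : P ∈ stdSimplex ℝ X)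
    (hr : r₁ * log 2 < r₂) (hC : ∀ b, 1 ≤ b → (b - 1) * r₂ - scaledInfo P (toMat W) b ≤ C)
    (he : C < e * log 2) :
    ∀ᶠ n : ℕ in atTop, ∀ N, IsSimulation N (n * r₁) →
      (exp (n * -(e * log 2)) : ℝ) ≤ channelDiv α (power W n) N := by
  have ha0 : 0 < α.toReal := ENNReal.toReal_pos h0 h1.ne_top
  have ha1 := toReal_lt_one h1
  set a := α.toReal
  obtain ⟨C', hCC', hC'e⟩ := exists_between he
  obtain ⟨δ, hδ, htail⟩ := eventually_exp_le_sum_mul_tailAffinity hP (toMat_mem W) le_rfl hr hC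
    (sub_pos.mpr hCC')
  filter_upwards [htail, eventually_mul_exp_le (mul_neg_of_pos_of_neg hδ (sub_neg.mpr ha1)) (2 / a),
    eventually_mul_exp_le (neg_lt_neg hC'e) (2 / a * (log 2 * (1 - a)))] with n htail hκ hexp N hN
  obtain ⟨Q, hQ, hNQ⟩ := hN.exists_le
  obtain ⟨B, hQB, hT⟩ := htail Q hQ
  rw [add_sub_cancel] at hT
  have hκa : exp (n * δ) ^ (a - 1) ≤ a / 2 := by
    rw [mul_zero, exp_zero, ← inv_div, inv_mul_le_one₀ (by positivity)] at hκ
    rwa [← exp_mul, mul_assoc]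
  refine le_iSup_of_le (ofVec _ (prodVec_mem hP n)) ((coe_le_renyiDiv_of_lt_one h0 h1
    (joint_ne_top _ _) (joint_ne_top _ _)).mpr ?_)
  rw [affinity_joint, toVec_ofVec, toMat_power]
  calc ∑ x, prodVec P n x * affinity a (prodMat (toMat W) n x) (toMat N x)
      ≤ 1 - a / 2 * ∑ x, prodVec P n x *
          tailAffinity (exp (n * δ)) 1 (prodMat (toMat W) n x) B :=
        sum_mul_affinity_le_one_sub (prodVec_mem hP n) (prodMat_mem (toMat_mem W) n) (toMat_mem N)
          (fun x y => (hNQ x y).trans (by rw [mul_assoc]; exact hQB y)) (exp_pos _) ha0 ha1 hκa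
    _ ≤ 1 - a / 2 * (2 / a * (log 2 * (1 - a)) * exp (n * -(e * log 2))) := by
        gcongr
        exact hexp.trans hT
    _ = 1 - -(exp (n * -(e * log 2)) * log 2 * (a - 1)) := by
        field_simp
        ring
    _ ≤ exp (exp (n * -(e * log 2)) * log 2 * (a - 1)) := by
        rw [sub_neg_eq_add, add_comm]
        exact add_one_le_exp _

theorem exp_le_one_add_two_mul {x : ℝ} (h0 : 0 ≤ x) (h1 : x ≤ 1) : exp x ≤ 1 + 2 * x := by
  have h := abs_exp_sub_one_le (x := x) (by rwa [abs_of_nonneg h0])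
  rw [abs_of_nonneg h0] at h
  linarith [le_abs_self (exp x - 1)]

theorem eventually_le_channelDiv_of_one_lt (h1 : 1 < α) (hT : α ≠ ∞) (hP : P ∈ stdSimplex ℝ X)
    (hr : r₁ * log 2 < r₂)
    (hC : ∀ b, α.toReal ≤ b → (b - 1) * r₂ - scaledInfo P (toMat W) b ≤ C)
    (he : C < e * log 2) (he0 : 0 < e) :
    ∀ᶠ n : ℕ in atTop, ∀ N, IsSimulation N (n * r₁) →
      (exp (n * -(e * log 2)) : ℝ) ≤ channelDiv α (power W n) N := by
  have h2 : 0 < log 2 := log_pos one_lt_two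
  have ha := one_lt_toReal h1 hT
  set a := α.toReal
  have : 0 < a - 1 := sub_pos.mpr ha
  obtain ⟨C', hCC', hC'e⟩ := exists_between he
  obtain ⟨δ, hδ, htail⟩ := eventually_exp_le_sum_mul_tailAffinity hP (toMat_mem W) ha.le hr hC
    (sub_pos.mpr hCC')
  filter_upwards [htail,
    eventually_mul_exp_le (mul_neg_of_pos_of_neg hδ (sub_neg.mpr ha)) (2 * a),
    eventually_mul_exp_le (neg_lt_neg hC'e) (4 * (log 2 * (a - 1))),
    eventually_mul_exp_le (neg_neg_of_pos (mul_pos he0 h2)) (log 2 * (a - 1))]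
    with n htail hκ hexp hsmall N hN
  obtain ⟨Q, hQ, hNQ⟩ := hN.exists_le
  obtain ⟨B, hQB, hT'⟩ := htail Q hQ
  rw [add_sub_cancel] at hT'
  have hκa : a * exp (n * δ) ^ (1 - a) ≤ 1 / 2 := by
    rw [mul_zero, exp_zero] at hκ
    rw [← exp_mul, mul_assoc (n : ℝ)]
    linarith
  refine le_iSup_of_le (ofVec _ (prodVec_mem hP n)) (coe_le_renyiDiv_of_one_lt h1 hT
    (joint_ne_top _ _) (joint_ne_top _ _) fun hac => ?_)
  have hsupp (x y) (hx : prodVec P n x ≠ 0) (hy : prodMat (toMat W) n x y ≠ 0) :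
      toMat N x y ≠ 0 :=
    (joint_ne_zero_iff.mp (hac (x, y) (joint_ne_zero_iff.mpr
      ⟨by rwa [toVec_ofVec], by rwa [toMat_power]⟩))).2
  rw [affinity_joint, toVec_ofVec, toMat_power]
  rw [mul_zero, exp_zero] at hsmall
  calc exp (exp (n * -(e * log 2)) * log 2 * (a - 1))
      ≤ 1 + 2 * (exp (n * -(e * log 2)) * log 2 * (a - 1)) :=
        exp_le_one_add_two_mul (by positivity) (by linarith)
    _ = 1 + 4 * (log 2 * (a - 1)) * exp (n * -(e * log 2)) / 2 := by ring
    _ ≤ 1 + (∑ x, prodVec P n x *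
          tailAffinity (exp (n * δ)) a (prodMat (toMat W) n x) B) / 2 := by
        gcongr
        exact hexp.trans hT'
    _ ≤ ∑ x, prodVec P n x * affinity a (prodMat (toMat W) n x) (toMat N x) :=
        one_add_le_sum_mul_affinity (prodVec_mem hP n) (prodMat_mem (toMat_mem W) n) (toMat_mem N)
          hsupp (fun x y => (hNQ x y).trans (by rw [mul_assoc]; exact hQB y)) (exp_pos _) ha.le hκa

theorem eventually_le_channelDiv (h0 : α ≠ 0) (hT : α ≠ ∞) (hP : P ∈ stdSimplex ℝ X)
    (hr : r₁ * log 2 < r₂)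
    (hC : ∀ b, max α.toReal 1 ≤ b → (b - 1) * r₂ - scaledInfo P (toMat W) b ≤ C)
    (he : C < e * log 2) (he0 : 0 < e) :
    ∀ᶠ n : ℕ in atTop, ∀ N, IsSimulation N (n * r₁) →
      (exp (n * -(e * log 2)) : ℝ) ≤ channelDiv α (power W n) N := by
  rcases lt_trichotomy α 1 with h1 | rfl | h1
  · rw [max_eq_right (toReal_lt_one h1).le] at hC
    exact eventually_le_channelDiv_of_lt_one h0 h1 hP hr hC he
  · rw [ENNReal.toReal_one, max_self] at hC
    have hhalf : (2⁻¹ : ℝ≥0∞) ≠ 0 := ENNReal.inv_ne_zero.mpr ENNReal.ofNat_ne_top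
    filter_upwards [eventually_le_channelDiv_of_lt_one hhalf ENNReal.one_half_lt_one hP hr hC he]
      with n h N hN
    exact (h N hN).trans (iSup_mono fun P => renyiDiv_le_renyiDiv_one (sum_joint P _)
      (joint_ne_top _ _) hhalf ENNReal.one_half_lt_one.le)
  · rw [max_eq_left (one_lt_toReal h1 hT).le] at hC
    exact eventually_le_channelDiv_of_one_lt h1 hT hP hr hC he he0

end Converse

section Reliability

variable {X Y : Type*} [Fintype X] [Fintype Y] {W : Channel X Y} {α β : ℝ≥0∞} {r : ℝ}

theorem exists_input_rate_of_lt_capacity_top [Nonempty X] (h : r < capacity ∞ W) :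
    ∃ P ∈ stdSimplex ℝ X, ∃ r' > r * log 2, ∃ C, ∀ b, 0 < b →
      (b - 1) * r' - scaledInfo P (toMat W) b ≤ C := by
  obtain ⟨P, hP, ξ, hξ, hs⟩ := exists_input_of_lt_capacity_top h
  obtain ⟨y, -⟩ := exists_pos_of_mem_stdSimplex (toMat_mem W (Classical.arbitrary X))
  have : Nonempty Y := ⟨y⟩
  obtain ⟨y₀, hy₀⟩ := Finite.exists_min fun y => P (ξ y)
  have hs0 : 0 < ∑ y, toMat W (ξ y) y := (exp_pos _).trans hs
  refine ⟨P, hP, log (∑ y, toMat W (ξ y) y), (lt_log_iff_exp_lt hs0).mpr hs,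
    -log (∑ y, toMat W (ξ y) y) - log (P (ξ y₀)), fun b hb => ?_⟩
  linarith [log_add_mul_log_le_scaledInfo hP (fun x => (toMat_mem W x).1) (hξ y₀) hy₀ hs0 hb]

theorem exists_convex_combination_le {c d e : ℝ} (h : c < e) :
    ∃ t : ℝ, 0 < t ∧ t ≤ 1 ∧ (1 - t) * c + t * d ≤ e := by
  have hlim : Tendsto (fun t : ℝ => (1 - t) * c + t * d) (𝓝[>] 0) (𝓝 c) :=
    tendsto_nhdsWithin_of_tendsto_nhds <| Continuous.tendsto' (by fun_prop) 0 c (by simp)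
  obtain ⟨t, hle, ht0, ht1⟩ :=
    ((hlim.eventually_le_const h).and (Ioc_mem_nhdsGT one_pos)).exists
  exact ⟨t, ht0, ht1, hle⟩

-- At the larger rate `r₀`, the input chosen for an order does at least as well there as `P₀`;
-- interpolating between `r` and `r₀` raises the rate while keeping the bound close to `C`.
theorem exists_rate_forall_order {w : X → Y → ℝ} {a r r₀ C C₀ C' : ℝ} {P₀ : X → ℝ} (hr : r < r₀)
    (h₀ : ∀ b, a ≤ b → (b - 1) * r₀ - scaledInfo P₀ w b ≤ C₀)
    (hC : C < C')
    (h : ∀ b, a ≤ b → ∃ P ∈ stdSimplex ℝ X, (b - 1) * r - scaledInfo P w b ≤ C ∧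
      scaledInfo P₀ w b ≤ scaledInfo P w b) :
    ∃ r' > r, ∀ b, a ≤ b → ∃ P ∈ stdSimplex ℝ X, (b - 1) * r' - scaledInfo P w b ≤ C' := by
  obtain ⟨t, ht0, ht1, ht⟩ := exists_convex_combination_le (d := C₀) hC
  refine ⟨(1 - t) * r + t * r₀, by nlinarith, fun b hb => ?_⟩
  obtain ⟨P, hP, hPC, hle⟩ := h b hb
  refine ⟨P, hP, le_trans ?_ ht⟩
  calc (b - 1) * ((1 - t) * r + t * r₀) - scaledInfo P w b
      = (1 - t) * ((b - 1) * r - scaledInfo P w b) + t * ((b - 1) * r₀ - scaledInfo P w b) := by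
        ring
    _ ≤ (1 - t) * C + t * C₀ :=
        add_le_add (mul_le_mul_of_nonneg_left hPC (sub_nonneg.mpr ht1))
          (mul_le_mul_of_nonneg_left ((sub_le_sub_left hle _).trans (h₀ b hb)) ht0.le)

theorem exists_optimal_input_of_mul_sub_capacity_le [Nonempty X] {C b : ℝ} (hC : 0 ≤ C)
    (hb : 1 ≤ b)
    (h : 1 < b → ((ENNReal.ofReal b : EReal) - 1) * (r - capacity (ENNReal.ofReal b) W) ≤ C) :
    ∃ P ∈ stdSimplex ℝ X, (b - 1) * (r * log 2) - scaledInfo P (toMat W) b ≤ C * log 2 ∧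
      ∀ P' ∈ stdSimplex ℝ X, scaledInfo P' (toMat W) b ≤ scaledInfo P (toMat W) b := by
  rcases hb.eq_or_lt with rfl | hb1
  · obtain ⟨P, hP⟩ : (stdSimplex ℝ X).Nonempty := stdSimplex_nonempty X
    refine ⟨P, hP, ?_, fun P' hP' => ?_⟩
    · rw [scaledInfo_one hP (toMat_mem W), sub_self, zero_mul, sub_zero]
      exact mul_nonneg hC (log_pos one_lt_two).le
    · rw [scaledInfo_one hP (toMat_mem W), scaledInfo_one hP' (toMat_mem W)]
  obtain ⟨P, hP, hcap, hmax⟩ :=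
    exists_capacity_eq (ENNReal.one_lt_ofReal.mpr hb1) ENNReal.ofReal_ne_top W
  have hterm := h hb1
  rw [mul_sub_capacity_eq (ENNReal.one_lt_ofReal.mpr hb1) ENNReal.ofReal_ne_top hcap,
    EReal.coe_le_coe_iff, div_le_iff₀ (log_pos one_lt_two)] at hterm
  rw [ENNReal.toReal_ofReal (by linarith)] at hterm hmax
  exact ⟨P, hP, hterm, hmax⟩

theorem reliability_le_of_forall_mul_sub_capacity_le [Nonempty X] {C : ℝ} (h0 : α ≠ 0)
    (hT : α ≠ ∞) (hr : r < capacity ∞ W) (hC : 0 ≤ C)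
    (h : ∀ β : ℝ≥0∞, α ≤ β → 1 < β → ((β : EReal) - 1) * (r - capacity β W) ≤ C) :
    reliability α W r ≤ C := by
  have h2 : 0 < log 2 := log_pos one_lt_two
  refine EReal.le_of_forall_lt_iff_le.mp fun e he => ?_
  have he : C < e := EReal.coe_lt_coe_iff.mp he
  obtain ⟨C', hCC', hC'e⟩ := exists_between ((mul_lt_mul_iff_left₀ h2).mpr he)
  obtain ⟨P₀, hP₀, r₀, hr₀, C₀, hC₀⟩ := exists_input_rate_of_lt_capacity_top hr
  have hone (b) (hb : max α.toReal 1 ≤ b) : 1 ≤ b := (le_max_right _ _).trans hb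
  obtain ⟨r₂, hr₂, hP⟩ := exists_rate_forall_order (a := max α.toReal 1) hr₀
    (fun b hb => hC₀ b (one_pos.trans_le (hone b hb))) hCC' fun b hb => by
      obtain ⟨P, hP, hPC, hmax⟩ := exists_optimal_input_of_mul_sub_capacity_le (W := W) hC
        (hone b hb) fun hb1 => h _ ((ENNReal.le_ofReal_iff_toReal_le hT (by linarith)).mpr
          ((le_max_left _ _).trans hb)) (ENNReal.one_lt_ofReal.mpr hb1)
      exact ⟨P, hP, hPC, hmax P₀ hP₀⟩
  obtain ⟨P, hP, hPC⟩ := exists_input_forall_order (toMat_mem W) (le_max_right _ _) hP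
  obtain ⟨r₁, hr₁, hr₁₂⟩ := exists_between ((lt_div_iff₀ h2).mpr hr₂)
  exact reliability_le hr₁ (eventually_le_channelDiv h0 hT hP ((lt_div_iff₀ h2).mp hr₁₂) hPC hC'e
    (hC.trans_lt he))

/-! ### Converse at orders zero and infinity -/

theorem reliability_nonpos_of_eventually_le {r' d : ℝ} (hr : r < r') (hd : 0 < d)
    (h : ∀ᶠ n : ℕ in atTop, ∀ N, IsSimulation N (n * r') → d ≤ channelDiv α (power W n) N) :
    reliability α W r ≤ 0 := by
  refine EReal.le_of_forall_lt_iff_le.mp fun e he => reliability_le hr ?_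
  have he : -(e * log 2) < 0 :=
    neg_neg_of_pos (mul_pos (EReal.coe_pos.mp he) (log_pos one_lt_two))
  filter_upwards [h, eventually_mul_exp_le he d⁻¹] with n h hexp N hN
  rw [mul_zero, exp_zero, inv_mul_le_one₀ hd] at hexp
  exact (EReal.coe_le_coe_iff.mpr hexp).trans (h N hN)

theorem le_channelDiv_top {N : Channel X Y} {P : X → ℝ} {ξ : Y → X} {c d : ℝ}
    (hP : P ∈ stdSimplex ℝ X) (hξ : ∀ y, 0 < P (ξ y)) (hN : IsSimulation N c)
    (h : exp ((c + d) * log 2) ≤ ∑ y, toMat W (ξ y) y) : d ≤ channelDiv ∞ W N := by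
  refine le_iSup_of_le (ofVec P hP) (le_of_not_gt fun hlt => ?_)
  obtain ⟨d', hd', hd'd⟩ := EReal.lt_iff_exists_real_btwn.mp hlt
  have hWN := renyiDiv_top_joint_le_coe.mp hd'.le
  rw [toVec_ofVec] at hWN
  obtain ⟨q, hq, hNq⟩ := hN.exists_le
  refine h.not_gt ?_
  calc ∑ y, toMat W (ξ y) y ≤ ∑ y, exp (d' * log 2) * (exp (c * log 2) * q y) :=
        Finset.sum_le_sum fun y _ => (hWN _ y (hξ y).ne').trans
          (mul_le_mul_of_nonneg_left (hNq _ y) (exp_pos _).le)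
    _ = exp ((c + d') * log 2) := by
        rw [← Finset.mul_sum, ← Finset.mul_sum, hq.2, mul_one, ← exp_add, ← add_mul, add_comm]
    _ < exp ((c + d) * log 2) := by
        gcongr
        exact EReal.coe_lt_coe_iff.mp hd'd

theorem reliability_top_nonpos [Nonempty X] (h : r < capacity ∞ W) : reliability ∞ W r ≤ 0 := by
  obtain ⟨P, hP, ξ, hξ, hs⟩ := exists_input_of_lt_capacity_top h
  have h2 : 0 < log 2 := log_pos one_lt_two
  have hs0 : 0 < ∑ y, toMat W (ξ y) y := (exp_pos _).trans hs
  rw [← lt_log_iff_exp_lt hs0, ← lt_div_iff₀ h2] at hs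
  obtain ⟨r₁, hr₁, hr₁s⟩ := exists_between hs
  refine reliability_nonpos_of_eventually_le hr₁ (sub_pos.mpr hr₁s) ?_
  filter_upwards [eventually_ge_atTop 1] with n hn N hN
  refine le_channelDiv_top (prodVec_mem hP n) (ξ := fun y i => ξ (y i))
    (fun y => Finset.prod_pos fun i _ => hξ (y i)) hN ?_
  have hsum : ∑ y, toMat (power W n) (fun i => ξ (y i)) y = (∑ y, toMat W (ξ y) y) ^ n := by
    rw [toMat_power, Fintype.sum_pow]
    rfl
  have hn : (1 : ℝ) ≤ n := Nat.one_le_cast.mpr hn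
  rw [hsum, ← exp_log (pow_pos hs0 n), log_pow, exp_le_exp, ← le_div_iff₀ h2, mul_div_assoc]
  nlinarith

theorem le_channelDiv_zero {N : Channel X Y} {P : X → ℝ} {c d : ℝ} (hP : P ∈ stdSimplex ℝ X)
    (hN : IsSimulation N c)
    (h : ∀ y, supportMass (toMat W · y) P ≤ exp (-((c + d) * log 2))) :
    d ≤ channelDiv 0 W N := by
  refine le_iSup_of_le (ofVec P hP) (coe_le_renyiDiv.mpr ?_)
  rw [fidelity_zero_joint, toVec_ofVec]
  refine ENNReal.ofReal_le_ofReal ?_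
  obtain ⟨q, hq, hNq⟩ := hN.exists_le
  calc ∑ x, P x * supportMass (toMat W x) (toMat N x)
      ≤ ∑ x, P x * supportMass (toMat W x) fun y => exp (c * log 2) * q y :=
        Finset.sum_le_sum fun x _ => mul_le_mul_of_nonneg_left (supportMass_mono (hNq x)) (hP.1 x)
    _ = ∑ y, exp (c * log 2) * q y * supportMass (toMat W · y) P := by
        simp only [supportMass, Finset.mul_sum]
        rw [Finset.sum_comm]
        refine Finset.sum_congr rfl fun y _ => Finset.sum_congr rfl fun x _ => ?_
        split_ifs <;> ring
    _ ≤ ∑ y, exp (c * log 2) * q y * exp (-((c + d) * log 2)) :=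
        Finset.sum_le_sum fun y _ =>
          mul_le_mul_of_nonneg_left (h y) (mul_nonneg (exp_pos _).le (hq.1 y))
    _ = exp (-(d * log 2)) := by
        rw [← Finset.sum_mul, ← Finset.mul_sum, hq.2, mul_one, ← exp_add]
        ring_nf

theorem reliability_zero_nonpos (h : r < capacity 0 W) : reliability 0 W r ≤ 0 := by
  obtain ⟨r₂, hr₂, P, hP, hmass⟩ := exists_input_of_lt_capacity_zero h
  obtain ⟨r₁, hr₁, hr₁₂⟩ := exists_between hr₂
  refine reliability_nonpos_of_eventually_le hr₁ (sub_pos.mpr hr₁₂) ?_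
  filter_upwards [eventually_ge_atTop 1] with n hn N hN
  refine le_channelDiv_zero (prodVec_mem hP n) hN fun y => ?_
  have hn : (1 : ℝ) ≤ n := Nat.one_le_cast.mpr hn
  calc supportMass (toMat (power W n) · y) (prodVec P n)
      = ∏ i, supportMass (toMat W · (y i)) P := by
        rw [toMat_power]
        exact supportMass_prod (fun y x => toMat W x y) P n y
    _ ≤ ∏ _i : Fin n, exp (-(r₂ * log 2)) := Finset.prod_le_prod
        (fun i _ => supportMass_nonneg hP.1) fun i _ => hmass (y i)
    _ = exp (n * -(r₂ * log 2)) := by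
        rw [Finset.prod_const, Finset.card_univ, Fintype.card_fin, ← exp_nat_mul]
    _ ≤ exp (-((n * r₁ + (r₂ - r₁)) * log 2)) := by
        rw [exp_le_exp, mul_neg, neg_le_neg_iff, ← mul_assoc]
        gcongr
        nlinarith

/-! ### The reliability function -/

theorem coe_ennreal_one_sub_one_mul (x : EReal) : (((1 : ℝ≥0∞) : EReal) - 1) * x = 0 := by
  rw [EReal.coe_ennreal_one, ← EReal.coe_one, ← EReal.coe_sub, sub_self, EReal.coe_zero, zero_mul]

theorem mul_sub_capacity_top (h : r < capacity ∞ W) :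
    (((∞ : ℝ≥0∞) : EReal) - 1) * (r - capacity ∞ W) = ⊥ := by
  rw [EReal.coe_ennreal_top, ← EReal.coe_one, EReal.top_sub_coe]
  exact EReal.top_mul_of_neg (EReal.sub_neg (Or.inl (EReal.coe_ne_top r))
    (Or.inl (EReal.coe_ne_bot r)) |>.mpr h)

theorem iSup_mul_sub_capacity_le_reliability [Nonempty X] (hr : 0 ≤ r) (hcap : r < capacity ∞ W)
    (h0 : α ≠ 0) {γ : ℝ≥0∞} (hαγ : α ≤ γ) (hγ : 1 ≤ γ) :
    ⨆ (β : ℝ≥0∞) (_ : γ ≤ β), ((β : EReal) - 1) * (r - capacity β W) ≤ reliability α W r := by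
  refine iSup₂_le fun β hβ => ?_
  rcases (hγ.trans hβ).eq_or_lt with rfl | h1
  · rw [coe_ennreal_one_sub_one_mul]
    exact reliability_nonneg hr
  rcases eq_or_ne β ∞ with rfl | hT
  · rw [mul_sub_capacity_top hcap]
    exact bot_le
  · exact mul_sub_capacity_le_reliability hr h0 (hαγ.trans hβ) h1 hT

theorem reliability_eq_iSup_of_le_one [Nonempty X] (hr : 0 ≤ r) (hcap : r < capacity ∞ W)
    (h0 : α ≠ 0) (h1 : α ≤ 1) :
    reliability α W r = ⨆ (β : ℝ≥0∞) (_ : 1 ≤ β), ((β : EReal) - 1) * (r - capacity β W) := by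
  refine le_antisymm (EReal.le_of_forall_lt_iff_le.mp fun C hC => ?_)
    (iSup_mul_sub_capacity_le_reliability hr hcap h0 h1 le_rfl)
  have hterm (β : ℝ≥0∞) (hβ : 1 ≤ β) : ((β : EReal) - 1) * (r - capacity β W) ≤ C :=
    (le_iSup₂ (f := fun (β : ℝ≥0∞) (_ : 1 ≤ β) => ((β : EReal) - 1) * (r - capacity β W))
      β hβ).trans hC.le
  have hC0 : 0 ≤ C := EReal.coe_nonneg.mp (coe_ennreal_one_sub_one_mul _ ▸ hterm 1 le_rfl)
  exact reliability_le_of_forall_mul_sub_capacity_le h0 (ne_top_of_le_ne_top ENNReal.one_ne_top h1)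
    hcap hC0 fun β _ hβ => hterm β hβ.le

theorem reliability_eq_max_of_one_lt [Nonempty X] (hr : 0 ≤ r) (hcap : r < capacity ∞ W)
    (h1 : 1 < α) :
    reliability α W r =
      max (⨆ (β : ℝ≥0∞) (_ : α ≤ β), ((β : EReal) - 1) * (r - capacity β W)) 0 := by
  have h0 : α ≠ 0 := (one_pos.trans h1).ne'
  refine le_antisymm ?_ (max_le (iSup_mul_sub_capacity_le_reliability hr hcap h0 le_rfl h1.le)
    (reliability_nonneg hr))
  rcases eq_or_ne α ∞ with rfl | hT
  · exact (reliability_top_nonpos hcap).trans (le_max_right _ _)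
  refine EReal.le_of_forall_lt_iff_le.mp fun C hC => ?_
  obtain ⟨hsup, hC0⟩ := max_le_iff.mp hC.le
  exact reliability_le_of_forall_mul_sub_capacity_le h0 hT hcap (EReal.coe_nonneg.mp hC0)
    fun β hβ _ => (iSup₂_le_iff.mp hsup) β hβ

end Reliability

end ChannelSimulation

end

theorem theorem2 {X Y : Type*} [Fintype X] [Nonempty X] [Fintype Y]
    (W : ChannelSimulation.Channel X Y) :
    (∀ r : ℝ, 0 ≤ r → (r : EReal) < ChannelSimulation.capacity ∞ W →
      (∀ α : ℝ≥0∞, 0 < α → α ≤ 1 →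
        ChannelSimulation.reliability α W r =
          ⨆ (β : ℝ≥0∞) (_ : 1 ≤ β),
            ((β : EReal) - 1) * ((r : EReal) - ChannelSimulation.capacity β W)) ∧
      (∀ α : ℝ≥0∞, 1 < α →
        ChannelSimulation.reliability α W r =
          max (⨆ (β : ℝ≥0∞) (_ : α ≤ β),
            ((β : EReal) - 1) * ((r : EReal) - ChannelSimulation.capacity β W)) 0)) ∧
    (∀ (r : ℝ) (α : ℝ≥0∞), ChannelSimulation.capacity ∞ W ≤ (r : EReal) →
      ChannelSimulation.reliability α W r = ⊤) ∧
    (∀ r : ℝ, ChannelSimulation.capacity 0 W < (r : EReal) →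
      ChannelSimulation.reliability 0 W r = ⊤) ∧
    (∀ r : ℝ, 0 ≤ r → (r : EReal) < ChannelSimulation.capacity 0 W →
      ChannelSimulation.reliability 0 W r = 0) := by
  open ChannelSimulation in
  exact ⟨fun r hr hcap =>
      ⟨fun _ h0 h1 => reliability_eq_iSup_of_le_one hr hcap h0.ne' h1,
        fun _ h1 => reliability_eq_max_of_one_lt hr hcap h1⟩,
    fun _ _ h => reliability_eq_top_of_capacity_top_le h,
    fun _ h => reliability_zero_eq_top h,
    fun _ hr h => le_antisymm (reliability_zero_nonpos h) (reliability_nonneg hr)⟩
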